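/- **Model.** A radio network is a simple connected undirected graph $G$ with $n\ge 1$ nodes and diameter $D$; one node $s$, the source, initially has a broadcast message. Nodes work in synchronous rounds, starting together. In each round a node transmits or listens, and a listening node hears a packet iff exactly one of its neighbors transmits; collisions are not distinguishable from silence. A labeling scheme assigns to each node of each network with a source a binary string, its label; its length is the maximum length of a label. A node initially knows only its label (and the message, if it is the source). A node is informed once it knows the message. Let $\mathrm{level}(v)=\mathrm{dist}(s,v)$; logarithms are to base 2. **Fast Broadcast Algorithm (nodes).** A label consists of 7 bits: $\mathit{Join}$, $\mathit{Lev}\in\{0,1,2\}$ (two bits), $\mathit{Stay}$, $\mathit{Go}$, $\mathit{Fast}$, $\mathit{Rescue}$. Rounds are grouped into blocks $r=0,1,2,\dots$ of five steps: Broadcast, Feedback, Go, Fast, Rescue. When a node becomes informed (the source: at the start) it joins the dominating set iff its $\mathit{Join}$ bit is 1. In block $r$: - In the steps Broadcast, Go, Fast and Rescue, uninformed nodes with $\mathit{Lev}\equiv r+1 \pmod 3$ accept the message if they hear it. - Broadcast: the nodes in the dominating set with $\mathit{Lev}\equiv r\pmod 3$ transmit the message. - Feedback: each node informed in the Broadcast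 step of this block, and having at least one of the bits $\mathit{Stay},\mathit{Go},\mathit{Fast},\mathit{Rescue}$ equal to 1, transmits these four bits. A node in the dominating set with $\mathit{Lev}\equiv r\pmod 3$ takes over the bits it hears (zeros if it hears none), and remains in the dominating set iff it received $\mathit{Stay}=1$. - Go, Fast, Rescue: a node which received in this block the bit $\mathit{Go}$, $\mathit{Fast}$ or $\mathit{Rescue}$ equal to 1 transmits the message in the step of that name. **Fast Broadcast Algorithm (labels).** For a rooted tree, the 2-height $h_2$ of a leaf is 0; if $m$ is the maximum 2-height of the children of $v$, then $h_2(v)=m$ if exactly one child attains $m$, and $h_2(v)=m+1$ otherwise. The edge between $v\neq s$ and its parent $p(v)$ is fast if $h_2(v)=h_2(p(v))$. A BFS spanning tree of $G$ with root $s$ is 2-height respecting if no two distinct nodes $u,u'$ on the same level with $h_2(u)=h_2(u')=h_2(p(u))=h_2(p(u'))$ have a common neighbor in $G$ on the preceding level. Given such a tree, let $$x(v)=3\bigl(\mathrm{level}(v)+30\lceil\log^2 n\rceil\,(h_2(s)-h_2(v))\bigr)+\bigl((\mathrm{level}(v)-1)\bmod 3\bigr).$$ Let $\mathbf{DOM}_r$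 be the set of the nodes with level $\equiv r\pmod 3$ that are in the dominating set at the beginning of block $r$. The labels follow the Fast Broadcast scheme if, for some 2-height respecting BFS tree of $G$ with root $s$: - $\mathit{Lev}(v)=\mathrm{level}(v)\bmod 3$ for each $v$. - For each $r$, $\mathbf{DOM}_r$ is an inclusion-minimal set of nodes informed before block $r$, on levels $\equiv r \pmod 3$, such that each node uninformed before block $r$ which has, on the preceding level, an informed neighbor, that level being $\equiv r\pmod 3$, has a neighbor in the set. - Each $v\in\mathbf{DOM}_r$ has a chosen feedback node in block $r$: a node uninformed before block $r$, on level $\mathrm{level}(v)+1$, whose only neighbor in $\mathbf{DOM}_r$ is $v$. The bits $\mathit{Stay},\mathit{Go},\mathit{Fast},\mathit{Rescue}$ of nodes which are never feedback nodes are 0. - The feedback node of $v\in\mathbf{DOM}_r$ in block $r$ has $\mathit{Stay}=1$ iff $v\in\mathbf{DOM}_{r+3}$; the scheme chooses its $\mathit{Go}$ bit. - Call $u\ne s$ *needy* if the edge between $u$ and $p(u)$ is fast and, at the beginning of block $x(u)$, $u$ is uninformed and $p(u)$ is informed. The feedback node of $v\in\mathbf{DOM}_r$ in block $r$ has $\mathit{Fast}=1$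 iff $v=p(u)$ for a needy $u$ with $x(u)=r$. For each needy $u$ with $p(u)\notin\mathbf{DOM}_{x(u)}$ one neighbor of $u$ in $\mathbf{DOM}_{x(u)}$ is chosen as its rescue node; the feedback node of $v\in\mathbf{DOM}_r$ in block $r$ has $\mathit{Rescue}=1$ iff $v$ is the rescue node of such a $u$ with $x(u)=r$. **Theorem.** There is a labeling scheme of length at most 7, computable in time polynomial in $n$, and there is a constant $C$, such that for every connected graph $G$ and every source $s$, the labels follow the Fast Broadcast scheme for a 2-height respecting BFS tree for which each node $v$ is informed by the end of block $x(v)$, and the Fast Broadcast Algorithm with these labels informs all nodes within $$C\cdot\bigl(D+\min(D,\log n)\cdot\log^2 n\bigr)$$ rounds. -/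

import Mathlib

/- ## Deterministic algorithms in labelled radio networks -/

/-- A deterministic broadcasting algorithm for nodes carrying binary strings as labels.  A node
starts with its own label and, if it is the source, with the broadcast message; it knows nothing
else.  All nodes start together, so the number `t` of the current round is available to them.
In round `t` a node in state `q` transmits the packet `send t q` (`none` means: it listens), and
then it moves to the state `recv t q p`, where `p` is what it has heard in this round.
`known q` is the broadcast message, if a node in state `q` has it. -/
structure RadioAlgorithm (M : Type) where
  State : Type
  Packet : Type
  init : List Bool → Option M → State
  send : ℕ → State → Option Packet
  recv : ℕ → State → Option Packet → State
  known : State → Option M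

open Classical in
/-- What `v` hears when each node `w` transmits `sent w`: a packet arrives exactly when `v` itself
is silent and precisely one neighbour of `v` transmits.  A collision is not distinguishable from
silence. -/
noncomputable def radioHeard {V P : Type} (G : SimpleGraph V) (sent : V → Option P) (v : V) :
    Option P :=
  if h : sent v = none ∧ ∃! w, G.Adj v w ∧ sent w ≠ none then sent h.2.choose else none

open Classical in
/-- The states of all nodes after the given number of rounds. -/
noncomputable def RadioAlgorithm.run {M V : Type} (A : RadioAlgorithm M) (G : SimpleGraph V)
    (label : V → List Bool) (s : V) (μ : M) : ℕ → V → A.State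
  | 0, v => A.init (label v) (if v = s then some μ else none)
  | t + 1, v => A.recv t (A.run G label s μ t v)
      (radioHeard G (fun w => A.send t (A.run G label s μ t w)) v)

/- ## The Fast Broadcast Algorithm, as executed by the nodes

A label consists of the seven bits Join, Lev (two bits), Stay, Go, Fast, Rescue. -/

def labelJoin (l : List Bool) : Bool := l.getD 0 false

def labelLev (l : List Bool) : ℕ := (l.getD 1 false).toNat + 2 * (l.getD 2 false).toNat

/-- The four bits which a feedback node passes on. -/
@[ext]
structure Orders where
  stay : Bool
  go : Bool
  fast : Bool
  rescue : Bool

def Orders.zero : Orders := ⟨false, false, false, false⟩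

def Orders.nonzero (o : Orders) : Bool := o.stay || o.go || o.fast || o.rescue

def labelOrders (l : List Bool) : Orders :=
  ⟨l.getD 3 false, l.getD 4 false, l.getD 5 false, l.getD 6 false⟩

/-- A transmission is either the broadcast message or the control bits of a feedback node. -/
inductive FBPacket (M : Type) where
  | message (μ : M)
  | control (o : Orders)

/-- The state of a node: its label, the broadcast message once it is known, whether the node is in
the dominating set, whether it was informed in the Broadcast step of the current block, just
completed, and the control bits received in the last block in which it was active. -/
structure FBState (M : Type) where
  label : List Bool
  msg : Option M
  dom : Bool
  fresh : Bool
  orders : Orders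

/-- Round `t` is step `t % 5` of block `t / 5`; the steps are `0` Broadcast, `1` Feedback, `2` Go,
`3` Fast, `4` Rescue.  In block `r` the dominating nodes with `Lev = r mod 3` are active. -/
def fbSend {M : Type} (t : ℕ) (q : FBState M) : Option (FBPacket M) :=
  let active : Bool := labelLev q.label == t / 5 % 3
  match q.msg with
  | none => none
  | some μ =>
    match t % 5 with
    | 0 => if active && q.dom then some (.message μ) else none
    | 1 => if q.fresh && (labelOrders q.label).nonzero then some (.control (labelOrders q.label))
           else none
    | 2 => if active && q.orders.go then some (.message μ) else none
    | 3 => if active && q.orders.fast then some (.message μ) else none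
    | _ => if active && q.orders.rescue then some (.message μ) else none

/-- The control bits contained in what has been heard (all zero if there are none). -/
def heardOrders {M : Type} : Option (FBPacket M) → Orders
  | some (.control o) => o
  | _ => Orders.zero

/-- In block `r` an uninformed node with `Lev = (r + 1) mod 3` accepts the broadcast message, and
then joins the dominating set if its Join bit is set.  In the Feedback step of block `r` a
dominating node with `Lev = r mod 3` accepts the bits of its feedback node; it stays in the
dominating set iff it hears `Stay = 1`. -/
def fbRecv {M : Type} (t : ℕ) (q : FBState M) (p : Option (FBPacket M)) : FBState M :=
  match q.msg, p with
  | none, some (.message μ) =>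
    if labelLev q.label = (t / 5 + 1) % 3 then
      { q with msg := some μ, dom := labelJoin q.label, fresh := t % 5 == 0 }
    else { q with fresh := false }
  | _, _ =>
    if t % 5 = 1 ∧ labelLev q.label = t / 5 % 3 then
      let o := if q.dom then heardOrders p else Orders.zero
      { q with orders := o, dom := o.stay, fresh := false }
    else { q with fresh := false }

/-- The Fast Broadcast Algorithm. -/
def fastBroadcast (M : Type) : RadioAlgorithm M where
  State := FBState M
  Packet := FBPacket M
  init := fun l m => ⟨l, m, m.isSome && labelJoin l, false, Orders.zero⟩
  send := fbSend
  recv := fbRecv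
  known := FBState.msg

/-- The state of `v` at the beginning of block `r`. -/
noncomputable def fbState {M V : Type} (G : SimpleGraph V) (label : V → List Bool) (s : V) (μ : M)
    (r : ℕ) (v : V) : FBState M :=
  (fastBroadcast M).run G label s μ (5 * r) v

/-- `v` is informed before block `r`. -/
def InformedBefore {M V : Type} (G : SimpleGraph V) (label : V → List Bool) (s : V) (μ : M)
    (r : ℕ) (v : V) : Prop :=
  (fbState G label s μ r v).msg ≠ none

/-- The dominating set of block `r`: its members at the levels which are active in block `r`. -/
def domSet {M V : Type} (G : SimpleGraph V) (label : V → List Bool) (s : V) (μ : M) (r : ℕ) :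
    Set V :=
  {v | (fbState G label s μ r v).dom = true ∧ G.dist s v % 3 = r % 3}

/-- `S` consists of informed nodes on the levels active in block `r`, and it covers each uninformed
node which has an informed neighbour on the preceding level, this level being active. -/
def Dominates {M V : Type} (G : SimpleGraph V) (label : V → List Bool) (s : V) (μ : M) (r : ℕ)
    (S : Set V) : Prop :=
  (∀ v ∈ S, InformedBefore G label s μ r v ∧ G.dist s v % 3 = r % 3) ∧
  ∀ u w, ¬ InformedBefore G label s μ r u → InformedBefore G label s μ r w → G.Adj w u →
    G.dist s u = G.dist s w + 1 → G.dist s w % 3 = r % 3 → ∃ w' ∈ S, G.Adj w' u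

/- ## 2-height respecting trees -/

/-- `parent` is the parent map of a BFS spanning tree of `G` with root `s` (`parent s` is set to `s`
by convention). -/
structure IsBFSTree {V : Type} (G : SimpleGraph V) (s : V) (parent : V → V) : Prop where
  root : parent s = s
  adj : ∀ v, v ≠ s → G.Adj (parent v) v
  level : ∀ v, v ≠ s → G.dist s v = G.dist s (parent v) + 1

def IsChild {V : Type} (s : V) (parent : V → V) (u v : V) : Prop := u ≠ s ∧ parent u = v

/-- `h` is the 2-height function of the rooted tree given by `s` and `parent`. -/
structure IsTwoHeight {V : Type} (s : V) (parent : V → V) (h : V → ℕ) : Prop where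
  leaf : ∀ v, (∀ u, ¬ IsChild s parent u v) → h v = 0
  unique : ∀ v u, IsChild s parent u v →
    (∀ w, IsChild s parent w v → w ≠ u → h w < h u) → h v = h u
  tie : ∀ v u u', IsChild s parent u v → IsChild s parent u' v → u ≠ u' → h u = h u' →
    (∀ w, IsChild s parent w v → h w ≤ h u) → h v = h u + 1

/-- The edge between `v` and its parent is fast. -/
def IsFastEdge {V : Type} (s : V) (parent : V → V) (h : V → ℕ) (v : V) : Prop :=
  v ≠ s ∧ h v = h (parent v)

/-- `parent`, with 2-height function `h`, is a 2-height respecting tree of `G` with root `s`. -/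
structure IsTwoHRT {V : Type} (G : SimpleGraph V) (s : V) (parent : V → V) (h : V → ℕ) :
    Prop where
  bfs : IsBFSTree G s parent
  height : IsTwoHeight s parent h
  respecting : ∀ u u', u ≠ u' → IsFastEdge s parent h u → IsFastEdge s parent h u' →
    G.dist s u = G.dist s u' → h u = h u' →
    ¬ ∃ v, G.Adj v u ∧ G.Adj v u' ∧ G.dist s u = G.dist s v + 1

/- ## The labeling scheme of the Fast Broadcast Algorithm -/

/-- The ultimate block number
`3 (level v + 30 ⌈log² n⌉ (h root - h v)) + ((level v - 1) mod 3)`. -/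
noncomputable def ultimateBlock {V : Type} [Fintype V] (G : SimpleGraph V) (s : V) (h : V → ℕ)
    (v : V) : ℕ :=
  3 * (G.dist s v + 30 * ⌈(Real.logb 2 (Fintype.card V)) ^ 2⌉₊ * (h s - h v))
    + (G.dist s v + 2) % 3

/-- `v` asks for help in its ultimate block: it is joined to its parent by a fast edge, and at the
beginning of this block it is uninformed while its parent is informed. -/
def NeedsHelp {M V : Type} [Fintype V] (G : SimpleGraph V) (label : V → List Bool) (s : V) (μ : M)
    (parent : V → V) (h : V → ℕ) (v : V) : Prop :=
  IsFastEdge s parent h v ∧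
  ¬ InformedBefore G label s μ (ultimateBlock G s h v) v ∧
  InformedBefore G label s μ (ultimateBlock G s h v) (parent v)

/-- The labels obey the rules of the Fast Broadcast Algorithm with respect to the tree `parent`,
the feedback nodes `fb r v` of `v` in block `r`, and the rescue nodes `rescuer v` of `v`. -/
structure FollowsFastScheme {M V : Type} [Fintype V] (G : SimpleGraph V) (label : V → List Bool)
    (s : V) (μ : M) (parent : V → V) (h : V → ℕ) (fb : ℕ → V → V) (rescuer : V → V) : Prop where
  tree : IsTwoHRT G s parent h
  lev : ∀ v, labelLev (label v) = G.dist s v % 3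
  dominating : ∀ r, Minimal (Dominates G label s μ r) (domSet G label s μ r)
  /-- A feedback node of `v` is informed by `v` in the Broadcast step: it is an uninformed node on
  the next level which has no other neighbour in the dominating set. -/
  feedback : ∀ r, ∀ v ∈ domSet G label s μ r,
    ¬ InformedBefore G label s μ r (fb r v) ∧ G.dist s (fb r v) = G.dist s v + 1 ∧
    ∀ w ∈ domSet G label s μ r, G.Adj w (fb r v) ↔ w = v
  silent : ∀ u, (∀ r, ∀ v ∈ domSet G label s μ r, fb r v ≠ u) →
    labelOrders (label u) = Orders.zero
  stay : ∀ r, ∀ v ∈ domSet G label s μ r,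
    ((labelOrders (label (fb r v))).stay = true ↔ v ∈ domSet G label s μ (r + 3))
  fast : ∀ r, ∀ v ∈ domSet G label s μ r,
    ((labelOrders (label (fb r v))).fast = true ↔
      ∃ u, NeedsHelp G label s μ parent h u ∧ ultimateBlock G s h u = r ∧ parent u = v)
  /-- If the parent of `u` has left the dominating set, one neighbour of `u` in it stands in. -/
  rescuer_mem : ∀ u, NeedsHelp G label s μ parent h u →
    parent u ∉ domSet G label s μ (ultimateBlock G s h u) →
    rescuer u ∈ domSet G label s μ (ultimateBlock G s h u) ∧ G.Adj (rescuer u) u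
  rescue : ∀ r, ∀ v ∈ domSet G label s μ r,
    ((labelOrders (label (fb r v))).rescue = true ↔
      ∃ u, NeedsHelp G label s μ parent h u ∧ ultimateBlock G s h u = r ∧
        parent u ∉ domSet G label s μ r ∧ rescuer u = v)

/- ## Polynomial time

Programs on binary trees, in the style of the WHILE language: the basic operations are the
constant `nil`, `cons`, `head`, `tail` and the test for `nil`.  Every counted step touches a bounded
number of memory cells of a machine which stores the trees by pointers. -/

inductive Data where
  | nil
  | cons (a b : Data)

def Data.head : Data → Data
  | .nil => .nil
  | .cons a _ => a

def Data.tail : Data → Data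
  | .nil => .nil
  | .cons _ b => b

inductive Prog where
  | id
  | nil
  | head
  | tail
  | pair (f g : Prog)
  | seq (f g : Prog)
  | cond (c f g : Prog)
  | loop (f : Prog)

/-- `Runs p x y t`: on input `x` the program `p` halts with output `y` after `t` steps.  Here
`cond c f g` runs `f` if the output of `c` is not `nil` and `g` otherwise, and `loop f` repeats
`x := f x` as long as the head of `x` is not `nil`. -/
inductive Runs : Prog → Data → Data → ℕ → Prop
  | id (x) : Runs .id x x 1
  | nil (x) : Runs .nil x .nil 1
  | head (x) : Runs .head x x.head 1
  | tail (x) : Runs .tail x x.tail 1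
  | pair {f g x a b m n} : Runs f x a m → Runs g x b n →
      Runs (.pair f g) x (.cons a b) (m + n + 1)
  | seq {f g x y z m n} : Runs f x y m → Runs g y z n → Runs (.seq f g) x z (m + n + 1)
  | cond_true {c f g x b y m n} : Runs c x b m → b ≠ .nil → Runs f x y n →
      Runs (.cond c f g) x y (m + n + 1)
  | cond_false {c f g x y m n} : Runs c x .nil m → Runs g x y n →
      Runs (.cond c f g) x y (m + n + 1)
  | loop_stop {f x} : x.head = .nil → Runs (.loop f) x x 1
  | loop_step {f x y z m n} : x.head ≠ .nil → Runs f x y m → Runs (.loop f) y z n →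
      Runs (.loop f) x z (m + n + 1)

def Data.ofBool : Bool → Data
  | false => .nil
  | true => .cons .nil .nil

def Data.ofList : List Data → Data
  | [] => .nil
  | a :: l => .cons a (Data.ofList l)

open Classical in
/-- A graph with nodes `0, …, n - 1` and a source, given by its adjacency matrix, row by row, and
by the characteristic vector of the source. -/
noncomputable def encodeNetwork {n : ℕ} (G : SimpleGraph (Fin n)) (s : Fin n) : Data :=
  .cons
    (.ofList (List.ofFn fun i => .ofList (List.ofFn fun j => .ofBool (decide (G.Adj i j)))))
    (.ofList (List.ofFn fun i => .ofBool (decide (i = s))))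

/-- The list of the labels of the nodes `0, …, n - 1`. -/
def encodeLabels {n : ℕ} (label : Fin n → List Bool) : Data :=
  .ofList (List.ofFn fun i => .ofList ((label i).map Data.ofBool))

/-- A labeling scheme assigns labels to the nodes of each network with a distinguished source. It
is constructive if a program finds the labels in time polynomial in the number of nodes. -/
def IsPolyTimeScheme (L : (n : ℕ) → SimpleGraph (Fin n) → Fin n → Fin n → List Bool) : Prop :=
  ∃ (p : Prog) (q : Polynomial ℕ), ∀ (n : ℕ) (G : SimpleGraph (Fin n)) (s : Fin n), G.Connected →
    ∃ t : ℕ, t ≤ q.eval n ∧ Runs p (encodeNetwork G s) (encodeLabels (L n G s)) t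

/-! The labels are found by simulating the execution that they are to enforce. The Fast and Rescue
bits all stay 0: the freely chosen Go bits alone inform every node before its ultimate block, so
that no node is ever needy.

Feedback. As `DOM_r` is inclusion-minimal, each of its nodes `v` has a private node, uninformed, on
the next level and without other neighbours in `DOM_r`. The Broadcast step informs this node, and it
can then tell `v` its Stay and Go bits. A node is informed only once, so it serves a single pair
`(r, v)` (`Schedule.feedback_inj`), and four bits in its label suffice. Every execution of the form
`Schedule` can therefore be prescribed by labels (`Prescribes`), and the nodes then carry it out
(`Schedule.blockInv`).

Tree. Parents are assigned greedily: among the nodes that still could get children, one on the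
deepest level and there with the largest prospective 2-height takes all its free children. If two
nodes violated the respecting condition, their common neighbour would have had a larger prospective
height than the node chosen (`TreeInv.step`). Moreover `2 ^ h s ≤ n`, and `h s` is at most the
largest level.

Go steps. Blocks with `r % 6 < 3` are fast, the others slow; every level is active once in each half
of a period of six. In a fast block the Go step serves the nodes below fast edges that are due in
the next block. All such nodes near one transmitter have the same level and 2-height, so the
respecting property leaves only one of them, and it hears a single transmitter. In a slow block the
uninformed nodes of the receiving levels are treated in batches. Some subset of `DOM_r` informs at
least the fraction `1 / m` of a batch, `m = ⌊log₂ n⌋ + 1` (`exists_spokesmen`, a harmonic sum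
argument), so a batch is finished after `m²` slow blocks (`eq_zero_of_decay`). A node waits for at
most one batch before its own: `18 m²` blocks suffice (`slow_wait`).

Time. On a path of the tree from the source, fast edges cost about two blocks each, other edges `18
m²` blocks, and each of the latter lowers the 2-height. Hence `v` is informed before block `due v`
(`inf_due`), at most `2 level v + 18 m² (h s - h v)`. This is below the ultimate block and gives the
bound on the rounds. The simulation consists of loops of polynomial length over tables of polynomial
size, which is what the calculus of `PolyTime` records. -/

section polyTime
open Polynomial

/-! ### Polynomial-time functions -/

/-- The number of constructors of a tree. -/
def Data.size : Data → ℕ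
  | .nil => 1
  | .cons a b => 1 + a.size + b.size

/-- The length of the right spine of a tree. -/
def Data.spine : Data → ℕ
  | .nil => 0
  | .cons _ b => b.spine + 1

class Enc (α : Type) where
  enc : α → Data

open Enc

instance : Enc Bool := ⟨Data.ofBool⟩
-- Numbers are written in unary: they can then serve directly as loop counters, and size and value
-- agree up to a constant factor.
instance : Enc ℕ := ⟨fun n => Data.ofList (List.replicate n .nil)⟩
instance {α β : Type} [Enc α] [Enc β] : Enc (α × β) := ⟨fun x => .cons (enc x.1) (enc x.2)⟩
instance {α : Type} [Enc α] : Enc (List α) := ⟨fun l => Data.ofList (l.map enc)⟩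

/-- The size of the encoding. -/
def esize {α : Type} [Enc α] (x : α) : ℕ := (enc x).size

section
variable {α β γ δ : Type} [Enc α] [Enc β] [Enc γ] [Enc δ]

@[simp] theorem enc_false : enc false = Data.nil := rfl
@[simp] theorem enc_true : enc true = Data.cons .nil .nil := rfl
@[simp] theorem enc_zero : enc 0 = Data.nil := rfl
@[simp] theorem enc_succ (n : ℕ) : enc (n + 1) = Data.cons .nil (enc n) := rfl
@[simp] theorem enc_nil : enc ([] : List α) = Data.nil := rfl
@[simp] theorem enc_cons (a : α) (l : List α) : enc (a :: l) = Data.cons (enc a) (enc l) := rfl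
@[simp] theorem enc_pair (a : α) (b : β) : enc (a, b) = Data.cons (enc a) (enc b) := rfl

@[simp] theorem spine_nat (n : ℕ) : (enc n).spine = n := by
  induction n with
  | zero => rfl
  | succ n ih => simp [Data.spine, ih]

@[simp] theorem spine_list (l : List α) : (enc l).spine = l.length := by
  induction l with
  | nil => rfl
  | cons a l ih => simp [Data.spine, ih]

theorem Data.spine_lt_size (d : Data) : d.spine < d.size := by
  induction d with
  | nil => simp [Data.spine, Data.size]
  | cons a b _ ih => simp only [Data.spine, Data.size]; omega

theorem esize_bool (b : Bool) : esize b ≤ 3 := by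
  cases b <;> simp [esize, Data.size]

@[simp] theorem esize_nat (n : ℕ) : esize n = 2 * n + 1 := by
  induction n with
  | zero => simp [esize, Data.size]
  | succ n ih => simp only [esize, enc_succ, Data.size] at ih ⊢; omega

@[simp] theorem esize_pair (a : α) (b : β) : esize (a, b) = 1 + esize a + esize b := rfl
@[simp] theorem esize_nil : esize ([] : List α) = 1 := rfl
@[simp] theorem esize_cons (a : α) (l : List α) : esize (a :: l) = 1 + esize a + esize l := rfl

theorem esize_fst (x : α × β) : esize x.1 ≤ esize x := by
  obtain ⟨a, b⟩ := x; simp only [esize_pair]; omega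

theorem esize_snd (x : α × β) : esize x.2 ≤ esize x := by
  obtain ⟨a, b⟩ := x; simp only [esize_pair]; omega

theorem length_le_esize (l : List α) : l.length ≤ esize l := by
  rw [← spine_list]; exact (Data.spine_lt_size _).le

theorem esize_list_le {l : List α} {B : ℕ} (h : ∀ a ∈ l, esize a ≤ B) :
    esize l ≤ l.length * (B + 1) + 1 := by
  induction l with
  | nil => simp
  | cons a l ih =>
    have h1 := h a (by simp)
    have h2 := ih fun b hb => h b (by simp [hb])
    simp only [esize_cons, List.length_cons, add_mul]
    omega

theorem eval_nat_mono (P : ℕ[X]) {a b : ℕ} (h : a ≤ b) : P.eval a ≤ P.eval b := by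
  induction P using Polynomial.induction_on' with
  | add p q hp hq => simpa using add_le_add hp hq
  | monomial n c => simpa using Nat.mul_le_mul_left c (Nat.pow_le_pow_left h n)

/-- `f` is computed by a program whose running time is polynomial in the size of the input, and
the size of the output is polynomial as well. -/
@[fun_prop]
def PolyTime (f : α → β) : Prop :=
  ∃ (p : Prog) (P : ℕ[X]), ∀ x, ∃ t, Runs p (enc x) (enc (f x)) t ∧
    t ≤ P.eval (esize x) ∧ esize (f x) ≤ P.eval (esize x)

theorem PolyTime.size_le {f : α → β} (hf : PolyTime f) :
    ∃ P : ℕ[X], ∀ x, esize (f x) ≤ P.eval (esize x) := by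
  obtain ⟨p, P, h⟩ := hf
  exact ⟨P, fun x => (h x).elim fun t ht => ht.2.2⟩

@[fun_prop]
theorem PolyTime.id : PolyTime (fun x : α => x) :=
  ⟨.id, X + 1, fun x => ⟨1, .id _, by simp, by simp⟩⟩

theorem exists_runs_const (d : Data) : ∃ p t, ∀ x, Runs p x d t := by
  induction d with
  | nil => exact ⟨.nil, 1, fun x => .nil x⟩
  | cons a b iha ihb =>
    obtain ⟨p, t, hp⟩ := iha
    obtain ⟨q, u, hq⟩ := ihb
    exact ⟨.pair p q, t + u + 1, fun x => .pair (hp x) (hq x)⟩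

@[fun_prop]
theorem PolyTime.const (b : β) : PolyTime (fun _ : α => b) := by
  obtain ⟨p, t, hp⟩ := exists_runs_const (enc b)
  exact ⟨p, C (t + esize b), fun x => ⟨t, hp _, by simp, by simp⟩⟩

@[fun_prop]
-- The size clause of `PolyTime` is what makes composition work. It does not follow from the time
-- bound: iterating `pair id id` doubles the tree in each round at constant cost.
theorem PolyTime.comp {f : β → γ} {g : α → β} (hf : PolyTime f) (hg : PolyTime g) :
    PolyTime (fun x => f (g x)) := by
  obtain ⟨p, P, hp⟩ := hf
  obtain ⟨q, Q, hq⟩ := hg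
  refine ⟨.seq q p, Q + P.comp Q + 1, fun x => ?_⟩
  obtain ⟨t, h1, h2, h3⟩ := hq x
  obtain ⟨u, h4, h5, h6⟩ := hp (g x)
  have h7 := eval_nat_mono P h3
  refine ⟨_, .seq h1 h4, ?_, ?_⟩ <;> simp only [eval_add, eval_comp, eval_one] <;> omega

@[fun_prop]
theorem PolyTime.prodMk {f : α → β} {g : α → γ} (hf : PolyTime f) (hg : PolyTime g) :
    PolyTime (fun x => (f x, g x)) := by
  obtain ⟨p, P, hp⟩ := hf
  obtain ⟨q, Q, hq⟩ := hg
  refine ⟨.pair p q, P + Q + 1, fun x => ?_⟩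
  obtain ⟨t, h1, h2, h3⟩ := hq x
  obtain ⟨u, h4, h5, h6⟩ := hp x
  refine ⟨_, .pair h4 h1, ?_, ?_⟩ <;> simp only [eval_add, eval_one, esize_pair] <;> omega

@[fun_prop]
theorem PolyTime.fst {f : α → β × γ} (hf : PolyTime f) : PolyTime (fun x => (f x).1) := by
  refine PolyTime.comp (f := Prod.fst) ⟨.head, X + 1, fun x => ⟨1, .head _, by simp, ?_⟩⟩ hf
  have := esize_fst x
  simp only [eval_add, eval_X, eval_one]; omega

@[fun_prop]
theorem PolyTime.snd {f : α → β × γ} (hf : PolyTime f) : PolyTime (fun x => (f x).2) := by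
  refine PolyTime.comp (f := Prod.snd) ⟨.tail, X + 1, fun x => ⟨1, .tail _, by simp, ?_⟩⟩ hf
  have := esize_snd x
  simp only [eval_add, eval_X, eval_one]; omega

@[fun_prop]
theorem PolyTime.ite {c : α → Bool} {f g : α → β} (hc : PolyTime c) (hf : PolyTime f)
    (hg : PolyTime g) : PolyTime (fun x => if c x = true then f x else g x) := by
  obtain ⟨pc, Pc, hc⟩ := hc
  obtain ⟨p, P, hp⟩ := hf
  obtain ⟨q, Q, hq⟩ := hg
  refine ⟨.cond pc p q, Pc + P + Q + 1, fun x => ?_⟩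
  obtain ⟨t, h1, h2, h3⟩ := hq x
  obtain ⟨u, h4, h5, h6⟩ := hp x
  obtain ⟨v, h7, h8, h9⟩ := hc x
  cases hb : c x
  · rw [hb] at h7
    refine ⟨_, .cond_false h7 (by simpa [hb] using h1), ?_, ?_⟩ <;>
      simp only [eval_add, eval_one, hb, Bool.false_eq_true, if_false] <;> omega
  · rw [hb] at h7
    refine ⟨_, .cond_true h7 (by simp) (by simpa [hb] using h4), ?_, ?_⟩ <;>
      simp only [eval_add, eval_one, hb, if_true] <;> omega

@[fun_prop]
theorem PolyTime.and {f g : α → Bool} (hf : PolyTime f) (hg : PolyTime g) :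
    PolyTime (fun x => f x && g x) := by
  have := hf.ite hg (PolyTime.const false)
  convert this using 2 with x
  cases f x <;> simp

@[fun_prop]
theorem PolyTime.or {f g : α → Bool} (hf : PolyTime f) (hg : PolyTime g) :
    PolyTime (fun x => f x || g x) := by
  have := hf.ite (PolyTime.const true) hg
  convert this using 2 with x
  cases f x <;> simp

@[fun_prop]
theorem PolyTime.not {f : α → Bool} (hf : PolyTime f) : PolyTime (fun x => !f x) := by
  have := hf.ite (PolyTime.const false) (PolyTime.const true)
  convert this using 2 with x
  cases f x <;> simp

@[fun_prop]
theorem PolyTime.succ {f : α → ℕ} (hf : PolyTime f) : PolyTime (fun x => f x + 1) := by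
  refine PolyTime.comp (f := fun n => n + 1) ⟨.pair .nil .id, X + 3, fun x => ⟨3, .pair (.nil _) (.id _), by simp, ?_⟩⟩ hf
  simp only [eval_add, eval_X, esize_nat, eval_ofNat]; omega

@[fun_prop]
theorem PolyTime.cons {f : α → β} {g : α → List β} (hf : PolyTime f) (hg : PolyTime g) :
    PolyTime (fun x => f x :: g x) := by
  obtain ⟨p, P, hp⟩ := hf.prodMk hg
  exact ⟨p, P, hp⟩

@[fun_prop]
theorem PolyTime.tail {f : α → List β} (hf : PolyTime f) : PolyTime (fun x => (f x).tail) := by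
  refine PolyTime.comp (f := List.tail) ⟨.tail, X + 1, fun x => ⟨1, ?_, by simp, ?_⟩⟩ hf
  · cases x <;> exact .tail _
  · cases x
    · simp
    · simp only [List.tail_cons, esize_cons, eval_add, eval_X, eval_one]; omega

@[fun_prop]
theorem PolyTime.pred {f : α → ℕ} (hf : PolyTime f) : PolyTime (fun x => (f x).pred) := by
  refine PolyTime.comp (f := Nat.pred) ⟨.tail, X + 1, fun x => ⟨1, ?_, by simp, ?_⟩⟩ hf
  · cases x <;> exact .tail _
  · cases x <;> simp; omega

/-- The head of `nil` is `nil`, so the program returns the default value for free if this is encoded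
by `nil`. -/
theorem PolyTime.headD {f : α → List β} {d : β} (hd : enc d = .nil) (hf : PolyTime f) :
    PolyTime (fun x => (f x).headD d) := by
  refine PolyTime.comp (f := fun l : List β => l.headD d)
    ⟨.head, X + 1, fun x => ⟨1, ?_, by simp, ?_⟩⟩ hf
  · cases x with
    | nil =>
      change Runs _ _ (enc d) _
      rw [hd]
      exact .head _
    | cons a l => exact .head _
  · cases x with
    | nil => simp [esize, hd]
    | cons a l => simp; omega

/-- Whether a number is positive. -/
@[fun_prop]
theorem PolyTime.pos {f : α → ℕ} (hf : PolyTime f) : PolyTime (fun x => decide (0 < f x)) := by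
  refine PolyTime.comp (f := fun n : ℕ => decide (0 < n))
    ⟨.cond .id (.pair .nil .nil) .nil, 10, fun x => ?_⟩ hf
  cases x with
  | zero => exact ⟨_, .cond_false (.id _) (.nil _), by simp, (esize_bool _).trans (by simp)⟩
  | succ n =>
    refine ⟨1 + (1 + 1 + 1) + 1, .cond_true (.id _) (by simp) ?_, by simp,
      (esize_bool _).trans (by simp)⟩
    simpa using Runs.pair (.nil _) (.nil _)

/-- Iteration of a function which may use the number of the round. -/
def loopN {β : Type} (f : ℕ → β → β) (b : β) : ℕ → β
  | 0 => b
  | k + 1 => f k (loopN f b k)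

/-- The state is `(counter, (input, (round, value)))`. One pass drops a cell of the counter, adds a
cell to the round number and applies `p`; the bookkeeping takes 18 steps. -/
theorem runs_loop_body {p : Prog} {x : Data} {k : ℕ} {b c : β} {d e : Data} {t : ℕ}
    (h : Runs p (.cons x (.cons (enc k) (enc b))) (enc c) t) :
    Runs (.pair (.seq .head .tail) (.pair (.seq .tail .head)
      (.pair (.pair .nil (.seq .tail (.seq .tail .head))) (.seq .tail p))))
      (.cons (.cons d e) (.cons x (.cons (enc k) (enc b))))
      (.cons e (.cons x (.cons (enc (k + 1)) (enc c)))) (t + 18) := by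
  have h1 := Runs.seq (Runs.head (.cons (.cons d e) (.cons x (.cons (enc k) (enc b))))) (.tail _)
  have h2 := Runs.seq (Runs.tail (.cons (.cons d e) (.cons x (.cons (enc k) (enc b))))) (.head _)
  have h3 := Runs.pair (.nil _) <| Runs.seq
    (Runs.tail (.cons (.cons d e) (.cons x (.cons (enc k) (enc b))))) (.seq (.tail _) (.head _))
  have h4 := Runs.seq (Runs.tail (.cons (.cons d e) (.cons x (.cons (enc k) (enc b))))) h
  have := h1.pair (h2.pair (h3.pair h4))
  refine cast ?_ this
  congr 1
  omega

/-- Only the spine of the counter `e` matters, so any list can drive a loop. The start `j` is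
arbitrary for the sake of the induction; 19 is the overhead of the body plus one step for the loop
itself. -/
theorem runs_loop {p : Prog} {x : Data} {f : ℕ → β → β} {b : β} {B : ℕ} {e : Data} {j : ℕ}
    (h : ∀ k < j + e.spine, ∃ t ≤ B,
      Runs p (.cons x (.cons (enc k) (enc (loopN f b k)))) (enc (loopN f b (k + 1))) t) :
    ∃ t ≤ e.spine * (B + 19) + 1, Runs (.loop (.pair (.seq .head .tail) (.pair (.seq .tail .head)
      (.pair (.pair .nil (.seq .tail (.seq .tail .head))) (.seq .tail p)))))
      (.cons e (.cons x (.cons (enc j) (enc (loopN f b j)))))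
      (.cons .nil (.cons x (.cons (enc (j + e.spine)) (enc (loopN f b (j + e.spine)))))) t := by
  induction e generalizing j with
  | nil => exact ⟨1, by simp, by constructor; rfl⟩
  | cons d e _ ih =>
    simp only [Data.spine] at h ⊢
    obtain ⟨t, ht, h1⟩ := h j (by omega)
    obtain ⟨u, hu, h2⟩ := ih (j := j + 1) (fun k hk => h k (by omega))
    rw [show j + (e.spine + 1) = j + 1 + e.spine by ring]
    exact ⟨_, by linarith, .loop_step (by simp [Data.head]) (runs_loop_body h1) h2⟩

/-- The bound `Q` on all intermediate values has to be given: a body that is polynomial in each pass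
may still produce exponential growth when iterated. -/
theorem PolyTime.loop_spine {d : α → δ} (hd : PolyTime d) {b : α → β} (hb : PolyTime b)
    {f : α → ℕ → β → β} (hf : PolyTime (fun y : α × ℕ × β => f y.1 y.2.1 y.2.2))
    (Q : ℕ[X]) (hQ : ∀ x, ∀ i ≤ (enc (d x)).spine,
      esize (loopN (f x) (b x) i) ≤ Q.eval (esize x)) :
    PolyTime (fun x => loopN (f x) (b x) (enc (d x)).spine) := by
  obtain ⟨p, P, hp⟩ := hf
  obtain ⟨pd, Pd, hpd⟩ := hd
  obtain ⟨pb, Pb, hpb⟩ := hb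
  refine ⟨.seq (.pair pd (.pair .id (.pair .nil pb))) (.seq (.loop (.pair (.seq .head .tail)
    (.pair (.seq .tail .head) (.pair (.pair .nil (.seq .tail (.seq .tail .head)))
      (.seq .tail p))))) (.seq .tail (.seq .tail .tail))),
    -- `2 * Pd + Q + X + 5` bounds the size of the input, round number and value passed to the body,
    -- and `Pd` bounds the number of passes.
    Pd + Pb + 20 + Pd * (P.comp (2 * Pd + Q + X + 5) + 19) + Q, fun x => ?_⟩
  obtain ⟨t, h1, h2, h3⟩ := hpd x
  obtain ⟨u, h4, h5, h6⟩ := hpb x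
  have hs : (enc (d x)).spine ≤ Pd.eval (esize x) := (Data.spine_lt_size _).le.trans h3
  obtain ⟨v, hv, h7⟩ := runs_loop (p := p) (x := enc x) (f := f x) (b := b x)
    (B := (P.comp (2 * Pd + Q + X + 5)).eval (esize x)) (e := enc (d x)) (j := 0) (by
      intro k hk
      rw [zero_add] at hk
      obtain ⟨w, h8, h9, -⟩ := hp (x, k, loopN (f x) (b x) k)
      refine ⟨w, h9.trans ?_, h8⟩
      rw [eval_comp]
      apply eval_nat_mono
      have := hQ x k hk.le
      simp only [esize_pair, esize_nat, eval_add, eval_mul, eval_ofNat, eval_X]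
      omega)
  rw [zero_add] at h7
  refine ⟨_, .seq (.pair h1 (.pair (.id _) (.pair (.nil _) h4)))
    (.seq h7 (.seq (.tail _) (.seq (.tail _) (.tail _)))), ?_, ?_⟩
  · have := Nat.mul_le_mul_right ((P.comp (2 * Pd + Q + X + 5)).eval (esize x) + 19) hs
    simp only [eval_add, eval_mul, eval_ofNat] at this hv ⊢
    omega
  · have := hQ x _ le_rfl
    simp only [eval_add]
    omega

theorem PolyTime.loopN {k : α → ℕ} (hk : PolyTime k) {b : α → β} (hb : PolyTime b)
    {f : α → ℕ → β → β} (hf : PolyTime (fun y : α × ℕ × β => f y.1 y.2.1 y.2.2))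
    (Q : ℕ[X]) (hQ : ∀ x, ∀ i ≤ k x, esize (loopN (f x) (b x) i) ≤ Q.eval (esize x)) :
    PolyTime (fun x => loopN (f x) (b x) (k x)) := by
  simpa using PolyTime.loop_spine hk hb hf Q (by simpa using hQ)

/-- A loop whose body maps everything to states of size polynomial in the environment. -/
theorem PolyTime.loopN_of_bounded {k : α → ℕ} (hk : PolyTime k) {b : α → β} (hb : PolyTime b)
    {f : α → ℕ → β → β} (hf : PolyTime (fun y : α × ℕ × β => f y.1 y.2.1 y.2.2))
    (Q : ℕ[X]) (hQ : ∀ x i y, esize (f x i y) ≤ Q.eval (esize x)) :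
    PolyTime (fun x => _root_.loopN (f x) (b x) (k x)) := by
  obtain ⟨P, hP⟩ := hb.size_le
  refine PolyTime.loopN hk hb hf (P + Q) fun x i _ => ?_
  rw [eval_add]
  cases i with
  | zero => exact (hP x).trans (by omega)
  | succ i => exact (hQ x i _).trans (by omega)

@[fun_prop]
theorem PolyTime.length {f : α → List β} (hf : PolyTime f) : PolyTime (fun x => (f x).length) := by
  obtain ⟨P, hP⟩ := hf.size_le
  have key : ∀ n, _root_.loopN (fun _ k => k + 1) 0 n = n := by
    intro n
    induction n with
    | zero => rfl
    | succ n ih => simp [_root_.loopN, ih]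
  have := PolyTime.loop_spine hf (PolyTime.const 0)
    (f := fun _ _ k => k + 1) (by fun_prop) (2 * P + 1) (fun x i hi => by
      have h := hP x
      have h2 := length_le_esize (f x)
      simp only [key, esize_nat, spine_list, eval_add, eval_mul, eval_ofNat, eval_one] at hi ⊢
      omega)
  simpa [key] using this

theorem PolyTime.add {f g : α → ℕ} (hf : PolyTime f) (hg : PolyTime g) :
    PolyTime (fun x => f x + g x) := by
  obtain ⟨P, hP⟩ := hf.size_le
  obtain ⟨Q, hQ⟩ := hg.size_le
  have key : ∀ m n, _root_.loopN (fun _ k => k + 1) m n = m + n := by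
    intro m n
    induction n with
    | zero => rfl
    | succ n ih => simp [_root_.loopN, ih, add_assoc]
  have := PolyTime.loopN hg hf (f := fun _ _ k => k + 1) (by fun_prop) (P + Q) (fun x i hi => by
      have h := hP x
      have h2 := hQ x
      simp only [key, esize_nat, eval_add] at hi h h2 ⊢
      omega)
  simpa only [key] using this

theorem PolyTime.sub {f g : α → ℕ} (hf : PolyTime f) (hg : PolyTime g) :
    PolyTime (fun x => f x - g x) := by
  obtain ⟨P, hP⟩ := hf.size_le
  have key : ∀ m n, _root_.loopN (fun _ k => k.pred) m n = m - n := by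
    intro m n
    induction n with
    | zero => rfl
    | succ n ih => simp only [_root_.loopN, ih]; rfl
  have := PolyTime.loopN hg hf (f := fun _ _ k => k.pred) (by fun_prop) P (fun x i hi => by
      have h := hP x
      simp only [key, esize_nat] at hi h ⊢
      omega)
  simpa only [key] using this

attribute [fun_prop] PolyTime.add PolyTime.sub

@[fun_prop]
theorem PolyTime.mul {f g : α → ℕ} (hf : PolyTime f) (hg : PolyTime g) :
    PolyTime (fun x => f x * g x) := by
  obtain ⟨P, hP⟩ := hf.size_le
  obtain ⟨Q, hQ⟩ := hg.size_le
  have key : ∀ m n, _root_.loopN (fun _ k => k + m) 0 n = m * n := by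
    intro m n
    induction n with
    | zero => rfl
    | succ n ih => simp [_root_.loopN, ih, mul_add]
  have := PolyTime.loopN hg (PolyTime.const 0) (f := fun x _ k => k + f x) (by fun_prop)
    (2 * P * Q + 1) (fun x i hi => by
      have h := hP x
      have h2 := hQ x
      simp only [key, esize_nat, eval_add, eval_mul, eval_ofNat, eval_one] at hi h h2 ⊢
      have : f x * i ≤ P.eval (esize x) * Q.eval (esize x) :=
        Nat.mul_le_mul (by omega) (by omega)
      linarith)
  simpa only [key] using this

@[fun_prop]
theorem PolyTime.lt {f g : α → ℕ} (hf : PolyTime f) (hg : PolyTime g) :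
    PolyTime (fun x => decide (f x < g x)) := by
  have : PolyTime (fun x => decide (0 < g x - f x)) := by fun_prop
  simpa using this

@[fun_prop]
theorem PolyTime.le {f g : α → ℕ} (hf : PolyTime f) (hg : PolyTime g) :
    PolyTime (fun x => decide (f x ≤ g x)) := by
  have : PolyTime (fun x => decide (f x < g x + 1)) := by fun_prop
  simpa [Nat.lt_succ_iff] using this

@[fun_prop]
theorem PolyTime.eq {f g : α → ℕ} (hf : PolyTime f) (hg : PolyTime g) :
    PolyTime (fun x => decide (f x = g x)) := by
  have : PolyTime (fun x => decide (f x ≤ g x) && decide (g x ≤ f x)) := by fun_prop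
  convert this using 2 with x
  rw [← Bool.decide_and, decide_eq_decide]
  omega

@[fun_prop]
theorem PolyTime.min {f g : α → ℕ} (hf : PolyTime f) (hg : PolyTime g) :
    PolyTime (fun x => min (f x) (g x)) := by
  have : PolyTime (fun x => if decide (f x ≤ g x) = true then f x else g x) := by fun_prop
  simpa [min_def] using this

/-- A counter is reset on reaching `c`. The guard is an inequality so that the body is bounded on
every state, not only on those that occur. -/
theorem PolyTime.mod_const (c : ℕ) (hc : 0 < c) {f : α → ℕ} (hf : PolyTime f) :
    PolyTime (fun x => f x % c) := by
  have key : ∀ n, _root_.loopN (fun _ k => if decide (c ≤ k + 1) = true then 0 else k + 1) 0 n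
      = n % c := by
    intro n
    induction n with
    | zero => simp [_root_.loopN]
    | succ n ih =>
      have h := Nat.mod_lt n hc
      simp only [decide_eq_true_eq] at ih
      simp only [_root_.loopN, decide_eq_true_eq, ih]
      rw [← Nat.mod_add_mod]
      split_ifs with h1
      · rw [show n % c + 1 = c by omega, Nat.mod_self]
      · exact (Nat.mod_eq_of_lt (a := n % c + 1) (by omega)).symm
  have := PolyTime.loopN_of_bounded hf (PolyTime.const 0)
    (f := fun _ _ k => if decide (c ≤ k + 1) = true then 0 else k + 1) (by fun_prop)
    (Polynomial.C (2 * c + 1)) (fun x i y => by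
      simp only [esize_nat, eval_C, decide_eq_true_eq]
      split_ifs <;> omega)
  simpa only [key] using this

@[fun_prop]
theorem PolyTime.mod_three {f : α → ℕ} (hf : PolyTime f) : PolyTime (fun x => f x % 3) :=
  hf.mod_const 3 (by norm_num)

@[fun_prop]
theorem PolyTime.mod_six {f : α → ℕ} (hf : PolyTime f) : PolyTime (fun x => f x % 6) :=
  hf.mod_const 6 (by norm_num)

theorem PolyTime.getD {f : α → List β} {i : α → ℕ} {d : β} (hd : enc d = .nil) (hf : PolyTime f)
    (hi : PolyTime i) : PolyTime (fun x => (f x).getD (i x) d) := by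
  obtain ⟨P, hP⟩ := hf.size_le
  have key : ∀ (l : List β) n, _root_.loopN (fun _ l => l.tail) l n = l.drop n := by
    intro l n
    induction n with
    | zero => rfl
    | succ n ih => simp [_root_.loopN, ih]
  have hsz : ∀ (l : List β) n, esize (l.drop n) ≤ esize l := by
    intro l
    induction l with
    | nil => simp
    | cons a l ih =>
      intro n
      cases n with
      | zero => simp
      | succ n =>
        have := ih n
        simp only [List.drop_succ_cons, esize_cons]
        omega
  have := PolyTime.headD hd (PolyTime.loopN hi hf (f := fun _ _ l => l.tail) (by fun_prop) P
    (fun x i hi => by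
      rw [key]
      exact (hsz _ _).trans (hP x)))
  simp only [key] at this
  convert this using 2 with x
  simp [List.headD_eq_head?_getD, List.head?_drop, List.getD_eq_getElem?_getD]

@[fun_prop]
theorem PolyTime.getD_false {f : α → List Bool} {i : α → ℕ} (hf : PolyTime f)
    (hi : PolyTime i) : PolyTime (fun x => (f x).getD (i x) false) := hf.getD rfl hi

@[fun_prop]
theorem PolyTime.getD_zero {f : α → List ℕ} {i : α → ℕ} (hf : PolyTime f)
    (hi : PolyTime i) : PolyTime (fun x => (f x).getD (i x) 0) := hf.getD rfl hi

@[fun_prop]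
theorem PolyTime.getD_nil {f : α → List (List β)} {i : α → ℕ} (hf : PolyTime f)
    (hi : PolyTime i) : PolyTime (fun x => (f x).getD (i x) []) := hf.getD rfl hi

end

end polyTime

section tables
open Polynomial

/-! ### Tables and bounded quantifiers -/

/-- The table of the values of `f` below `n`. -/
def tab {β : Type} (n : ℕ) (f : ℕ → β) : List β := loopN (fun k l => f (n - (k + 1)) :: l) [] n

def any (n : ℕ) (p : ℕ → Bool) : Bool := loopN (fun k b => p k || b) false n

def all (n : ℕ) (p : ℕ → Bool) : Bool := !any n fun i => !p i

def count (n : ℕ) (p : ℕ → Bool) : ℕ := loopN (fun k c => if p k = true then c + 1 else c) 0 n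

/-- The last number below `n` with property `p`, and `n` if there is none. -/
def find (n : ℕ) (p : ℕ → Bool) : ℕ := loopN (fun k c => if p k = true then k else c) n n

theorem tab_eq {β : Type} (n : ℕ) (f : ℕ → β) : tab n f = (List.range n).map f := by
  -- The table is filled from its end: after `k` rounds it holds the last `k` entries in the right
  -- order.
  have : ∀ k ≤ n, loopN (fun k l => f (n - (k + 1)) :: l) [] k
      = ((List.range k).map fun i => f (n - k + i)) := by
    intro k
    induction k with
    | zero => simp [loopN]
    | succ k ih =>
      intro hk
      rw [loopN, ih (by omega), List.range_succ_eq_map]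
      simp only [List.map_cons, add_zero, List.map_map, List.cons.injEq, true_and]
      refine List.map_congr_left fun i _ => ?_
      simp only [Function.comp, Nat.succ_eq_add_one]
      congr 1
      omega
  simpa [tab] using this n le_rfl

@[simp] theorem length_tab {β : Type} (n : ℕ) (f : ℕ → β) : (tab n f).length = n := by
  simp [tab_eq]

theorem getD_tab {β : Type} {n i : ℕ} (f : ℕ → β) (d : β) (h : i < n) :
    (tab n f).getD i d = f i := by
  simp [tab_eq, h, List.getD_eq_getElem?_getD]

@[simp] theorem getD_tab_fin {β : Type} {n : ℕ} (i : Fin n) (f : ℕ → β) (d : β) :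
    (tab n f).getD i d = f i := getD_tab f d i.2

theorem any_eq_true {n : ℕ} {p : ℕ → Bool} : any n p = true ↔ ∃ i < n, p i = true := by
  unfold any
  induction n with
  | zero => simp [loopN]
  | succ n ih => simp only [loopN, Bool.or_eq_true, ih, Nat.exists_lt_succ_right, or_comm]

@[simp] theorem any_iff {n : ℕ} {p : ℕ → Bool} : any n p = true ↔ ∃ i : Fin n, p i = true := by
  rw [any_eq_true]
  exact ⟨fun ⟨i, h, hp⟩ => ⟨⟨i, h⟩, hp⟩, fun ⟨i, hp⟩ => ⟨i, i.2, hp⟩⟩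

@[simp] theorem all_iff {n : ℕ} {p : ℕ → Bool} : all n p = true ↔ ∀ i : Fin n, p i = true := by
  rw [all, Bool.not_eq_true', ← Bool.not_eq_true, any_iff]
  simp

theorem count_eq {n : ℕ} {p : ℕ → Bool} {P : Fin n → Prop} [DecidablePred P]
    (h : ∀ i : Fin n, p i = true ↔ P i) :
    count n p = (Finset.univ.filter P).card := by
  have h1 : ∀ k, count k p = ∑ i ∈ Finset.range k, if p i = true then 1 else 0 := by
    intro k
    unfold count
    induction k with
    | zero => simp [loopN]
    | succ k ih =>
      rw [loopN, Finset.sum_range_succ, ih]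
      split_ifs <;> rfl
  rw [h1, Finset.sum_range, Finset.card_filter]
  simp only [h]

theorem count_le (n : ℕ) (p : ℕ → Bool) : count n p ≤ n := by
  rw [count_eq (P := fun i : Fin n => p i = true) fun _ => Iff.rfl]
  exact (Finset.card_le_univ _).trans (by simp)

theorem find_spec {n : ℕ} {p : ℕ → Bool} (h : ∃ i : Fin n, p i = true) :
    ∃ i : Fin n, find n p = i ∧ p i = true := by
  have h1 : ∀ k, (∀ i < k, p i = false) ∨
      ∃ i < k, p i = true ∧ loopN (fun k c => if p k = true then k else c) n k = i := by
    intro k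
    induction k with
    | zero => simp
    | succ k ih =>
      by_cases hk : p k = true
      · exact .inr ⟨k, by omega, hk, by simp [loopN, hk]⟩
      · rcases ih with ih | ⟨i, hi, hp, he⟩
        · left
          intro i hi
          rcases Nat.lt_succ_iff_lt_or_eq.1 hi with hi | rfl
          · exact ih i hi
          · simpa using hk
        · exact .inr ⟨i, by omega, hp, by simp [loopN, hk, he]⟩
  obtain ⟨i, hi⟩ := h
  rcases h1 n with h1 | ⟨j, hj, hp, he⟩
  · rw [h1 i i.2] at hi
    exact absurd hi (by simp)
  · exact ⟨⟨j, hj⟩, he, hp⟩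

theorem find_spec_iff {n : ℕ} {p : ℕ → Bool} {P : Fin n → Prop}
    (hp : ∀ i : Fin n, p i = true ↔ P i) (h : ∃ i, P i) : ∃ i : Fin n, find n p = i ∧ P i := by
  obtain ⟨i, hi, h1⟩ := find_spec (h.imp fun i => (hp i).2)
  exact ⟨i, hi, (hp i).1 h1⟩

theorem find_eq_of_forall {n : ℕ} {p : ℕ → Bool} (h : ∀ i : Fin n, ¬ p i = true) :
    find n p = n := by
  have h1 : ∀ k ≤ n, loopN (fun k c => if p k = true then k else c) n k = n := by
    intro k
    induction k with
    | zero => simp [loopN]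
    | succ k ih =>
      intro hk
      rw [loopN, ih (by omega), if_neg (h ⟨k, hk⟩)]
  exact h1 n le_rfl

section
variable {α β γ δ : Type} [Enc α] [Enc β] [Enc γ] [Enc δ]

@[fun_prop]
theorem PolyTime.tab {n : α → ℕ} (hn : PolyTime n) {f : α → ℕ → β}
    (hf : PolyTime fun y : α × ℕ => f y.1 y.2) : PolyTime fun x => tab (n x) (f x) := by
  obtain ⟨N, hN⟩ := hn.size_le
  obtain ⟨P, hP⟩ := hf.size_le
  have hf' : PolyTime fun y : α × ℕ × List β => f y.1 (n y.1 - (y.2.1 + 1)) :: y.2.2 := by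
    have := hf.comp (g := fun y : α × ℕ × List β => (y.1, n y.1 - (y.2.1 + 1))) (by fun_prop)
    fun_prop
  refine PolyTime.loopN hn (PolyTime.const []) (f := fun x k l => f x (n x - (k + 1)) :: l)
    hf' (N * (P.comp (1 + X + N) + 1) + 1) fun x i hi => ?_
  have h1 : ∀ j, j ≤ n x → ∀ a ∈ _root_.loopN (fun k l => f x (n x - (k + 1)) :: l) [] j,
      esize a ≤ (P.comp (1 + X + N)).eval (esize x) := by
    intro j
    induction j with
    | zero => simp [_root_.loopN]
    | succ j ih =>
      intro hj a ha
      rw [_root_.loopN, List.mem_cons] at ha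
      rcases ha with rfl | ha
      · refine (hP (x, n x - (j + 1))).trans ?_
        rw [eval_comp]
        apply eval_nat_mono
        have := hN x
        simp only [esize_nat, esize_pair, eval_add, eval_one, eval_X] at this ⊢
        omega
      · exact ih (by omega) a ha
  have h2 : ∀ j, (_root_.loopN (fun k l => f x (n x - (k + 1)) :: l) [] j).length = j := by
    intro j
    induction j with
    | zero => simp [_root_.loopN]
    | succ j ih => simp [_root_.loopN, ih]
  refine (esize_list_le (h1 i hi)).trans ?_
  rw [h2]
  have h3 : i ≤ N.eval (esize x) := by
    have := hN x
    rw [esize_nat] at this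
    omega
  have := Nat.mul_le_mul_right ((P.comp (1 + X + N)).eval (esize x) + 1) h3
  simpa using this

@[fun_prop]
theorem PolyTime.any {n : α → ℕ} (hn : PolyTime n) {p : α → ℕ → Bool}
    (hp : PolyTime fun y : α × ℕ => p y.1 y.2) : PolyTime fun x => any (n x) (p x) := by
  refine PolyTime.loopN_of_bounded hn (PolyTime.const false) (f := fun x k b => p x k || b)
    ?_ (C 3) fun x i y => (esize_bool _).trans (by simp)
  have := hp.comp (g := fun y : α × ℕ × Bool => (y.1, y.2.1)) (by fun_prop)
  fun_prop

@[fun_prop]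
theorem PolyTime.all {n : α → ℕ} (hn : PolyTime n) {p : α → ℕ → Bool}
    (hp : PolyTime fun y : α × ℕ => p y.1 y.2) : PolyTime fun x => all (n x) (p x) := by
  unfold _root_.all
  fun_prop

@[fun_prop]
theorem PolyTime.count {n : α → ℕ} (hn : PolyTime n) {p : α → ℕ → Bool}
    (hp : PolyTime fun y : α × ℕ => p y.1 y.2) : PolyTime fun x => count (n x) (p x) := by
  obtain ⟨N, hN⟩ := hn.size_le
  refine PolyTime.loopN hn (PolyTime.const 0)
    (f := fun x k c => if p x k = true then c + 1 else c) ?_ N fun x i hi => ?_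
  · have := hp.comp (g := fun y : α × ℕ × ℕ => (y.1, y.2.1)) (by fun_prop)
    fun_prop
  · have h1 : ∀ j, _root_.loopN (fun k c => if p x k = true then c + 1 else c) 0 j ≤ j := by
      intro j
      induction j with
      | zero => simp [_root_.loopN]
      | succ j ih =>
        rw [_root_.loopN]
        split_ifs <;> omega
    have h2 := h1 i
    have h3 := hN x
    rw [esize_nat] at h3 ⊢
    omega

@[fun_prop]
theorem PolyTime.find {n : α → ℕ} (hn : PolyTime n) {p : α → ℕ → Bool}
    (hp : PolyTime fun y : α × ℕ => p y.1 y.2) : PolyTime fun x => find (n x) (p x) := by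
  obtain ⟨N, hN⟩ := hn.size_le
  refine PolyTime.loopN hn hn
    (f := fun x k c => if p x k = true then k else c) ?_ N fun x i hi => ?_
  · have := hp.comp (g := fun y : α × ℕ × ℕ => (y.1, y.2.1)) (by fun_prop)
    fun_prop
  · have h1 : ∀ j ≤ n x, _root_.loopN (fun k c => if p x k = true then k else c) (n x) j ≤ n x := by
      intro j
      induction j with
      | zero => simp [_root_.loopN]
      | succ j ih =>
        intro hj
        have := ih (by omega)
        rw [_root_.loopN]
        split_ifs <;> omega
    have h2 := h1 i hi
    have h3 := hN x
    rw [esize_nat] at h3 ⊢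
    omega

theorem esize_boolTable {l : List Bool} : esize l ≤ 4 * l.length + 1 := by
  have := esize_list_le (l := l) (B := 3) fun a _ => esize_bool a
  omega

/-- A loop whose states are tables of `n` bits. -/
theorem PolyTime.loopN_boolTable {n : α → ℕ} (hn : PolyTime n) {k : α → ℕ} (hk : PolyTime k)
    {b : α → List Bool} (hb : PolyTime b) {f : α → ℕ → List Bool → List Bool}
    (hf : PolyTime (fun y : α × ℕ × List Bool => f y.1 y.2.1 y.2.2))
    (hl : ∀ x i y, (f x i y).length = n x) :
    PolyTime (fun x => _root_.loopN (f x) (b x) (k x)) := by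
  obtain ⟨N, hN⟩ := hn.size_le
  refine PolyTime.loopN_of_bounded hk hb hf (4 * N + 1) fun x i y => ?_
  refine esize_boolTable.trans ?_
  have := hN x
  rw [hl]
  simp only [esize_nat, eval_add, eval_mul, eval_ofNat, eval_one] at this ⊢
  omega

end

end tables

section program
open Polynomial

/-! ### The labeling program -/

/-- The adjacency matrix and the characteristic vector of the source. -/
abbrev Net := List (List Bool) × List Bool

/-- Parents (`N.nodes` for a node without one) and heights. -/
abbrev TreeState := List ℕ × List ℕ

/-- The informed nodes, the nodes with their dominating flag set, and the nodes which have been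
targets of the slow part of the Go steps. -/
abbrev BlockState := List Bool × List Bool × List Bool

def Net.nodes (N : Net) : ℕ :=
  N.2.length

@[fun_prop]
theorem Net.polyTime_nodes {α : Type} [Enc α] {N : α → Net}
    (hN : PolyTime N) :
    PolyTime fun x => Net.nodes (N x) := by
  unfold Net.nodes
  fun_prop

def Net.adj (N : Net) (i : ℕ) (j : ℕ) : Bool :=
  (N.1.getD i []).getD j false

@[fun_prop]
theorem Net.polyTime_adj {α : Type} [Enc α] {N : α → Net} {i : α → ℕ} {j : α → ℕ}
    (hN : PolyTime N) (hi : PolyTime i) (hj : PolyTime j) :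
    PolyTime fun x => Net.adj (N x) (i x) (j x) := by
  unfold Net.adj
  fun_prop

def Net.isSource (N : Net) (i : ℕ) : Bool :=
  N.2.getD i false

@[fun_prop]
theorem Net.polyTime_isSource {α : Type} [Enc α] {N : α → Net} {i : α → ℕ}
    (hN : PolyTime N) (hi : PolyTime i) :
    PolyTime fun x => Net.isSource (N x) (i x) := by
  unfold Net.isSource
  fun_prop

/-- The nodes at distance at most `k` from the source. -/
def Net.ball (N : Net) (k : ℕ) : List Bool :=
  loopN (fun _ B => tab N.nodes fun i =>
    B.getD i false || any N.nodes fun j => B.getD j false && N.adj j i)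
    (tab N.nodes fun i => N.isSource i) k

@[fun_prop]
theorem Net.polyTime_ball {α : Type} [Enc α] {N : α → Net} {k : α → ℕ}
    (hN : PolyTime N) (hk : PolyTime k) :
    PolyTime fun x => Net.ball (N x) (k x) := by
  unfold Net.ball
  exact PolyTime.loopN_boolTable (n := fun x => (N x).nodes) (by fun_prop) hk (by fun_prop) (by fun_prop) (by simp)

/-- The distance is the number of radii whose ball misses `i`. Radii below `n` suffice since
distances in a connected graph are below `n`. -/
def Net.lev (N : Net) (i : ℕ) : ℕ :=
  count N.nodes fun k => !(N.ball k).getD i false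

@[fun_prop]
theorem Net.polyTime_lev {α : Type} [Enc α] {N : α → Net} {i : α → ℕ}
    (hN : PolyTime N) (hi : PolyTime i) :
    PolyTime fun x => Net.lev (N x) (i x) := by
  unfold Net.lev
  fun_prop

/-- `u` has no parent yet and could become a child of `w`. -/
def Net.freeChild (N : Net) (T : TreeState) (w : ℕ) (u : ℕ) : Bool :=
  decide (N.nodes ≤ T.1.getD u 0) && N.adj w u && decide (N.lev u = N.lev w + 1)

@[fun_prop]
theorem Net.polyTime_freeChild {α : Type} [Enc α] {N : α → Net} {T : α → TreeState} {w : α → ℕ} {u : α → ℕ}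
    (hN : PolyTime N) (hT : PolyTime T) (hw : PolyTime w) (hu : PolyTime u) :
    PolyTime fun x => Net.freeChild (N x) (T x) (w x) (u x) := by
  unfold Net.freeChild
  fun_prop

/-- The 2-height of `w` after it has taken all its free children. -/
def Net.newHeight (N : Net) (T : TreeState) (w : ℕ) : ℕ :=
  count N.nodes fun k => any N.nodes fun u => N.freeChild T w u &&
    (decide (k < T.2.getD u 0) || (decide (T.2.getD u 0 = k) &&
      any N.nodes fun u' => N.freeChild T w u' && !decide (u = u') && decide (T.2.getD u' 0 = k)))

@[fun_prop]
theorem Net.polyTime_newHeight {α : Type} [Enc α] {N : α → Net} {T : α → TreeState} {w : α → ℕ}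
    (hN : PolyTime N) (hT : PolyTime T) (hw : PolyTime w) :
    PolyTime fun x => Net.newHeight (N x) (T x) (w x) := by
  unfold Net.newHeight
  fun_prop

/-- The next node to get children. -/
def Net.pick (N : Net) (T : TreeState) : ℕ :=
  find N.nodes fun w => any N.nodes (fun u => N.freeChild T w u) &&
    all N.nodes fun w' => !(any N.nodes fun u => N.freeChild T w' u) ||
      (decide (N.lev w' < N.lev w) || (decide (N.lev w' = N.lev w) &&
        decide (N.newHeight T w' ≤ N.newHeight T w)))

@[fun_prop]
theorem Net.polyTime_pick {α : Type} [Enc α] {N : α → Net} {T : α → TreeState}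
    (hN : PolyTime N) (hT : PolyTime T) :
    PolyTime fun x => Net.pick (N x) (T x) := by
  unfold Net.pick
  fun_prop

/-- Truncation by `N.nodes` changes nothing on the states that occur; it bounds the size of the
result for arbitrary states, as `PolyTime.loopN_of_bounded` requires. -/
def Net.treeStep (N : Net) (T : TreeState) : TreeState :=
  (tab N.nodes fun u => min N.nodes (if N.freeChild T (N.pick T) u = true then N.pick T else T.1.getD u 0),
    tab N.nodes fun v => min N.nodes
      (if decide (v = N.pick T) = true then N.newHeight T (N.pick T) else T.2.getD v 0))

@[fun_prop]
theorem Net.polyTime_treeStep {α : Type} [Enc α] {N : α → Net} {T : α → TreeState}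
    (hN : PolyTime N) (hT : PolyTime T) :
    PolyTime fun x => Net.treeStep (N x) (T x) := by
  unfold Net.treeStep
  fun_prop

def Net.treeInit (N : Net) : TreeState :=
  (tab N.nodes fun i => if N.isSource i = true then i else N.nodes, tab N.nodes fun _ => 0)

@[fun_prop]
theorem Net.polyTime_treeInit {α : Type} [Enc α] {N : α → Net}
    (hN : PolyTime N) :
    PolyTime fun x => Net.treeInit (N x) := by
  unfold Net.treeInit
  fun_prop

def Net.treeAt (N : Net) (k : ℕ) : TreeState :=
  loopN (fun _ T => N.treeStep T) N.treeInit k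

@[fun_prop]
theorem Net.polyTime_treeAt {α : Type} [Enc α] {N : α → Net} {k : α → ℕ}
    (hN : PolyTime N) (hk : PolyTime k) :
    PolyTime fun x => Net.treeAt (N x) (k x) := by
  unfold Net.treeAt
  obtain ⟨Q, hQ⟩ := hN.size_le
  refine PolyTime.loopN_of_bounded hk (by fun_prop) (by fun_prop)
    (2 * (Q * (2 * Q + 2) + 1) + 1) fun x i y => ?_
  have h1 : (N x).nodes ≤ Q.eval (esize x) :=
    (length_le_esize _).trans ((esize_snd _).trans (hQ x))
  have h2 : ∀ f : ℕ → ℕ, esize (tab (N x).nodes fun u => min (N x).nodes (f u)) ≤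
      Q.eval (esize x) * (2 * Q.eval (esize x) + 2) + 1 := by
    intro f
    refine (esize_list_le (B := 2 * Q.eval (esize x) + 1) ?_).trans ?_
    · intro a ha
      rw [tab_eq, List.mem_map] at ha
      obtain ⟨u, -, rfl⟩ := ha
      rw [esize_nat]
      omega
    · rw [length_tab]
      exact Nat.add_le_add_right (Nat.mul_le_mul_right _ h1) 1
  simp only [Net.treeStep, esize_pair, eval_add, eval_mul, eval_ofNat, eval_one]
  linarith [h2 fun u => if (N x).freeChild y ((N x).pick y) u = true then (N x).pick y else y.1.getD u 0,
    h2 fun v => if decide (v = (N x).pick y) = true then (N x).newHeight y ((N x).pick y)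
      else y.2.getD v 0]

def Net.parent (N : Net) (u : ℕ) : ℕ :=
  (N.treeAt N.nodes).1.getD u 0

@[fun_prop]
theorem Net.polyTime_parent {α : Type} [Enc α] {N : α → Net} {u : α → ℕ}
    (hN : PolyTime N) (hu : PolyTime u) :
    PolyTime fun x => Net.parent (N x) (u x) := by
  unfold Net.parent
  fun_prop

def Net.height (N : Net) (u : ℕ) : ℕ :=
  (N.treeAt N.nodes).2.getD u 0

@[fun_prop]
theorem Net.polyTime_height {α : Type} [Enc α] {N : α → Net} {u : α → ℕ}
    (hN : PolyTime N) (hu : PolyTime u) :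
    PolyTime fun x => Net.height (N x) (u x) := by
  unfold Net.height
  fun_prop

/-- `⌊log₂ n⌋ + 1`. -/
def Net.logSize (N : Net) : ℕ :=
  count (N.nodes + 1) fun k =>
    decide (loopN (fun _ a => min (a + a) (N.nodes + 1)) 1 k ≤ N.nodes)

@[fun_prop]
theorem Net.polyTime_logSize {α : Type} [Enc α] {N : α → Net}
    (hN : PolyTime N) :
    PolyTime fun x => Net.logSize (N x) := by
  unfold Net.logSize
  obtain ⟨Q, hQ⟩ := hN.size_le
  -- The powers of two are capped at `n + 1`; uncapped, their unary encodings would be exponentially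
  -- large.
  have h1 : PolyTime fun y : α × ℕ =>
      loopN (fun _ a => min (a + a) ((N y.1).nodes + 1)) 1 y.2 := by
    refine PolyTime.loopN_of_bounded (by fun_prop) (by fun_prop) (by fun_prop) (2 * Q.comp X + 3)
      fun x i y => ?_
    have h2 : (N x.1).nodes ≤ Q.eval (esize x.1) :=
      (length_le_esize _).trans ((esize_snd _).trans (hQ x.1))
    have h3 := eval_nat_mono Q (esize_fst x)
    simp only [esize_nat, eval_add, eval_mul, eval_ofNat, eval_comp, eval_X]
    omega
  fun_prop

/-- The 2-height of the source. -/
def Net.maxHeight (N : Net) : ℕ :=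
  N.height (find N.nodes fun i => N.isSource i)

@[fun_prop]
theorem Net.polyTime_maxHeight {α : Type} [Enc α] {N : α → Net}
    (hN : PolyTime N) :
    PolyTime fun x => Net.maxHeight (N x) := by
  unfold Net.maxHeight
  fun_prop

/-- The first block at whose beginning `u` is certainly informed. -/
def Net.due (N : Net) (u : ℕ) : ℕ :=
  N.lev u + ((N.lev u - 1) - (N.lev u - 1) % 3) +
    18 * (N.logSize * N.logSize) * (N.maxHeight - N.height u)

@[fun_prop]
theorem Net.polyTime_due {α : Type} [Enc α] {N : α → Net} {u : α → ℕ}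
    (hN : PolyTime N) (hu : PolyTime u) :
    PolyTime fun x => Net.due (N x) (u x) := by
  unfold Net.due
  fun_prop

def Net.fastEdge (N : Net) (u : ℕ) : Bool :=
  !N.isSource u && decide (N.height u = N.height (N.parent u))

@[fun_prop]
theorem Net.polyTime_fastEdge {α : Type} [Enc α] {N : α → Net} {u : α → ℕ}
    (hN : PolyTime N) (hu : PolyTime u) :
    PolyTime fun x => Net.fastEdge (N x) (u x) := by
  unfold Net.fastEdge
  fun_prop

def Net.receiver (N : Net) (r : ℕ) (u : ℕ) : Bool :=
  decide (N.lev u % 3 = (r + 1) % 3)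

@[fun_prop]
theorem Net.polyTime_receiver {α : Type} [Enc α] {N : α → Net} {r : α → ℕ} {u : α → ℕ}
    (hN : PolyTime N) (hr : PolyTime r) (hu : PolyTime u) :
    PolyTime fun x => Net.receiver (N x) (r x) (u x) := by
  unfold Net.receiver
  fun_prop

def Net.frontier (N : Net) (S : BlockState) (r : ℕ) (u : ℕ) : Bool :=
  !S.1.getD u false && N.receiver r u &&
    any N.nodes fun w => S.1.getD w false && N.adj w u && decide (N.lev u = N.lev w + 1)

@[fun_prop]
theorem Net.polyTime_frontier {α : Type} [Enc α] {N : α → Net} {S : α → BlockState} {r : α → ℕ} {u : α → ℕ}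
    (hN : PolyTime N) (hS : PolyTime S) (hr : PolyTime r) (hu : PolyTime u) :
    PolyTime fun x => Net.frontier (N x) (S x) (r x) (u x) := by
  unfold Net.frontier
  fun_prop

def Net.dominated (N : Net) (D : List Bool) (u : ℕ) : Bool :=
  any N.nodes fun w => D.getD w false && N.adj w u

@[fun_prop]
theorem Net.polyTime_dominated {α : Type} [Enc α] {N : α → Net} {D : α → List Bool} {u : α → ℕ}
    (hN : PolyTime N) (hD : PolyTime D) (hu : PolyTime u) :
    PolyTime fun x => Net.dominated (N x) (D x) (u x) := by
  unfold Net.dominated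
  fun_prop

def Net.without (N : Net) (D : List Bool) (a : ℕ) : List Bool :=
  tab N.nodes fun w => D.getD w false && !decide (w = a)

@[fun_prop]
theorem Net.polyTime_without {α : Type} [Enc α] {N : α → Net} {D : α → List Bool} {a : α → ℕ}
    (hN : PolyTime N) (hD : PolyTime D) (ha : PolyTime a) :
    PolyTime fun x => Net.without (N x) (D x) (a x) := by
  unfold Net.without
  fun_prop

/-- A minimal set of flagged nodes dominating the frontier. -/
def Net.domTable (N : Net) (S : BlockState) (r : ℕ) : List Bool :=
  loopN (fun v D => tab N.nodes fun w => D.getD w false && !(decide (w = v) &&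
      all N.nodes fun u => !N.frontier S r u || N.dominated (N.without D v) u))
    (tab N.nodes fun v => S.2.1.getD v false && decide (N.lev v % 3 = r % 3)) N.nodes

@[fun_prop]
theorem Net.polyTime_domTable {α : Type} [Enc α] {N : α → Net} {S : α → BlockState} {r : α → ℕ}
    (hN : PolyTime N) (hS : PolyTime S) (hr : PolyTime r) :
    PolyTime fun x => Net.domTable (N x) (S x) (r x) := by
  unfold Net.domTable
  exact PolyTime.loopN_boolTable (n := fun x => (N x).nodes) (by fun_prop) (by fun_prop) (by fun_prop) (by fun_prop) (by simp)

def Net.hearsOne (N : Net) (D : List Bool) (u : ℕ) : Bool :=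
  decide (count N.nodes (fun w => D.getD w false && N.adj w u) = 1)

@[fun_prop]
theorem Net.polyTime_hearsOne {α : Type} [Enc α] {N : α → Net} {D : α → List Bool} {u : α → ℕ}
    (hN : PolyTime N) (hD : PolyTime D) (hu : PolyTime u) :
    PolyTime fun x => Net.hearsOne (N x) (D x) (u x) := by
  unfold Net.hearsOne
  fun_prop

/-- The rest of the current batch of the receiving levels. A new batch is opened only when this is
empty. -/
def Net.pending (N : Net) (S : BlockState) (r : ℕ) (u : ℕ) : Bool :=
  S.2.2.getD u false && !S.1.getD u false && N.receiver r u

@[fun_prop]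
theorem Net.polyTime_pending {α : Type} [Enc α] {N : α → Net} {S : α → BlockState} {r : α → ℕ} {u : α → ℕ}
    (hN : PolyTime N) (hS : PolyTime S) (hr : PolyTime r) (hu : PolyTime u) :
    PolyTime fun x => Net.pending (N x) (S x) (r x) (u x) := by
  unfold Net.pending
  fun_prop

/-- Three fast blocks alternate with three slow ones, so that each residue of levels mod 3 is active
in one block of each kind per period of six. -/
def isSlow (r : ℕ) : Bool :=
  decide (3 ≤ r % 6)

@[fun_prop]
theorem polyTime_isSlow {α : Type} [Enc α] {r : α → ℕ}
    (hr : PolyTime r) :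
    PolyTime fun x => isSlow (r x) := by
  unfold _root_.isSlow
  fun_prop

def Net.targetTable (N : Net) (S : BlockState) (r : ℕ) : List Bool :=
  tab N.nodes fun u => S.2.2.getD u false ||
    (isSlow r && !(any N.nodes fun v => N.pending S r v) && N.frontier S r u)

@[fun_prop]
theorem Net.polyTime_targetTable {α : Type} [Enc α] {N : α → Net} {S : α → BlockState} {r : α → ℕ}
    (hN : PolyTime N) (hS : PolyTime S) (hr : PolyTime r) :
    PolyTime fun x => Net.targetTable (N x) (S x) (r x) := by
  unfold Net.targetTable
  fun_prop

/-- The updated table is consulted, so a batch opened in block `r` is already served there. -/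
def Net.isTarget (N : Net) (S : BlockState) (r : ℕ) (u : ℕ) : Bool :=
  (N.targetTable S r).getD u false && !S.1.getD u false && N.receiver r u

@[fun_prop]
theorem Net.polyTime_isTarget {α : Type} [Enc α] {N : α → Net} {S : α → BlockState} {r : α → ℕ} {u : α → ℕ}
    (hN : PolyTime N) (hS : PolyTime S) (hr : PolyTime r) (hu : PolyTime u) :
    PolyTime fun x => Net.isTarget (N x) (S x) (r x) (u x) := by
  unfold Net.isTarget
  fun_prop

def Net.privateTargets (N : Net) (S : BlockState) (r : ℕ) (D : List Bool) (a : ℕ) : ℕ :=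
  count N.nodes fun u => N.isTarget S r u && N.hearsOne D u && N.adj a u

@[fun_prop]
theorem Net.polyTime_privateTargets {α : Type} [Enc α] {N : α → Net} {S : α → BlockState} {r : α → ℕ} {D : α → List Bool} {a : α → ℕ}
    (hN : PolyTime N) (hS : PolyTime S) (hr : PolyTime r) (hD : PolyTime D) (ha : PolyTime a) :
    PolyTime fun x => Net.privateTargets (N x) (S x) (r x) (D x) (a x) := by
  unfold Net.privateTargets
  fun_prop

def Net.worst (N : Net) (S : BlockState) (r : ℕ) (D : List Bool) : ℕ :=
  find N.nodes fun a => D.getD a false &&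
    all N.nodes fun b => !D.getD b false || decide (N.privateTargets S r D a ≤ N.privateTargets S r D b)

@[fun_prop]
theorem Net.polyTime_worst {α : Type} [Enc α] {N : α → Net} {S : α → BlockState} {r : α → ℕ} {D : α → List Bool}
    (hN : PolyTime N) (hS : PolyTime S) (hr : PolyTime r) (hD : PolyTime D) :
    PolyTime fun x => Net.worst (N x) (S x) (r x) (D x) := by
  unfold Net.worst
  fun_prop

/-- Transmitters are removed one by one, always one with the fewest private targets. -/
def Net.chain (N : Net) (S : BlockState) (r : ℕ) (k : ℕ) : List Bool :=
  loopN (fun _ D => N.without D (N.worst S r D)) (N.domTable S r) k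

@[fun_prop]
theorem Net.polyTime_chain {α : Type} [Enc α] {N : α → Net} {S : α → BlockState} {r : α → ℕ} {k : α → ℕ}
    (hN : PolyTime N) (hS : PolyTime S) (hr : PolyTime r) (hk : PolyTime k) :
    PolyTime fun x => Net.chain (N x) (S x) (r x) (k x) := by
  unfold Net.chain
  exact PolyTime.loopN_boolTable (n := fun x => (N x).nodes) (by fun_prop) hk (by fun_prop) (by fun_prop) (by simp [Net.without])

/-- A set of the chain that informs at least the fraction `1 / logSize` of the targets;
`exists_spokesmen` shows that there is one. -/
def Net.slowTable (N : Net) (S : BlockState) (r : ℕ) : List Bool :=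
  N.chain S r (find N.nodes fun k =>
    decide (count N.nodes (fun u => N.isTarget S r u) ≤
      count N.nodes (fun u => N.isTarget S r u && N.hearsOne (N.chain S r k) u) * N.logSize))

@[fun_prop]
theorem Net.polyTime_slowTable {α : Type} [Enc α] {N : α → Net} {S : α → BlockState} {r : α → ℕ}
    (hN : PolyTime N) (hS : PolyTime S) (hr : PolyTime r) :
    PolyTime fun x => Net.slowTable (N x) (S x) (r x) := by
  unfold Net.slowTable
  fun_prop

def Net.helper (N : Net) (S : BlockState) (r : ℕ) (u : ℕ) : ℕ :=
  find N.nodes fun w => (N.domTable S r).getD w false && N.adj w u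

@[fun_prop]
theorem Net.polyTime_helper {α : Type} [Enc α] {N : α → Net} {S : α → BlockState} {r : α → ℕ} {u : α → ℕ}
    (hN : PolyTime N) (hS : PolyTime S) (hr : PolyTime r) (hu : PolyTime u) :
    PolyTime fun x => Net.helper (N x) (S x) (r x) (u x) := by
  unfold Net.helper
  fun_prop

/-- One dominating neighbour transmits for each frontier node below a fast edge that has to be
informed in this very block. -/
def Net.fastTable (N : Net) (S : BlockState) (r : ℕ) : List Bool :=
  tab N.nodes fun w => (N.domTable S r).getD w false && any N.nodes fun u =>
    N.frontier S r u && N.fastEdge u && decide (N.due u = r + 1) && decide (N.helper S r u = w)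

@[fun_prop]
theorem Net.polyTime_fastTable {α : Type} [Enc α] {N : α → Net} {S : α → BlockState} {r : α → ℕ}
    (hN : PolyTime N) (hS : PolyTime S) (hr : PolyTime r) :
    PolyTime fun x => Net.fastTable (N x) (S x) (r x) := by
  unfold Net.fastTable
  fun_prop

def Net.goTable (N : Net) (S : BlockState) (r : ℕ) : List Bool :=
  if isSlow r = true then N.slowTable S r else N.fastTable S r

@[fun_prop]
theorem Net.polyTime_goTable {α : Type} [Enc α] {N : α → Net} {S : α → BlockState} {r : α → ℕ}
    (hN : PolyTime N) (hS : PolyTime S) (hr : PolyTime r) :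
    PolyTime fun x => Net.goTable (N x) (S x) (r x) := by
  unfold Net.goTable
  fun_prop

def Net.nextInformed (N : Net) (S : BlockState) (r : ℕ) (u : ℕ) : Bool :=
  S.1.getD u false || (N.receiver r u &&
    (N.hearsOne (N.domTable S r) u || N.hearsOne (N.goTable S r) u))

@[fun_prop]
theorem Net.polyTime_nextInformed {α : Type} [Enc α] {N : α → Net} {S : α → BlockState} {r : α → ℕ} {u : α → ℕ}
    (hN : PolyTime N) (hS : PolyTime S) (hr : PolyTime r) (hu : PolyTime u) :
    PolyTime fun x => Net.nextInformed (N x) (S x) (r x) (u x) := by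
  unfold Net.nextInformed
  fun_prop

/-- A node informed in block `r` is flagged provisionally; block `r + 1`, its first active one,
decides whether it really joins. On the active levels the nodes pruned from the dominating set lose
their flag for good. -/
def Net.blockStep (N : Net) (S : BlockState) (r : ℕ) : BlockState :=
  (tab N.nodes fun u => N.nextInformed S r u,
    tab N.nodes fun v => if decide (N.lev v % 3 = r % 3) = true then (N.domTable S r).getD v false
      else S.2.1.getD v false || (!S.1.getD v false && N.nextInformed S r v),
    N.targetTable S r)

@[fun_prop]
theorem Net.polyTime_blockStep {α : Type} [Enc α] {N : α → Net} {S : α → BlockState} {r : α → ℕ}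
    (hN : PolyTime N) (hS : PolyTime S) (hr : PolyTime r) :
    PolyTime fun x => Net.blockStep (N x) (S x) (r x) := by
  unfold Net.blockStep
  fun_prop

def Net.blockInit (N : Net) : BlockState :=
  (tab N.nodes fun v => N.isSource v, tab N.nodes fun v => N.isSource v, tab N.nodes fun _ => false)

@[fun_prop]
theorem Net.polyTime_blockInit {α : Type} [Enc α] {N : α → Net}
    (hN : PolyTime N) :
    PolyTime fun x => Net.blockInit (N x) := by
  unfold Net.blockInit
  fun_prop

def Net.blockAt (N : Net) (r : ℕ) : BlockState :=
  loopN (fun r S => N.blockStep S r) N.blockInit r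

@[fun_prop]
theorem Net.polyTime_blockAt {α : Type} [Enc α] {N : α → Net} {r : α → ℕ}
    (hN : PolyTime N) (hr : PolyTime r) :
    PolyTime fun x => Net.blockAt (N x) (r x) := by
  unfold Net.blockAt
  obtain ⟨Q, hQ⟩ := hN.size_le
  refine PolyTime.loopN_of_bounded hr (by fun_prop) (by fun_prop) (12 * Q + 5) fun x i y => ?_
  have h1 : (N x).nodes ≤ Q.eval (esize x) :=
    (length_le_esize _).trans ((esize_snd _).trans (hQ x))
  have h2 : ∀ f : ℕ → Bool, esize (tab (N x).nodes f) ≤ 4 * (N x).nodes + 1 := by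
    intro f
    simpa using esize_boolTable (l := tab (N x).nodes f)
  simp only [Net.blockStep, Net.targetTable, esize_pair, eval_add, eval_mul, eval_ofNat]
  linarith [h2 fun u => (N x).nextInformed y i u,
    h2 fun v => if decide ((N x).lev v % 3 = i % 3) = true then ((N x).domTable y i).getD v false
      else y.2.1.getD v false || (!y.1.getD v false && (N x).nextInformed y i v),
    h2 fun u => y.2.2.getD u false ||
      (isSlow i && !(any (N x).nodes fun v => (N x).pending y i v) && (N x).frontier y i u)]

def Net.informed (N : Net) (r : ℕ) (v : ℕ) : Bool :=
  (N.blockAt r).1.getD v false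

@[fun_prop]
theorem Net.polyTime_informed {α : Type} [Enc α] {N : α → Net} {r : α → ℕ} {v : α → ℕ}
    (hN : PolyTime N) (hr : PolyTime r) (hv : PolyTime v) :
    PolyTime fun x => Net.informed (N x) (r x) (v x) := by
  unfold Net.informed
  fun_prop

def Net.dom (N : Net) (r : ℕ) (v : ℕ) : Bool :=
  (N.domTable (N.blockAt r) r).getD v false

@[fun_prop]
theorem Net.polyTime_dom {α : Type} [Enc α] {N : α → Net} {r : α → ℕ} {v : α → ℕ}
    (hN : PolyTime N) (hr : PolyTime r) (hv : PolyTime v) :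
    PolyTime fun x => Net.dom (N x) (r x) (v x) := by
  unfold Net.dom
  fun_prop

def Net.go (N : Net) (r : ℕ) (v : ℕ) : Bool :=
  (N.goTable (N.blockAt r) r).getD v false

@[fun_prop]
theorem Net.polyTime_go {α : Type} [Enc α] {N : α → Net} {r : α → ℕ} {v : α → ℕ}
    (hN : PolyTime N) (hr : PolyTime r) (hv : PolyTime v) :
    PolyTime fun x => Net.go (N x) (r x) (v x) := by
  unfold Net.go
  fun_prop

def Net.feedback (N : Net) (r : ℕ) (v : ℕ) : ℕ :=
  find N.nodes fun u => N.frontier (N.blockAt r) r u && N.adj v u &&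
    all N.nodes fun w => !(N.dom r w && N.adj w u) || decide (w = v)

@[fun_prop]
theorem Net.polyTime_feedback {α : Type} [Enc α] {N : α → Net} {r : α → ℕ} {v : α → ℕ}
    (hN : PolyTime N) (hr : PolyTime r) (hv : PolyTime v) :
    PolyTime fun x => Net.feedback (N x) (r x) (v x) := by
  unfold Net.feedback
  fun_prop

/-- After this number of blocks all nodes are informed. -/
def Net.blocks (N : Net) : ℕ :=
  2 * N.nodes + 18 * (N.logSize * N.logSize) * N.nodes

@[fun_prop]
theorem Net.polyTime_blocks {α : Type} [Enc α] {N : α → Net}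
    (hN : PolyTime N) :
    PolyTime fun x => Net.blocks (N x) := by
  unfold Net.blocks
  fun_prop

/-- The second condition singles out the first block in which `v` can be dominating: block 0 for the
source, otherwise the one right after `v` has been informed. -/
def Net.joinBit (N : Net) (v : ℕ) : Bool :=
  any N.blocks fun r => N.dom r v && (decide (r = 0) || !N.informed (r - 1) v)

@[fun_prop]
theorem Net.polyTime_joinBit {α : Type} [Enc α] {N : α → Net} {v : α → ℕ}
    (hN : PolyTime N) (hv : PolyTime v) :
    PolyTime fun x => Net.joinBit (N x) (v x) := by
  unfold Net.joinBit
  fun_prop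

/-- The disjunction over all `r` and `v` has at most one relevant pair, since a node gives feedback
at most once. -/
def Net.stayBit (N : Net) (u : ℕ) : Bool :=
  any N.blocks fun r => any N.nodes fun v => N.dom r v && decide (N.feedback r v = u) && N.dom (r + 3) v

@[fun_prop]
theorem Net.polyTime_stayBit {α : Type} [Enc α] {N : α → Net} {u : α → ℕ}
    (hN : PolyTime N) (hu : PolyTime u) :
    PolyTime fun x => Net.stayBit (N x) (u x) := by
  unfold Net.stayBit
  fun_prop

def Net.goBit (N : Net) (u : ℕ) : Bool :=
  any N.blocks fun r => any N.nodes fun v => N.dom r v && decide (N.feedback r v = u) && N.go r v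

@[fun_prop]
theorem Net.polyTime_goBit {α : Type} [Enc α] {N : α → Net} {u : α → ℕ}
    (hN : PolyTime N) (hu : PolyTime u) :
    PolyTime fun x => Net.goBit (N x) (u x) := by
  unfold Net.goBit
  fun_prop

def Net.labels (N : Net) : List (List Bool) :=
  tab N.nodes fun v => [N.joinBit v, decide (N.lev v % 3 = 1), decide (N.lev v % 3 = 2),
    N.stayBit v, N.goBit v, false, false]

@[fun_prop]
theorem Net.polyTime_labels {α : Type} [Enc α] {N : α → Net}
    (hN : PolyTime N) :
    PolyTime fun x => Net.labels (N x) := by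
  unfold Net.labels
  fun_prop

end program

/-! ### Executions without help -/

/-- The course of an execution of the Fast Broadcast Algorithm in which the Fast and the Rescue
steps are not used: `inf r` are the nodes informed before block `r`, `dom r` is the dominating set
of block `r`, `go r` are the transmitters of its Go step, and `fb r` gives the feedback nodes. -/
structure Schedule {V : Type} (G : SimpleGraph V) (s : V) (inf dom go : ℕ → V → Prop)
    (fb : ℕ → V → V) : Prop where
  init : ∀ v, inf 0 v ↔ v = s
  step : ∀ r u, inf (r + 1) u ↔ inf r u ∨ G.dist s u % 3 = (r + 1) % 3 ∧
    ((∃! w, G.Adj u w ∧ dom r w) ∨ ∃! w, G.Adj u w ∧ go r w)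
  dom_inf : ∀ r v, dom r v → inf r v ∧ G.dist s v % 3 = r % 3
  cover : ∀ r u w, ¬ inf r u → inf r w → G.Adj w u → G.dist s u = G.dist s w + 1 →
    G.dist s w % 3 = r % 3 → ∃ w', dom r w' ∧ G.Adj w' u
  feedback : ∀ r v, dom r v → ¬ inf r (fb r v) ∧ G.dist s (fb r v) = G.dist s v + 1 ∧
    ∀ w, dom r w → (G.Adj w (fb r v) ↔ w = v)
  go_dom : ∀ r v, go r v → dom r v
  persist : ∀ r v, dom (r + 3) v → inf r v → dom r v

/-- The labels prescribe the given execution. -/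
structure Prescribes {V : Type} (G : SimpleGraph V) (s : V) (label : V → List Bool)
    (inf dom go : ℕ → V → Prop) (fb : ℕ → V → V) : Prop where
  lev : ∀ v, labelLev (label v) = G.dist s v % 3
  join_source : labelJoin (label s) = true ↔ dom 0 s
  join : ∀ r v, ¬ inf r v → inf (r + 1) v → (labelJoin (label v) = true ↔ dom (r + 1) v)
  stay : ∀ r v, dom r v → ((labelOrders (label (fb r v))).stay = true ↔ dom (r + 3) v)
  go : ∀ r v, dom r v → ((labelOrders (label (fb r v))).go = true ↔ go r v)
  fast : ∀ v, (labelOrders (label v)).fast = false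
  rescue : ∀ v, (labelOrders (label v)).rescue = false
  silent : ∀ u, (∀ r v, dom r v → fb r v ≠ u) → labelOrders (label u) = Orders.zero

/-! ### What a node hears in one round, and how it reacts -/

section radio
variable {V P : Type} {G : SimpleGraph V}

theorem radioHeard_eq_some {sent : V → Option P} {v w : V} (hv : sent v = none)
    (h : ∃! w, G.Adj v w ∧ sent w ≠ none) (hw : G.Adj v w) (hs : sent w ≠ none) :
    radioHeard G sent v = sent w := by
  have h' : sent v = none ∧ ∃! w, G.Adj v w ∧ sent w ≠ none := ⟨hv, h⟩
  rw [radioHeard, dif_pos h', h.unique h'.2.choose_spec.1 ⟨hw, hs⟩]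

theorem radioHeard_eq_none {sent : V → Option P} {v : V}
    (h : ¬ ∃! w, G.Adj v w ∧ sent w ≠ none) : radioHeard G sent v = none :=
  dif_neg fun h' => h h'.2

open Classical in
theorem radioHeard_const {sent : V → Option P} {X : V → Prop} {p : P}
    (h : ∀ w, sent w = if X w then some p else none) {v : V} (hv : ¬ X v) :
    radioHeard G sent v = if ∃! w, G.Adj v w ∧ X w then some p else none := by
  have h1 : ∀ w, sent w ≠ none ↔ X w := by
    intro w
    rw [h w]
    split_ifs with hw <;> simp [hw]
  split_ifs with hX
  · obtain ⟨w, hw, hu⟩ := hX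
    rw [radioHeard_eq_some (w := w) (by rw [h v, if_neg hv]) ⟨w, ⟨hw.1, (h1 w).2 hw.2⟩,
      fun w' hw' => hu w' ⟨hw'.1, (h1 w').1 hw'.2⟩⟩ hw.1 ((h1 w).2 hw.2), h w, if_pos hw.2]
  · refine radioHeard_eq_none fun hh => hX ?_
    simpa only [h1] using hh

theorem radioHeard_sent {sent : V → Option P} {v : V} {p : P} (h : radioHeard G sent v = some p) :
    ∃ w, sent w = some p := by
  unfold radioHeard at h
  split_ifs at h with h'
  exact ⟨_, h⟩

end radio

section recv
variable {M : Type} {t : ℕ} {q : FBState M}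

theorem fbRecv_message {μ : M} (hq : q.msg = none) (hl : labelLev q.label = (t / 5 + 1) % 3) :
    fbRecv t q (some (.message μ)) =
      { q with msg := some μ, dom := labelJoin q.label, fresh := t % 5 == 0 } := by
  simp [fbRecv, hq, hl]

theorem fbRecv_of_ne (ht : t % 5 ≠ 1) {p : Option (FBPacket M)}
    (h : q.msg ≠ none ∨ labelLev q.label ≠ (t / 5 + 1) % 3 ∨ p = none) :
    fbRecv t q p = { q with fresh := false } := by
  unfold fbRecv
  split
  · next h1 => 
    rw [if_neg]
    rcases h with h | h | h
    · exact absurd h1 h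
    · exact h
    · cases h
  · rw [if_neg (fun h => ht h.1)]

theorem fbRecv_feedback (ht : t % 5 = 1) {p : Option (FBPacket M)}
    (h : q.msg ≠ none ∨ ∀ μ, p ≠ some (.message μ)) :
    fbRecv t q p = if labelLev q.label = t / 5 % 3 then
      { q with orders := if q.dom then heardOrders p else Orders.zero,
               dom := (if q.dom then heardOrders p else Orders.zero).stay, fresh := false }
      else { q with fresh := false } := by
  unfold fbRecv
  split
  · next h1 =>
    rcases h with h | h
    · exact absurd h1 h
    · exact absurd rfl (h _)
  · simp only [ht, true_and]

end recv

/-! ### The nodes carry out every prescribed schedule -/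

namespace Schedule
variable {V : Type} {G : SimpleGraph V} {s : V} {inf dom go : ℕ → V → Prop} {fb : ℕ → V → V}

theorem mono (hS : Schedule G s inf dom go fb) {r r' : ℕ} (h : r ≤ r') {v : V} (hv : inf r v) :
    inf r' v := by
  induction h with
  | refl => exact hv
  | step _ ih => exact (hS.step _ _).2 (.inl ih)

theorem adj_feedback (hS : Schedule G s inf dom go fb) {r : ℕ} {v : V} (hv : dom r v) :
    G.Adj v (fb r v) := ((hS.feedback r v hv).2.2 v hv).2 rfl

/-- Its only dominating neighbour is `v`, so it hears `v` without collision in the Broadcast step.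
-/
theorem inf_feedback (hS : Schedule G s inf dom go fb) {r : ℕ} {v : V} (hv : dom r v) :
    inf (r + 1) (fb r v) := by
  have h := hS.feedback r v hv
  refine (hS.step _ _).2 (.inr ⟨?_, .inl ⟨v, ⟨(hS.adj_feedback hv).symm, hv⟩, ?_⟩⟩)
  · have := (hS.dom_inf r v hv).2
    omega
  · exact fun w hw => (h.2.2 w hw.2).1 hw.1.symm

theorem block_eq (hS : Schedule G s inf dom go fb) {r r' : ℕ} {u : V} (h1 : ¬ inf r u)
    (h2 : inf (r + 1) u) (h3 : ¬ inf r' u) (h4 : inf (r' + 1) u) : r = r' := by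
  by_contra h
  rcases Nat.lt_or_gt_of_ne h with h | h
  · exact h3 (hS.mono h h2)
  · exact h1 (hS.mono h h4)

/-- A feedback node in block `r` is informed exactly in that block, which determines `r`; then `v`
is its only neighbour in the dominating set. Thus the bits in its label are read by one node in one
block only. -/
theorem feedback_inj (hS : Schedule G s inf dom go fb) {r r' : ℕ} {v v' : V} (hv : dom r v)
    (hv' : dom r' v') (h : fb r v = fb r' v') : r = r' ∧ v = v' := by
  have h1 := hS.inf_feedback hv'
  have h2 := (hS.feedback r' v' hv').1
  rw [← h] at h1 h2
  obtain rfl := hS.block_eq (hS.feedback r v hv).1 (hS.inf_feedback hv) h2 h1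
  refine ⟨rfl, ((hS.feedback r v' hv').2.2 v hv).1 ?_⟩
  rw [← h]
  exact hS.adj_feedback hv

/-- The receivers of the Broadcast step. -/
def Fresh (G : SimpleGraph V) (s : V) (inf dom : ℕ → V → Prop) (r : ℕ) (u : V) : Prop :=
  ¬ inf r u ∧ G.dist s u % 3 = (r + 1) % 3 ∧ ∃! w, G.Adj u w ∧ dom r w

variable {M : Type} {μ : M} {label : V → List Bool}

open Classical in
/-- The states at the beginning of block `r`. -/
def BlockInv (G : SimpleGraph V) (s : V) (inf dom : ℕ → V → Prop) (label : V → List Bool) (μ : M)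
    (r : ℕ) (q : V → FBState M) : Prop :=
  ∀ v, (q v).label = label v ∧ (q v).msg = (if inf r v then some μ else none) ∧
    ∀ j < 3, G.dist s v % 3 = (r + j) % 3 → ((q v).dom = true ↔ inf r v ∧ dom (r + j) v)

open Classical in
/-- The states after the Broadcast step of block `r`. -/
def BroadcastInv (G : SimpleGraph V) (s : V) (inf dom : ℕ → V → Prop) (label : V → List Bool)
    (μ : M) (r : ℕ) (q : V → FBState M) : Prop :=
  ∀ v, (q v).label = label v ∧
    (q v).msg = (if inf r v ∨ Fresh G s inf dom r v then some μ else none) ∧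
    ((q v).fresh = true ↔ Fresh G s inf dom r v) ∧
    (∀ j < 3, G.dist s v % 3 = (r + j) % 3 →
      ((q v).dom = true ↔ (inf r v ∨ Fresh G s inf dom r v) ∧ dom (r + j) v))

open Classical in
/-- The states in block `r` after the Feedback step, where `X` are the nodes informed so far. -/
def ControlInv (G : SimpleGraph V) (s : V) (dom go : ℕ → V → Prop) (label : V → List Bool)
    (μ : M) (r : ℕ) (X : V → Prop) (q : V → FBState M) : Prop :=
  ∀ v, (q v).label = label v ∧ (q v).msg = (if X v then some μ else none) ∧
    (∀ j < 3, G.dist s v % 3 = (r + (j + 1)) % 3 → ((q v).dom = true ↔ X v ∧ dom (r + (j + 1)) v)) ∧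
    (G.dist s v % 3 = r % 3 → ((q v).orders.go = true ↔ go r v) ∧
      (q v).orders.fast = false ∧ (q v).orders.rescue = false)

theorem broadcast_step (hS : Schedule G s inf dom go fb)
    (hL : Prescribes G s label inf dom go fb) {r : ℕ} {q : V → FBState M}
    (hq : BlockInv G s inf dom label μ r q) :
    BroadcastInv G s inf dom label μ r fun v => fbRecv (5 * r) (q v)
      (radioHeard G (fun w => fbSend (5 * r) (q w)) v) := by
  classical
  have h0 : 5 * r % 5 = 0 := by omega
  have h5 : 5 * r / 5 = r := by omega
  have hsend : ∀ w, fbSend (5 * r) (q w) = if dom r w then some (.message μ) else none := by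
    intro w
    obtain ⟨hl, hm, hd⟩ := hq w
    have hd0 := hd 0 (by norm_num)
    unfold fbSend
    rw [hm, h0, h5, hl, hL.lev]
    by_cases hi : inf r w
    · simp only [hi, if_true]
      by_cases hdw : dom r w
      · have h3 := (hS.dom_inf r w hdw).2
        simp [hdw, h3, (hd0 h3).2 ⟨hi, hdw⟩]
      · by_cases h3 : G.dist s w % 3 = r % 3
        · have : (q w).dom = false := by
            rw [← Bool.not_eq_true, hd0 h3]
            exact fun h => hdw h.2
          simp [this, hdw]
        · simp [h3, hdw]
    · have : ¬ dom r w := fun h => hi (hS.dom_inf r w h).1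
      simp [hi, this]
  intro v
  obtain ⟨hl, hm, hd⟩ := hq v
  by_cases hF : Fresh G s inf dom r v
  · obtain ⟨h1, h2, h3⟩ := id hF
    have hh := radioHeard_const (G := G) hsend (v := v) (fun h => h1 (hS.dom_inf r v h).1)
    rw [if_pos h3] at hh
    have h4 : inf (r + 1) v := (hS.step r v).2 (.inr ⟨h2, .inl h3⟩)
    simp only [hh]
    rw [fbRecv_message (by simp [hm, h1]) (by rw [hl, hL.lev, h5, h2])]
    refine ⟨hl, by simp [hF], by simp [hF, h0], fun j hj h6 => ?_⟩
    -- A node informed in block `r` is next active in block `r + 1`, and its Join bit speaks about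
    -- just this block.
    obtain rfl : j = 1 := by omega
    simp only [hl, hL.join r v h1 h4, hF, or_true, true_and]
  · have hrecv : fbRecv (5 * r) (q v) (radioHeard G (fun w => fbSend (5 * r) (q w)) v) =
        { q v with fresh := false } := by
      apply fbRecv_of_ne (by omega)
      by_cases h1 : inf r v
      · exact .inl (by simp [hm, h1])
      by_cases h2 : G.dist s v % 3 = (r + 1) % 3
      · refine .inr (.inr ?_)
        rw [radioHeard_const (G := G) hsend (v := v) (fun h => h1 (hS.dom_inf r v h).1),
          if_neg fun h3 => hF ⟨h1, h2, h3⟩]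
      · exact .inr (.inl (by rw [hl, hL.lev, h5]; exact h2))
    simp only [hrecv]
    refine ⟨hl, by simp [hF, hm], by simp [hF], fun j hj h6 => ?_⟩
    simp only [hF, or_false]
    exact hd j hj h6

/-- A dominating node hears its own feedback node undisturbed: every node transmitting control bits
is a feedback node of this block, and by privacy it is adjacent to no dominating node but its own.
-/
theorem feedback_step (hS : Schedule G s inf dom go fb)
    (hL : Prescribes G s label inf dom go fb) {r : ℕ} {q : V → FBState M}
    (hq : BroadcastInv G s inf dom label μ r q) :
    ControlInv G s dom go label μ r (fun v => inf r v ∨ Fresh G s inf dom r v) fun v =>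
      fbRecv (5 * r + 1) (q v) (radioHeard G (fun w => fbSend (5 * r + 1) (q w)) v) := by
  classical
  have h0 : (5 * r + 1) % 5 = 1 := by omega
  have h5 : (5 * r + 1) / 5 = r := by omega
  have hsend : ∀ w, fbSend (5 * r + 1) (q w) =
      if Fresh G s inf dom r w ∧ (labelOrders (label w)).nonzero = true then
        some (.control (labelOrders (label w))) else none := by
    intro w
    obtain ⟨hl, hm, hf, -⟩ := hq w
    unfold fbSend
    rw [hm, h0, h5, hl]
    by_cases hF : Fresh G s inf dom r w
    · simp [hF, hf.2 hF]
    · have : (q w).fresh = false := by rwa [← Bool.not_eq_true, hf]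
      by_cases hi : inf r w <;> simp [hF, hi, this]
  have hheard : ∀ v, dom r v →
      heardOrders (radioHeard G (fun w => fbSend (5 * r + 1) (q w)) v) =
        labelOrders (label (fb r v)) := by
    intro v hv
    have hFb : Fresh G s inf dom r (fb r v) := by
      have h := hS.feedback r v hv
      refine ⟨h.1, ?_, v, ⟨(hS.adj_feedback hv).symm, hv⟩, fun w hw => (h.2.2 w hw.2).1 hw.1.symm⟩
      have := (hS.dom_inf r v hv).2
      omega
    have huniq : ∀ w, G.Adj v w ∧ fbSend (5 * r + 1) (q w) ≠ none → w = fb r v := by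
      rintro w ⟨hw1, hw2⟩
      rw [hsend w] at hw2
      split_ifs at hw2 with hw3
      · by_contra hne
        -- If `w` gave feedback to some `v'` in some block, this block would be `r`, as `w` is
        -- informed now; being adjacent to `v`, it would have `v' = v`. So `w` has only zero bits
        -- and does not transmit.
        have hz := hL.silent w fun r' v' hv' he => hne <| by
          have h1 := (hS.feedback r' v' hv').1
          have h2 := hS.inf_feedback hv'
          rw [he] at h1 h2
          obtain rfl := hS.block_eq hw3.1.1 ((hS.step r w).2 (.inr ⟨hw3.1.2.1, .inl hw3.1.2.2⟩)) h1 h2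
          have h3 := ((hS.feedback r v' hv').2.2 v hv).1 (by rwa [he])
          rw [h3, he]
        rw [hz] at hw3
        exact absurd hw3.2 (by decide)
      · exact absurd rfl hw2
    have hv0 : fbSend (5 * r + 1) (q v) = none := by
      rw [hsend, if_neg fun h => h.1.1 (hS.dom_inf r v hv).1]
    by_cases hnz : (labelOrders (label (fb r v))).nonzero = true
    · have hs : fbSend (5 * r + 1) (q (fb r v)) = some (.control (labelOrders (label (fb r v)))) := by
        rw [hsend, if_pos ⟨hFb, hnz⟩]
      have hs' : fbSend (5 * r + 1) (q (fb r v)) ≠ none := by simp [hs]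
      rw [radioHeard_eq_some (w := fb r v) hv0 ⟨fb r v, ⟨hS.adj_feedback hv, hs'⟩, huniq⟩
        (hS.adj_feedback hv) hs', hs]
      rfl
    -- A feedback node with four zero bits keeps silent, and silence is read as four zeros.
    · rw [radioHeard_eq_none]
      · simp only [Orders.nonzero, Bool.or_eq_true, not_or, Bool.not_eq_true] at hnz
        ext <;> simp [heardOrders, Orders.zero, hnz]
      · rintro ⟨w, hw, -⟩
        obtain rfl := huniq w hw
        apply hw.2
        rw [hsend, if_neg fun h => hnz h.2]
  intro v
  obtain ⟨hl, hm, -, hd⟩ := hq v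
  beta_reduce
  have hlev : labelLev (q v).label = G.dist s v % 3 := by rw [hl, hL.lev]
  rw [fbRecv_feedback h0, h5, hlev]
  · by_cases h3 : G.dist s v % 3 = r % 3
    · rw [if_pos h3]
      have hnF : ¬ Fresh G s inf dom r v := fun h => by
        have := h.2.1
        omega
      have hd0 := hd 0 (by norm_num) h3
      simp only [hnF, or_false, add_zero] at hd0
      by_cases hdv : dom r v
      · have hqd : (q v).dom = true := hd0.2 ⟨(hS.dom_inf r v hdv).1, hdv⟩
        simp only [hqd, if_true, hheard v hdv]
        refine ⟨hl, hm.trans (by congr), fun j hj h6 => ?_, fun _ => ⟨hL.go r v hdv, hL.fast _, hL.rescue _⟩⟩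
        -- The next active block of `v` is `r + 3`, which is what the Stay bit decides.
        obtain rfl : j = 2 := by omega
        rw [hL.stay r v hdv]
        exact ⟨fun h => ⟨.inl (hS.dom_inf r v hdv).1, h⟩, fun h => h.2⟩
      · have hqd : (q v).dom = false := by
          rw [← Bool.not_eq_true, hd0]
          exact fun h => hdv h.2
        simp only [hqd, Bool.false_eq_true, if_false]
        refine ⟨hl, hm.trans (by congr), fun j hj h6 => ?_, fun _ => ⟨?_, rfl, rfl⟩⟩
        · obtain rfl : j = 2 := by omega
          simp only [Orders.zero, Bool.false_eq_true, false_iff, hnF, or_false]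
          -- An informed node outside the dominating set never enters it later.
          exact fun h => hdv (hS.persist r v h.2 h.1)
        · simp only [Orders.zero, Bool.false_eq_true, false_iff]
          exact fun h => hdv (hS.go_dom r v h)
    · rw [if_neg h3]
      refine ⟨hl, hm.trans (by congr), fun j hj h6 => ?_, fun h => absurd h h3⟩
      have hj : j + 1 < 3 := by omega
      exact hd (j + 1) hj h6
  · right
    intro μ' hμ
    obtain ⟨w, hw⟩ := radioHeard_sent hμ
    rw [hsend] at hw
    split_ifs at hw
    simp at hw

theorem go_step (hS : Schedule G s inf dom go fb)
    (hL : Prescribes G s label inf dom go fb) {r : ℕ} {q : V → FBState M}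
    (hq : ControlInv G s dom go label μ r (fun v => inf r v ∨ Fresh G s inf dom r v) q) :
    ControlInv G s dom go label μ r (inf (r + 1)) fun v =>
      fbRecv (5 * r + 2) (q v) (radioHeard G (fun w => fbSend (5 * r + 2) (q w)) v) := by
  classical
  have h0 : (5 * r + 2) % 5 = 2 := by omega
  have h5 : (5 * r + 2) / 5 = r := by omega
  have hsend : ∀ w, fbSend (5 * r + 2) (q w) = if go r w then some (.message μ) else none := by
    intro w
    obtain ⟨hl, hm, -, ho⟩ := hq w
    unfold fbSend
    rw [hm, h0, h5, hl, hL.lev]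
    by_cases hg : go r w
    · have h1 := hS.dom_inf r w (hS.go_dom r w hg)
      simp [hg, h1.1, h1.2, ((ho h1.2).1).2 hg]
    · by_cases h3 : G.dist s w % 3 = r % 3
      · have : (q w).orders.go = false := by
          rw [← Bool.not_eq_true, (ho h3).1]
          exact hg
        split <;> simp [hg, this]
      · split <;> simp [hg, h3]
  intro v
  obtain ⟨hl, hm, hd, ho⟩ := hq v
  beta_reduce at hm hd ⊢
  by_cases h1 : inf r v ∨ Fresh G s inf dom r v
  · have h2 : inf (r + 1) v := by
      rcases h1 with h1 | h1
      · exact hS.mono (Nat.le_succ r) h1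
      · exact (hS.step r v).2 (.inr ⟨h1.2.1, .inl h1.2.2⟩)
    rw [fbRecv_of_ne (by omega) (.inl (by simp [hm, h1]))]
    refine ⟨hl, by simp [hm, h1, h2], fun j hj h6 => ?_, ho⟩
    simp only [h2, hd j hj h6, h1, true_and]
  · rw [not_or] at h1
    have hh := radioHeard_const (G := G) hsend (v := v)
      (fun h => h1.1 (hS.dom_inf r v (hS.go_dom r v h)).1)
    by_cases h2 : inf (r + 1) v
    · obtain ⟨h3, h4⟩ := ((hS.step r v).1 h2).resolve_left h1.1
      have h4 := h4.resolve_left fun h => h1.2 ⟨h1.1, h3, h⟩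
      rw [hh, if_pos h4, fbRecv_message (by simp [hm, h1]) (by rw [hl, hL.lev, h5, h3])]
      refine ⟨hl, by simp [h2], fun j hj h6 => ?_, ho⟩
      -- The index is shifted in `ControlInv`: `j = 0` stands for block `r + 1`, the first active
      -- block of the new node.
      obtain rfl : j = 0 := by omega
      simp only [hl, hL.join r v h1.1 h2, h2, true_and, zero_add]
    · rw [fbRecv_of_ne (by omega)]
      · refine ⟨hl, by simp [hm, h1, h2], fun j hj h6 => ?_, ho⟩
        simp only [h2, hd j hj h6, h1, or_self, false_and]
      · by_cases h3 : G.dist s v % 3 = (r + 1) % 3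
        · refine .inr (.inr ?_)
          rw [hh, if_neg fun h4 => h2 ((hS.step r v).2 (.inr ⟨h3, .inr h4⟩))]
        · exact .inr (.inl (by rw [hl, hL.lev, h5]; exact h3))

theorem silent_step (hL : Prescribes G s label inf dom go fb) {r i : ℕ}
    (hi : i = 3 ∨ i = 4)
    {X : V → Prop} {q : V → FBState M} (hq : ControlInv G s dom go label μ r X q) :
    ControlInv G s dom go label μ r X fun v =>
      fbRecv (5 * r + i) (q v) (radioHeard G (fun w => fbSend (5 * r + i) (q w)) v) := by
  have h0 : (5 * r + i) % 5 = i := by omega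
  have h5 : (5 * r + i) / 5 = r := by omega
  have hsend : ∀ w, fbSend (5 * r + i) (q w) = none := by
    intro w
    obtain ⟨hl, -, -, ho⟩ := hq w
    unfold fbSend
    rw [h0, h5, hl, hL.lev]
    by_cases h3 : G.dist s w % 3 = r % 3
    · rcases hi with rfl | rfl <;> split <;> simp [ho h3]
    · rcases hi with rfl | rfl <;> split <;> simp [h3]
  intro v
  obtain ⟨hl, hm, hd, ho⟩ := hq v
  beta_reduce at hm hd ⊢
  rw [fbRecv_of_ne (by omega) (.inr (.inr (radioHeard_eq_none (by simp [hsend]))))]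
  exact ⟨hl, hm, hd, ho⟩

theorem blockInv (hS : Schedule G s inf dom go fb) (hL : Prescribes G s label inf dom go fb)
    (r : ℕ) : BlockInv G s inf dom label μ r (fbState G label s μ r) := by
  classical
  induction r with
  | zero =>
    intro v
    have h0 : fbState G label s μ 0 v = ⟨label v, if v = s then some μ else none,
        (if v = s then some μ else none).isSome && labelJoin (label v), false, Orders.zero⟩ := by
      change (fastBroadcast M).init _ _ = _
      unfold fastBroadcast
      by_cases hv : v = s <;> simp [hv]
    rw [h0]
    refine ⟨rfl, by simp [hS.init], fun j hj h => ?_⟩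
    by_cases hv : v = s
    · subst hv
      rw [SimpleGraph.dist_self] at h
      obtain rfl : j = 0 := by omega
      simp [hL.join_source, hS.init]
    · simp [hv, hS.init]
  | succ r ih =>
    have h1 : BroadcastInv G s inf dom label μ r
      ((fastBroadcast M).run G label s μ (5 * r + 1)) := broadcast_step hS hL ih
    have h2 : ControlInv G s dom go label μ r (fun v => inf r v ∨ Fresh G s inf dom r v)
      ((fastBroadcast M).run G label s μ (5 * r + 2)) := feedback_step hS hL h1
    have h3 : ControlInv G s dom go label μ r (inf (r + 1))
      ((fastBroadcast M).run G label s μ (5 * r + 3)) := go_step hS hL h2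
    have h4 : ControlInv G s dom go label μ r (inf (r + 1))
      ((fastBroadcast M).run G label s μ (5 * r + 4)) := silent_step hL (.inl rfl) h3
    have h5 : ControlInv G s dom go label μ r (inf (r + 1))
      ((fastBroadcast M).run G label s μ (5 * r + 5)) := silent_step hL (.inr rfl) h4
    intro v
    obtain ⟨hl, hm, hd, -⟩ := h5 v
    rw [fbState, mul_add, mul_one]
    refine ⟨hl, hm, fun j hj h6 => ?_⟩
    rw [add_right_comm, add_assoc] at h6 ⊢
    exact hd j hj h6

theorem informedBefore_iff (hS : Schedule G s inf dom go fb)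
    (hL : Prescribes G s label inf dom go fb) {r : ℕ} {v : V} : InformedBefore G label s μ r v ↔ inf r v := by
  classical
  rw [InformedBefore, (blockInv hS hL r v).2.1]
  by_cases h : inf r v <;> simp [h]

theorem mem_domSet_iff (hS : Schedule G s inf dom go fb)
    (hL : Prescribes G s label inf dom go fb) {r : ℕ} {v : V} : v ∈ domSet G label s μ r ↔ dom r v := by
  have h := (blockInv (μ := μ) hS hL r v).2.2 0 (by norm_num)
  constructor
  · rintro ⟨h1, h2⟩
    exact ((h h2).1 h1).2
  · intro h1
    obtain ⟨h2, h3⟩ := hS.dom_inf r v h1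
    exact ⟨(h h3).2 ⟨h2, h1⟩, h3⟩

/-- All rules about the Fast and Rescue bits hold vacuously: a node informed before its ultimate
block is not needy. For the same reason the rescue nodes may be arbitrary, here `id`. -/
theorem follows [Fintype V] (hS : Schedule G s inf dom go fb)
    (hL : Prescribes G s label inf dom go fb) 
    {parent : V → V} {h : V → ℕ} (hT : IsTwoHRT G s parent h)
    (hdue : ∀ v, inf (ultimateBlock G s h v) v) :
    FollowsFastScheme G label s μ parent h fb id := by
  have hI : ∀ r v, InformedBefore G label s μ r v ↔ inf r v := fun r v =>
    informedBefore_iff hS hL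
  have hD : ∀ r v, v ∈ domSet G label s μ r ↔ dom r v := fun r v => mem_domSet_iff hS hL
  have hN : ∀ v, ¬ NeedsHelp G label s μ parent h v := fun v hv =>
    hv.2.1 ((hI _ _).2 (hdue v))
  refine ⟨hT, hL.lev, fun r => ⟨⟨?_, ?_⟩, ?_⟩, ?_, ?_, ?_, ?_, ?_, ?_⟩
  · intro v hv
    rw [hI]
    exact hS.dom_inf r v ((hD r v).1 hv)
  · intro u w hu hw h1 h2 h3
    rw [hI] at hu hw
    obtain ⟨w', h4, h5⟩ := hS.cover r u w hu hw h1 h2 h3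
    exact ⟨w', (hD r w').2 h4, h5⟩
  -- Minimality: a dominating subset has to cover the feedback node of `v`, and only `v` can do
  -- that.
  · intro S hS' hSD v hv
    rw [hD] at hv
    obtain ⟨h1, h2, h3⟩ := hS.feedback r v hv
    obtain ⟨h4, h5⟩ := hS.dom_inf r v hv
    obtain ⟨w, hw, hadj⟩ := hS'.2 (fb r v) v (by rwa [hI]) (by rwa [hI]) (hS.adj_feedback hv) h2 h5
    rwa [← (h3 w ((hD r w).1 (hSD hw))).1 hadj]
  · intro r v hv
    rw [hD] at hv
    simp only [hI, hD]
    exact hS.feedback r v hv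
  · intro u hu
    exact hL.silent u fun r v hv => hu r v ((hD r v).2 hv)
  · intro r v hv
    rw [hD] at hv ⊢
    exact hL.stay r v hv
  · intro r v hv
    simp [hL.fast, hN]
  · exact fun u hu => absurd hu (hN u)
  · intro r v hv
    simp [hL.rescue, hN]

end Schedule

/-! ### Construction of a 2-height respecting tree -/

/-- The 2-height of a node whose children are `C` exceeds `k`. -/
def HeightAbove {V : Type} (C : V → Prop) (h : V → ℕ) (k : ℕ) : Prop :=
  ∃ u, C u ∧ (k < h u ∨ h u = k ∧ ∃ u', C u' ∧ u ≠ u' ∧ h u' = k)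

theorem HeightAbove.congr {V : Type} {C C' : V → Prop} {h h' : V → ℕ} {k : ℕ}
    (hC : ∀ u, C u ↔ C' u) (hh : ∀ u, C u → h u = h' u) :
    HeightAbove C h k ↔ HeightAbove C' h' k := by
  unfold HeightAbove
  constructor
  · rintro ⟨u, hu, h1 | ⟨h1, u', hu', h2, h3⟩⟩
    · exact ⟨u, (hC u).1 hu, .inl (hh u hu ▸ h1)⟩
    · exact ⟨u, (hC u).1 hu, .inr ⟨hh u hu ▸ h1, u', (hC u').1 hu', h2, hh u' hu' ▸ h3⟩⟩
  · rintro ⟨u, hu, h1 | ⟨h1, u', hu', h2, h3⟩⟩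
    · rw [← hC] at hu
      exact ⟨u, hu, .inl (by rwa [hh u hu])⟩
    · rw [← hC] at hu hu'
      exact ⟨u, hu, .inr ⟨by rwa [hh u hu], u', hu', h2, by rwa [hh u' hu']⟩⟩

section tree
variable {n : ℕ} (G : SimpleGraph (Fin n)) (s : Fin n)

/-- `u` has no parent yet (`p u = n`) and could become a child of `w`. -/
def FreeChild (p : Fin n → ℕ) (w u : Fin n) : Prop :=
  p u = n ∧ G.Adj w u ∧ G.dist s u = G.dist s w + 1

/-- The invariant of the construction: `p` gives the parents found so far (`n` for a node without
one), and `h` the heights. -/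
structure TreeInv (p h : Fin n → ℕ) : Prop where
  root : p s = s
  par_le : ∀ u, p u ≤ n
  height_lt : ∀ v, h v + G.dist s v < n
  adj : ∀ u w : Fin n, u ≠ s → p u = w → G.Adj w u ∧ G.dist s u = G.dist s w + 1
  taken : ∀ u w : Fin n, u ≠ s → p u = w → ∀ x, ¬ FreeChild G s p w x
  closed : ∀ u w : Fin n, u ≠ s → p u = w → ∀ v x, G.dist s u ≤ G.dist s v →
    ¬ FreeChild G s p v x
  height : ∀ v k, k < h v ↔ HeightAbove (fun u => u ≠ s ∧ p u = (v : ℕ)) h k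
  respect_free : ∀ u w v x : Fin n, u ≠ s → p u = w → h u = h w → G.Adj v u →
    G.dist s u = G.dist s v + 1 → FreeChild G s p v x → h x ≠ h u
  respect : ∀ u u' w w' v : Fin n, u ≠ u' → u ≠ s → u' ≠ s → p u = w → p u' = w' →
    h u = h w → h u' = h w' → G.dist s u = G.dist s u' → h u = h u' → G.Adj v u → G.Adj v u' →
    G.dist s u ≠ G.dist s v + 1

variable {G s}

/-- Deeper levels are finished first, so the children of `w` have their final heights. The
respecting property rests on the maximality of `H w`: if two free nodes of equal height `k` have a
common neighbour `v` on the level of `w`, then `k < H v ≤ H w`, so neither gets a fast edge to `w`.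
-/
theorem TreeInv.step {p h p' h' H : Fin n → ℕ} (hT : TreeInv G s p h)
    (hH : ∀ v k, k < H v ↔ HeightAbove (FreeChild G s p v) h k) {w x₀ : Fin n}
    (hw : FreeChild G s p w x₀)
    (hmax : ∀ v x, FreeChild G s p v x →
      G.dist s v < G.dist s w ∨ G.dist s v = G.dist s w ∧ H v ≤ H w)
    (hdist : G.dist s w < n)
    (hp1 : ∀ u, FreeChild G s p w u → p' u = w) (hp2 : ∀ u, ¬ FreeChild G s p w u → p' u = p u)
    (hh1 : h' w = H w) (hh2 : ∀ v, v ≠ w → h' v = h v) : TreeInv G s p' h' := by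
  have hfree : ∀ v x, FreeChild G s p' v x → FreeChild G s p v x ∧ ¬ FreeChild G s p w x := by
    intro v x hx
    by_cases h1 : FreeChild G s p w x
    · have h2 := hp1 x h1
      rw [hx.1] at h2
      exact absurd w.2 (by omega)
    · exact ⟨⟨hp2 x h1 ▸ hx.1, hx.2⟩, h1⟩
  have hcase : ∀ u a : Fin n, p' u = a → FreeChild G s p w u ∧ a = w ∨
      ¬ FreeChild G s p w u ∧ p u = a := by
    intro u a ha
    by_cases h1 : FreeChild G s p w u
    · exact .inl ⟨h1, Fin.ext (by rw [← ha, hp1 u h1])⟩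
    · exact .inr ⟨h1, by rw [← ha, hp2 u h1]⟩
  have hhn : ∀ v u, G.dist s v = G.dist s w → G.dist s u = G.dist s v + 1 → h' u = h u :=
    fun v u h1 h2 => hh2 u (by rintro rfl; omega)
  have hhf : ∀ u, FreeChild G s p w u → h' u = h u := fun u hu => hhn w u rfl hu.2.2
  have hho : ∀ u a : Fin n, u ≠ s → p u = a → h' u = h u := fun u a h1 h2 =>
    hh2 u (by rintro rfl; exact hT.closed u a h1 h2 u x₀ le_rfl hw)
  have hha : ∀ u a : Fin n, u ≠ s → p u = a → h' a = h a := fun u a h1 h2 =>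
    hh2 a (by rintro rfl; exact hT.taken u a h1 h2 x₀ hw)
  have hfs : ∀ u, FreeChild G s p w u → u ≠ s := by
    rintro u hu rfl
    have h1 := hu.1
    rw [hT.root] at h1
    exact absurd u.2 (by omega)
  refine ⟨?_, ?_, ?_, ?_, ?_, ?_, ?_, ?_, ?_⟩
  · rw [hp2 s fun h => hfs s h rfl, hT.root]
  · intro u
    by_cases h1 : FreeChild G s p w u
    · rw [hp1 u h1]; exact w.2.le
    · rw [hp2 u h1]; exact hT.par_le u
  · intro v
    by_cases hv : v = w
    · subst hv
      rw [hh1]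
      by_contra hlt
      -- Some child has height at least `H v - 1` and lies one level deeper, so the sum of height
      -- and level does not grow.
      obtain ⟨u, hu, h1⟩ := (hH v (H v - 1)).1 (by omega)
      have h2 := hT.height_lt u
      have h3 := hu.2.2
      omega
    · rw [hh2 v hv]; exact hT.height_lt v
  · intro u a hu ha
    rcases hcase u a ha with ⟨h1, rfl⟩ | ⟨-, h1⟩
    · exact h1.2
    · exact hT.adj u a hu h1
  · intro u a hu ha x hx
    rcases hcase u a ha with ⟨h1, rfl⟩ | ⟨-, h1⟩
    · exact (hfree _ x hx).2 (hfree _ x hx).1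
    · exact hT.taken u a hu h1 x (hfree _ x hx).1
  · intro u a hu ha v x hle hx
    rcases hcase u a ha with ⟨h1, rfl⟩ | ⟨-, h1⟩
    · have h2 := h1.2.2
      have h3 := hmax v x (hfree _ x hx).1
      omega
    · exact hT.closed u a hu h1 v x hle (hfree _ x hx).1
  · intro v k
    by_cases hv : v = w
    · subst hv
      rw [hh1, hH]
      refine HeightAbove.congr (fun u => ?_) fun u hu => (hhf u hu).symm
      constructor
      · exact fun hu => ⟨hfs u hu, hp1 u hu⟩
      · rintro ⟨hu, ha⟩
        rcases hcase u v ha with ⟨h1, -⟩ | ⟨-, h1⟩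
        · exact h1
        · exact absurd hw (hT.taken u v hu h1 x₀)
    · rw [hh2 v hv, hT.height]
      refine HeightAbove.congr (fun u => and_congr_right fun hu => ?_)
        fun u hu => (hho u v hu.1 hu.2).symm
      constructor
      · intro ha
        rw [hp2 u, ha]
        intro h1
        have h2 := h1.1
        rw [ha] at h2
        exact absurd v.2 (by omega)
      · intro ha
        rcases hcase u v ha with ⟨-, h1⟩ | ⟨-, h1⟩
        · exact absurd h1 hv
        · exact h1
  · intro u a v x hu ha hf hadj hd hx heq
    have hx' := (hfree _ x hx).1
    rcases hcase u a ha with ⟨h1, rfl⟩ | ⟨-, h1⟩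
    · have hvd : G.dist s v = G.dist s a := by have := h1.2.2; omega
      rw [hhn v x hvd hx'.2.2, hhf u h1] at heq
      rw [hhf u h1, hh1] at hf
      -- Both `u` and `x` were free children of `v` of the same height, whence `H v > h u = H a`,
      -- against the choice of `a`.
      have hlt : h u < H v := (hH v (h u)).2 ⟨u, ⟨h1.1, hadj, hd⟩, .inr ⟨rfl, x, hx', ?_, heq⟩⟩
      · have := hmax v x hx'
        omega
      · rintro rfl
        exact (hfree _ u hx).2 h1
    · rw [hho u a hu h1] at hf heq
      rw [hha u a hu h1] at hf
      refine hT.respect_free u a v x hu h1 hf hadj hd hx' ?_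
      rw [← heq, hh2]
      rintro rfl
      refine hT.closed u a hu h1 x x₀ ?_ hw
      rw [hd, hx'.2.2]
  · intro u u' a a' v hne hu hu' ha ha' hf hf' hd heq hadj hadj' hlev
    rcases hcase u a ha with ⟨h1, rfl⟩ | ⟨-, h1⟩ <;> rcases hcase u' a' ha' with ⟨h2, rfl⟩ | ⟨-, h2⟩
    · rw [hhf u h1] at hf heq
      rw [hhf u' h2] at heq
      rw [hh1] at hf
      -- Two new children of equal height already raise the height of the common parent above
      -- theirs, so their edges are not fast.
      have hlt : h u < H a' := (hH a' (h u)).2 ⟨u, h1, .inr ⟨rfl, u', h2, hne, heq.symm⟩⟩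
      omega
    · rw [hhf u h1, hho u' a' hu' h2] at heq
      rw [hho u' a' hu' h2, hha u' a' hu' h2] at hf'
      exact hT.respect_free u' a' v u hu' h2 hf' hadj' (by omega) ⟨h1.1, hadj, hlev⟩ heq
    · rw [hhf u' h2, hho u a hu h1] at heq
      rw [hho u a hu h1, hha u a hu h1] at hf
      exact hT.respect_free u a v u' hu h1 hf hadj hlev ⟨h2.1, hadj', by omega⟩ heq.symm
    · rw [hho u a hu h1, hha u a hu h1] at hf
      rw [hho u' a' hu' h2, hha u' a' hu' h2] at hf'
      rw [hho u a hu h1, hho u' a' hu' h2] at heq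
      exact hT.respect u u' a a' v hne hu hu' h1 h2 hf hf' hd heq hadj hadj' hlev

end tree

/-! ### Properties of 2-heights -/

section height
variable {V : Type} {s : V} {parent : V → V} {h : V → ℕ}

/-- A recursive description of the 2-height function. -/
def HeightSpec (s : V) (parent : V → V) (h : V → ℕ) : Prop :=
  ∀ v k, k < h v ↔ HeightAbove (fun u => IsChild s parent u v) h k

theorem HeightSpec.le_parent (hh : HeightSpec s parent h) {u : V} (hu : u ≠ s) :
    h u ≤ h (parent u) := by
  by_contra hlt
  have h1 := (hh (parent u) (h (parent u))).2 ⟨u, ⟨hu, rfl⟩, .inl (by omega)⟩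
  omega

theorem HeightSpec.isTwoHeight (hh : HeightSpec s parent h) : IsTwoHeight s parent h := by
  refine ⟨fun v hv => ?_, fun v u hu hmax => ?_, fun v u u' hu hu' hne heq hmax => ?_⟩
  · by_contra h0
    obtain ⟨u, hu, -⟩ := (hh v 0).1 (by omega)
    exact hv u hu
  · apply le_antisymm
    · by_contra hlt
      obtain ⟨w, hw, h1⟩ := (hh v (h u)).1 (by omega)
      rcases h1 with h1 | ⟨h1, w', hw', hne, h2⟩
      · have := hmax w hw (by rintro rfl; omega)
        omega
      · by_cases h3 : w = u
        · have := hmax w' hw' (by rintro rfl; exact hne h3)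
          omega
        · have := hmax w hw h3
          omega
    · have := hh.le_parent hu.1
      rwa [hu.2] at this
  · apply le_antisymm
    · by_contra hlt
      obtain ⟨w, hw, h1⟩ := (hh v (h u + 1)).1 (by omega)
      have := hmax w hw
      omega
    · exact (hh v (h u)).2 ⟨u, hu, .inr ⟨rfl, u', hu', hne, heq.symm⟩⟩

open Classical in
-- Either one child has height at least `h v`, or two children of height `h v - 1` together
-- contribute `2 ^ h v`; the summand 1 accounts for leaves.
theorem HeightSpec.two_pow_le [Fintype V] (hh : HeightSpec s parent h) (v : V) :
    2 ^ h v ≤ 1 + ∑ u with IsChild s parent u v, 2 ^ h u := by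
  rcases Nat.eq_zero_or_pos (h v) with h0 | h0
  · simp [h0]
  obtain ⟨u, hu, h1⟩ := (hh v (h v - 1)).1 (by omega)
  have hmem : u ∈ Finset.univ.filter fun u => IsChild s parent u v := by simpa using hu
  rcases h1 with h1 | ⟨h1, u', hu', hne, h2⟩
  · have h3 := Finset.single_le_sum (f := fun u => 2 ^ h u) (fun _ _ => Nat.zero_le _) hmem
    have h4 : 2 ^ h v ≤ 2 ^ h u := Nat.pow_le_pow_right (by norm_num) (by omega)
    omega
  · have hsub : ({u, u'} : Finset V) ⊆ Finset.univ.filter fun u => IsChild s parent u v := by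
      intro w
      simp only [Finset.mem_insert, Finset.mem_singleton, Finset.mem_filter, Finset.mem_univ,
        true_and]
      rintro (rfl | rfl) <;> assumption
    have h3 := Finset.sum_le_sum_of_subset (f := fun u => 2 ^ h u) hsub
    rw [Finset.sum_pair hne, h1, h2] at h3
    have h4 : 2 ^ h v = 2 ^ (h v - 1) + 2 ^ (h v - 1) := by
      obtain ⟨k, hk⟩ := Nat.exists_eq_succ_of_ne_zero h0.ne'
      rw [hk, Nat.succ_sub_one, pow_succ]
      ring
    omega

/-- Summed over all nodes, the inequality of `two_pow_le` has every node except the root on both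
sides; cancellation leaves the root against one unit per node. -/
theorem HeightSpec.two_pow_root_le [Fintype V] (hh : HeightSpec s parent h) :
    2 ^ h s ≤ Fintype.card V := by
  classical
  have h1 : ∑ v, 2 ^ h v ≤ ∑ v, (1 + ∑ u with IsChild s parent u v, 2 ^ h u) :=
    Finset.sum_le_sum fun v _ => by
      have := hh.two_pow_le v
      convert this
  have h2 : ∑ v, ∑ u with IsChild s parent u v, 2 ^ h u = ∑ u with u ≠ s, 2 ^ h u := by
    simp only [Finset.sum_filter]
    rw [Finset.sum_comm]
    refine Finset.sum_congr rfl fun u _ => ?_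
    by_cases hu : u = s <;> simp [IsChild, hu]
  have h3 : ∑ v, 2 ^ h v = ∑ u with u ≠ s, 2 ^ h u + 2 ^ h s := by
    rw [← Finset.sum_filter_add_sum_filter_not Finset.univ (fun u => u ≠ s)]
    congr 1
    rw [Finset.sum_filter]
    simp
  rw [Finset.sum_add_distrib, h2, h3] at h1
  simp only [Finset.sum_const, smul_eq_mul, mul_one, Finset.card_univ] at h1
  omega

theorem HeightSpec.le_root {G : SimpleGraph V} (hh : HeightSpec s parent h)
    (hB : IsBFSTree G s parent) (v : V) : h v ≤ h s := by
  induction hd : G.dist s v using Nat.strong_induction_on generalizing v with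
  | _ d ih =>
    by_cases hv : v = s
    · rw [hv]
    · have := hB.level v hv
      exact (hh.le_parent hv).trans (ih _ (by omega) _ rfl)

/-- Every node of positive height has a child whose height is smaller by at most one. Following such
children down reaches a node of height 0 on level at least `h v + G.dist s v`. -/
theorem HeightSpec.add_dist_le {G : SimpleGraph V} (hh : HeightSpec s parent h)
    (hB : IsBFSTree G s parent) {D : ℕ} (hD : ∀ v, G.dist s v ≤ D) (v : V) :
    h v + G.dist s v ≤ D := by
  induction hd : D - G.dist s v using Nat.strong_induction_on generalizing v with
  | _ d ih =>
    rcases Nat.eq_zero_or_pos (h v) with h0 | h0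
    · have := hD v
      omega
    · obtain ⟨u, ⟨hu, rfl⟩, h1⟩ := (hh v (h v - 1)).1 (by omega)
      have h2 := hB.level u hu
      have h3 := hD u
      have := ih (D - G.dist s u) (by omega) u rfl
      omega

end height

/-! ### Correctness of the tree construction -/

section
variable {n : ℕ} {G : SimpleGraph (Fin n)} {s : Fin n}

open Classical in
/-- The network as an input of the labeling program. -/
noncomputable def netOf (G : SimpleGraph (Fin n)) (s : Fin n) : Net :=
  (List.ofFn fun i => List.ofFn fun j => decide (G.Adj i j), List.ofFn fun i => decide (i = s))

theorem enc_netOf : Enc.enc (netOf G s) = encodeNetwork G s := by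
  simp only [netOf, encodeNetwork, Enc.enc, List.map_ofFn, Function.comp_def]

@[simp] theorem nodes_netOf : (netOf G s).nodes = n := by simp [Net.nodes, netOf]

@[simp] theorem adj_netOf {i j : Fin n} : (netOf G s).adj i j = true ↔ G.Adj i j := by
  simp [Net.adj, netOf, List.getD_eq_getElem?_getD]

@[simp] theorem isSource_netOf {i : Fin n} : (netOf G s).isSource i = true ↔ i = s := by
  simp [Net.isSource, netOf, List.getD_eq_getElem?_getD]

theorem SimpleGraph.Connected.exists_adj_dist {V : Type} {G : SimpleGraph V} (hG : G.Connected)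
    {s v : V} (hv : v ≠ s) : ∃ w, G.Adj w v ∧ G.dist s v = G.dist s w + 1 := by
  obtain ⟨p, hp⟩ := hG.exists_walk_length_eq_dist v s
  cases p with
  | nil => exact absurd rfl hv
  | @cons _ w _ h q =>
    refine ⟨w, h.symm, ?_⟩
    have h1 := SimpleGraph.dist_le q
    rw [SimpleGraph.Walk.length_cons] at hp
    have h2 := h.symm.diff_dist_adj (u := s)
    rw [SimpleGraph.dist_comm (u := v)] at hp
    rw [SimpleGraph.dist_comm] at h1
    omega

theorem dist_lt_card (hG : G.Connected) (v : Fin n) : G.dist s v < n := by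
  obtain ⟨p, hp, hl⟩ := hG.exists_path_of_dist s v
  have := hp.length_lt
  rw [Fintype.card_fin] at this
  omega

theorem ball_netOf (hG : G.Connected) (k : ℕ) (i : Fin n) :
    ((netOf G s).ball k).getD i false = true ↔ G.dist s i ≤ k := by
  induction k generalizing i with
  | zero =>
    rw [Net.ball, loopN, nodes_netOf, getD_tab_fin, isSource_netOf, Nat.le_zero,
      hG.dist_eq_zero_iff, eq_comm]
  | succ k ih =>
    have h1 : (netOf G s).ball (k + 1) = tab (netOf G s).nodes fun i =>
      ((netOf G s).ball k).getD i false || any (netOf G s).nodes fun j =>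
        ((netOf G s).ball k).getD j false && (netOf G s).adj j i := rfl
    rw [h1, nodes_netOf, getD_tab_fin]
    simp only [Bool.or_eq_true, any_iff, Bool.and_eq_true, ih, adj_netOf]
    constructor
    · rintro (h | ⟨j, hj, hadj⟩)
      · omega
      · have := hadj.diff_dist_adj (u := s)
        omega
    · intro h
      by_cases h2 : G.dist s i ≤ k
      · exact .inl h2
      · right
        obtain ⟨w, hw, hd⟩ := hG.exists_adj_dist (s := s) (v := i) (by rintro rfl; simp at h2)
        exact ⟨w, by omega, hw⟩

theorem lev_netOf (hG : G.Connected) (i : Fin n) : (netOf G s).lev i = G.dist s i := by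
  rw [Net.lev, nodes_netOf, count_eq (P := fun k : Fin n => k < (⟨G.dist s i, dist_lt_card hG i⟩ : Fin n))]
  · have : (Finset.univ.filter fun k : Fin n => k < ⟨G.dist s i, dist_lt_card hG i⟩) =
        Finset.Iio ⟨G.dist s i, dist_lt_card hG i⟩ := by
      ext; simp
    rw [this, Fin.card_Iio]
  · intro k
    rw [Bool.not_eq_true', ← Bool.not_eq_true, ball_netOf hG, Fin.lt_def, not_le]

/-- The parent of a node in a state of the tree construction. -/
def parOf (T : TreeState) (u : Fin n) : ℕ := T.1.getD u 0

/-- The height of a node in a state of the tree construction. -/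
def heightOf (T : TreeState) (u : Fin n) : ℕ := T.2.getD u 0

theorem freeChild_netOf (hG : G.Connected) {T : TreeState} (hT : ∀ u : Fin n, parOf T u ≤ n)
    {w u : Fin n} : (netOf G s).freeChild T w u = true ↔ FreeChild G s (parOf T) w u := by
  have := hT u
  simp only [Net.freeChild, nodes_netOf, Bool.and_eq_true, decide_eq_true_eq, adj_netOf,
    lev_netOf hG, FreeChild, parOf, and_assoc] at this ⊢
  exact and_congr_left fun _ => ⟨fun h => by omega, fun h => by omega⟩

theorem count_eq_of_downward {n m : ℕ} {p : ℕ → Bool} (hm : m ≤ n)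
    (h : ∀ i : Fin n, p i = true ↔ (i : ℕ) < m) : count n p = m := by
  rw [count_eq h, Fin.card_filter_val_lt, min_eq_right hm]

theorem exists_nat_of_downward {P : ℕ → Prop} {n : ℕ} (hn : ¬ P n)
    (hd : ∀ j k, j ≤ k → P k → P j) : ∃ m ≤ n, ∀ k, P k ↔ k < m := by
  classical
  have hex : ∃ m, ¬ P m := ⟨n, hn⟩
  refine ⟨Nat.find hex, Nat.find_min' hex hn, fun k => ⟨fun hk => ?_, fun hk => ?_⟩⟩
  · by_contra hlt
    exact Nat.find_spec hex (hd _ _ (by omega) hk)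
  · exact not_not.1 (Nat.find_min hex hk)

theorem HeightAbove.mono {V : Type} {C : V → Prop} {h : V → ℕ} {j k : ℕ} (hjk : j ≤ k)
    (hk : HeightAbove C h k) : HeightAbove C h j := by
  obtain ⟨u, hu, h1⟩ := hk
  rcases Nat.eq_or_lt_of_le hjk with rfl | hlt
  · exact ⟨u, hu, h1⟩
  · exact ⟨u, hu, .inl (by omega)⟩

/-- The program counts the `k < n` with `HeightAbove`. This property is inherited by smaller `k` and
fails at `n`, so the count is the 2-height. -/
theorem newHeight_netOf (hG : G.Connected) {T : TreeState}
    (hT : TreeInv G s (parOf T) (heightOf T)) (w : Fin n) (k : ℕ) :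
    k < (netOf G s).newHeight T w ↔ HeightAbove (FreeChild G s (parOf T) w) (heightOf T) k := by
  obtain ⟨m, hm, h⟩ := exists_nat_of_downward (n := n)
    (P := HeightAbove (FreeChild G s (parOf T) w) (heightOf T)) (by
      rintro ⟨u, hu, h1⟩
      have := hT.height_lt u
      omega) fun j k hjk => HeightAbove.mono hjk
  rw [h, Net.newHeight, nodes_netOf, count_eq_of_downward hm]
  intro i
  rw [← h]
  simp only [any_iff, Bool.and_eq_true, freeChild_netOf hG hT.par_le, Bool.or_eq_true,
    decide_eq_true_eq, Bool.not_eq_true', decide_eq_false_iff_not, HeightAbove, heightOf,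
    Fin.val_inj, and_assoc, ne_eq]

/-- Any parentless node has a neighbour on the preceding level, so candidates exist; the best one is
a lexicographic maximum of level and prospective height. -/
theorem exists_pick (hG : G.Connected) {T : TreeState}
    (hT : TreeInv G s (parOf T) (heightOf T)) (hex : ∃ u : Fin n, parOf T u = n) :
    ∃ w x : Fin n, (netOf G s).pick T = w ∧ FreeChild G s (parOf T) w x ∧
      ∀ v x, FreeChild G s (parOf T) v x → G.dist s v < G.dist s w ∨
        G.dist s v = G.dist s w ∧ (netOf G s).newHeight T v ≤ (netOf G s).newHeight T w := by
  classical
  have key : ∀ w : Fin n, (any (netOf G s).nodes (fun u => (netOf G s).freeChild T w u) &&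
    all (netOf G s).nodes fun w' => !(any (netOf G s).nodes fun u => (netOf G s).freeChild T w' u) ||
      (decide ((netOf G s).lev w' < (netOf G s).lev w) ||
      (decide ((netOf G s).lev w' = (netOf G s).lev w) &&
        decide ((netOf G s).newHeight T w' ≤ (netOf G s).newHeight T w)))) = true ↔
      (∃ x, FreeChild G s (parOf T) w x) ∧
      ∀ v x, FreeChild G s (parOf T) v x → G.dist s v < G.dist s w ∨
        G.dist s v = G.dist s w ∧ (netOf G s).newHeight T v ≤ (netOf G s).newHeight T w := by
    intro w
    rw [nodes_netOf, Bool.and_eq_true, any_iff, all_iff]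
    simp only [freeChild_netOf hG hT.par_le, Bool.or_eq_true, Bool.not_eq_true',
      ← Bool.not_eq_true, any_iff, decide_eq_true_eq, Bool.and_eq_true, lev_netOf hG]
    refine and_congr_right fun _ => forall_congr' fun v => ?_
    rw [← imp_iff_not_or, exists_imp]
  have hspec : ∃ w : Fin n, (∃ x, FreeChild G s (parOf T) w x) ∧
      ∀ v x, FreeChild G s (parOf T) v x → G.dist s v < G.dist s w ∨
        G.dist s v = G.dist s w ∧ (netOf G s).newHeight T v ≤ (netOf G s).newHeight T w := by
    obtain ⟨u, hu⟩ := hex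
    have hus : u ≠ s := by
      rintro rfl
      rw [hT.root] at hu
      exact absurd u.2 (by omega)
    obtain ⟨w, hw, hd⟩ := hG.exists_adj_dist hus
    obtain ⟨w, hw, hmax⟩ := Finset.exists_max_image
      (Finset.univ.filter fun w => ∃ x, FreeChild G s (parOf T) w x)
      (fun w => toLex (G.dist s w, (netOf G s).newHeight T w))
      ⟨w, by simpa using ⟨u, hu, hw, hd⟩⟩
    refine ⟨w, by simpa using hw, fun v x hx => ?_⟩
    have := hmax v (by simpa using ⟨x, hx⟩)
    rwa [Prod.Lex.toLex_le_toLex] at this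
  obtain ⟨w, hw, hp⟩ := find_spec (n := n)
    (p := fun w => any (netOf G s).nodes (fun u => (netOf G s).freeChild T w u) &&
    all (netOf G s).nodes fun w' => !(any (netOf G s).nodes fun u => (netOf G s).freeChild T w' u) ||
      (decide ((netOf G s).lev w' < (netOf G s).lev w) ||
      (decide ((netOf G s).lev w' = (netOf G s).lev w) &&
        decide ((netOf G s).newHeight T w' ≤ (netOf G s).newHeight T w))))
    (hspec.imp fun w hw => (key w).2 hw)
  obtain ⟨⟨x, hx⟩, hmax⟩ := (key w).1 hp
  refine ⟨w, x, ?_, hx, hmax⟩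
  rw [Net.pick, nodes_netOf] at *
  exact hw

theorem treeStep_spec (hG : G.Connected) {T : TreeState}
    (hT : TreeInv G s (parOf T) (heightOf T)) (hex : ∃ u : Fin n, parOf T u = n) :
    TreeInv G s (parOf ((netOf G s).treeStep T)) (heightOf ((netOf G s).treeStep T)) ∧
    ∃ x : Fin n, parOf T x = n ∧ ∀ u : Fin n, parOf ((netOf G s).treeStep T) u = n →
      parOf T u = n ∧ u ≠ x := by
  obtain ⟨w, x, hw, hx, hmax⟩ := exists_pick hG hT hex
  have hpar : ∀ u : Fin n, parOf ((netOf G s).treeStep T) u =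
      min n (if (netOf G s).freeChild T w u = true then (w : ℕ) else parOf T u) := by
    intro u
    rw [parOf, Net.treeStep, hw]
    simp only [nodes_netOf, getD_tab_fin]
    rfl
  have hp1 : ∀ u : Fin n, FreeChild G s (parOf T) w u → parOf ((netOf G s).treeStep T) u = w := by
    intro u hu
    rw [hpar, if_pos ((freeChild_netOf hG hT.par_le).2 hu), min_eq_right w.2.le]
  have hp2 : ∀ u : Fin n, ¬ FreeChild G s (parOf T) w u →
      parOf ((netOf G s).treeStep T) u = parOf T u := by
    intro u hu
    rw [hpar, if_neg fun h => hu ((freeChild_netOf hG hT.par_le).1 h),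
      min_eq_right (hT.par_le u)]
  have hh : ∀ v : Fin n, heightOf ((netOf G s).treeStep T) v =
      min n (if v = w then (netOf G s).newHeight T w else heightOf T v) := by
    intro v
    rw [heightOf, Net.treeStep, hw]
    simp only [nodes_netOf, getD_tab_fin, decide_eq_true_eq, Fin.val_inj]
    rfl
  refine ⟨hT.step (H := fun v => (netOf G s).newHeight T v) (newHeight_netOf hG hT) hx hmax
    (dist_lt_card hG w) hp1 hp2 ?_ ?_, x, hx.1, fun u hu => ?_⟩
  · rw [hh, if_pos rfl, min_eq_right]
    have := count_le n fun k => any (netOf G s).nodes fun u => (netOf G s).freeChild T w u &&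
      (decide (k < T.2.getD u 0) || (decide (T.2.getD u 0 = k) &&
        any (netOf G s).nodes fun u' => (netOf G s).freeChild T w u' && !decide (u = u') &&
          decide (T.2.getD u' 0 = k)))
    rw [Net.newHeight]
    simpa only [nodes_netOf] using this
  · intro v hv
    rw [hh, if_neg hv, min_eq_right]
    have := hT.height_lt v
    omega
  · by_cases h1 : FreeChild G s (parOf T) w u
    · rw [hp1 u h1] at hu
      exact absurd w.2 (by omega)
    · rw [hp2 u h1] at hu
      exact ⟨hu, by rintro rfl; exact h1 hx⟩

theorem treeInit_spec (hG : G.Connected) :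
    TreeInv G s (parOf (netOf G s).treeInit) (heightOf (netOf G s).treeInit) := by
  have hp : ∀ u : Fin n, parOf (netOf G s).treeInit u = if u = s then (u : ℕ) else n := by
    intro u
    simp only [parOf, Net.treeInit, nodes_netOf, getD_tab_fin, isSource_netOf]
  have hh : ∀ u : Fin n, heightOf (netOf G s).treeInit u = 0 := by
    intro u
    simp only [heightOf, Net.treeInit, nodes_netOf, getD_tab_fin]
  have hno : ∀ u w : Fin n, u ≠ s → parOf (netOf G s).treeInit u ≠ w := by
    intro u w hu h
    rw [hp, if_neg hu] at h
    exact absurd w.2 (by omega)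
  refine ⟨by simp [hp], fun u => ?_, fun v => ?_, fun u w hu h => absurd h (hno u w hu),
    fun u w hu h => absurd h (hno u w hu), fun u w hu h => absurd h (hno u w hu), fun v k => ?_,
    fun u w v x hu h => absurd h (hno u w hu), fun u u' w w' v _ hu _ h => absurd h (hno u w hu)⟩
  · rw [hp]
    split_ifs
    · exact u.2.le
    · rfl
  · rw [hh, zero_add]
    exact dist_lt_card hG v
  · rw [hh]
    refine ⟨fun h => by omega, ?_⟩
    rintro ⟨u, ⟨h1, h2⟩, -⟩
    exact absurd h2 (hno u v h1)

/-- Without free nodes the search returns its default `n`, which is no node. A finished tree is thus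
stationary, and the program may always run for `n` rounds. -/
theorem treeStep_of_complete {T : TreeState}
    (hT : TreeInv G s (parOf T) (heightOf T)) (hex : ∀ u : Fin n, parOf T u ≠ n) :
    (parOf ((netOf G s).treeStep T) : Fin n → ℕ) = parOf T ∧
      (heightOf ((netOf G s).treeStep T) : Fin n → ℕ) = heightOf T := by
  have hfree : ∀ (w : ℕ) (u : Fin n), ¬ (netOf G s).freeChild T w u = true := by
    intro w u h
    simp only [Net.freeChild, Bool.and_eq_true, decide_eq_true_eq, nodes_netOf] at h
    exact hex u (le_antisymm (hT.par_le u) h.1.1)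
  have hpick : (netOf G s).pick T = n := by
    rw [Net.pick, nodes_netOf]
    refine find_eq_of_forall fun w => ?_
    rw [Bool.and_eq_true, any_iff]
    exact fun h => h.1.elim fun u => hfree _ _
  constructor <;> funext u
  · simp only [parOf, Net.treeStep, nodes_netOf, getD_tab_fin, hfree]
    exact min_eq_right (hT.par_le u)
  · have h1 := hT.height_lt u
    simp only [heightOf] at h1
    simp only [heightOf, Net.treeStep, nodes_netOf, getD_tab_fin, hpick, decide_eq_true_eq,
      u.2.ne, if_false]
    omega

theorem treeAt_spec (hG : G.Connected) (k : ℕ) :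
    TreeInv G s (parOf ((netOf G s).treeAt k)) (heightOf ((netOf G s).treeAt k)) ∧
      (Finset.univ.filter fun u : Fin n => parOf ((netOf G s).treeAt k) u = n).card ≤ n - k := by
  induction k with
  | zero => exact ⟨treeInit_spec hG, (Finset.card_le_univ _).trans (by simp)⟩
  | succ k ih =>
    have hs : (netOf G s).treeAt (k + 1) = (netOf G s).treeStep ((netOf G s).treeAt k) := rfl
    obtain ⟨hT, hc⟩ := ih
    rw [hs]
    by_cases hex : ∃ u : Fin n, parOf ((netOf G s).treeAt k) u = n
    · obtain ⟨h1, x, hx, h2⟩ := treeStep_spec hG hT hex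
      refine ⟨h1, ?_⟩
      have hlt : (Finset.univ.filter fun u : Fin n =>
          parOf ((netOf G s).treeStep ((netOf G s).treeAt k)) u = n).card <
          (Finset.univ.filter fun u : Fin n => parOf ((netOf G s).treeAt k) u = n).card := by
        refine Finset.card_lt_card ⟨fun u hu => ?_, fun hsub => ?_⟩
        · simp only [Finset.mem_filter, Finset.mem_univ, true_and] at hu ⊢
          exact (h2 u hu).1
        · have := @hsub x (by simpa using hx)
          simp only [Finset.mem_filter, Finset.mem_univ, true_and] at this
          exact (h2 x this).2 rfl
      omega
    · push Not at hex
      obtain ⟨h1, h2⟩ := treeStep_of_complete hT hex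
      rw [h1, h2]
      exact ⟨hT, by simp [hex]⟩

/-- The program finds a 2-height respecting tree. -/
theorem exists_tree (hG : G.Connected) : ∃ P : Fin n → Fin n,
    (∀ u : Fin n, (netOf G s).parent u = P u) ∧
    IsTwoHRT G s P (fun v => (netOf G s).height v) ∧
    HeightSpec s P (fun v : Fin n => (netOf G s).height v) := by
  obtain ⟨hT, hc⟩ := treeAt_spec (s := s) hG n
  have hlt : ∀ u : Fin n, parOf ((netOf G s).treeAt n) u < n := by
    intro u
    refine lt_of_le_of_ne (hT.par_le u) fun h => ?_
    rw [Nat.sub_self, Nat.le_zero, Finset.card_eq_zero] at hc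
    have : u ∈ (Finset.univ.filter fun u : Fin n => parOf ((netOf G s).treeAt n) u = n) := by
      simpa using h
    rw [hc] at this
    exact absurd this (Finset.notMem_empty u)
  have hP : ∀ u : Fin n, (netOf G s).parent u = parOf ((netOf G s).treeAt n) u := by
    intro u
    rw [Net.parent, nodes_netOf]
    rfl
  have hH : (fun v : Fin n => (netOf G s).height v) = heightOf ((netOf G s).treeAt n) := by
    funext v
    rw [Net.height, nodes_netOf]
    rfl
  rw [hH]
  refine ⟨fun u => ⟨parOf ((netOf G s).treeAt n) u, hlt u⟩, hP, ?_⟩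
  have hspec : HeightSpec s (fun u => ⟨parOf ((netOf G s).treeAt n) u, hlt u⟩)
      (heightOf ((netOf G s).treeAt n)) := by
    intro v k
    rw [hT.height]
    exact HeightAbove.congr (fun u => and_congr_right fun _ => by rw [Fin.ext_iff]) fun _ _ => rfl
  refine ⟨⟨⟨Fin.ext hT.root, fun v hv => (hT.adj v _ hv rfl).1, fun v hv => (hT.adj v _ hv rfl).2⟩,
    hspec.isTwoHeight, ?_⟩, hspec⟩
  rintro u u' hne ⟨hu, hf⟩ ⟨hu', hf'⟩ hd heq ⟨v, h1, h2, h3⟩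
  exact hT.respect u u' _ _ v hne hu hu' rfl rfl hf hf' hd heq h1 h2 h3

end

/-! ### The sets chosen in a block -/

/-! ### Sets of transmitters informing a logarithmic fraction of the targets -/

section spokesmen

/-- Between `k / 2` and `k` there are at most `k / 2 + 1` terms, none larger than `1 / (k / 2 + 1)`,
so doubling `k` adds at most 1. -/
theorem harmonic_le_log (k : ℕ) : harmonic k ≤ Nat.log 2 k + 1 := by
  induction k using Nat.strong_induction_on with
  | _ k ih =>
    rcases Nat.lt_or_ge k 2 with hk | hk
    · interval_cases k <;> simp [harmonic]
    · have h1 := ih (k / 2) (by omega)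
      have h2 : Nat.log 2 k = Nat.log 2 (k / 2) + 1 := Nat.log_of_one_lt_of_le (by norm_num) hk
      have h3 : harmonic k ≤ harmonic (k / 2) + 1 := by
        unfold harmonic
        rw [← Finset.sum_range_add_sum_Ico _ (Nat.div_le_self k 2)]
        gcongr
        have hb : ∀ i ∈ Finset.Ico (k / 2) k, ((↑(i + 1) : ℚ))⁻¹ ≤ ((k / 2 : ℕ) + 1 : ℚ)⁻¹ := by
          intro i hi
          rw [Finset.mem_Ico] at hi
          gcongr
          push_cast
          have : ((k / 2 : ℕ) : ℚ) ≤ i := by exact_mod_cast hi.1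
          linarith
        refine (Finset.sum_le_card_nsmul _ _ _ hb).trans ?_
        rw [Nat.card_Ico, nsmul_eq_mul, ← div_eq_mul_inv, div_le_one (by positivity)]
        have : k - k / 2 ≤ k / 2 + 1 := by omega
        exact_mod_cast this
      rw [h2]
      push_cast
      linarith

variable {V : Type} [DecidableEq V]

open Classical in
/-- The targets hearing exactly one transmitter of `D`. -/
noncomputable def uniq (G : SimpleGraph V) (T D : Finset V) : Finset V :=
  T.filter fun u => ∃! w, G.Adj u w ∧ w ∈ D

open Classical in
/-- The targets with a neighbour in `D`. -/
noncomputable def covered (G : SimpleGraph V) (T D : Finset V) : Finset V :=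
  T.filter fun u => ∃ w, G.Adj u w ∧ w ∈ D

open Classical in
/-- The targets hearing `a` if `D` transmits. -/
noncomputable def privateOf (G : SimpleGraph V) (T D : Finset V) (a : V) : Finset V :=
  (uniq G T D).filter fun u => G.Adj a u

variable {G : SimpleGraph V} {T D : Finset V}

/-- A target that hears exactly one transmitter is private to that transmitter alone, so the private
sets are disjoint. -/
theorem sum_privateOf_le : ∑ a ∈ D, (privateOf G T D a).card ≤ (uniq G T D).card := by
  classical
  rw [← Finset.card_biUnion]
  · exact Finset.card_le_card (Finset.biUnion_subset.2 fun a _ => Finset.filter_subset _ _)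
  · intro a ha b hb hab
    refine Finset.disjoint_left.2 fun u hu hu' => hab ?_
    simp only [privateOf, uniq, Finset.mem_filter] at hu hu'
    exact hu.1.2.unique ⟨hu.2.symm, ha⟩ ⟨hu'.2.symm, hb⟩

/-- A target that is no longer covered after the removal of `a` had `a` as its only neighbour in
`D`. -/
theorem covered_le (a : V) : (covered G T D).card ≤
    (covered G T (D.erase a)).card + (privateOf G T D a).card := by
  classical
  refine (Finset.card_le_card fun u hu => ?_).trans (Finset.card_union_le _ _)
  simp only [covered, privateOf, uniq, Finset.mem_filter, Finset.mem_union, Finset.mem_erase] at hu ⊢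
  by_cases h : ∃ w, G.Adj u w ∧ w ≠ a ∧ w ∈ D
  · exact .inl ⟨hu.1, h⟩
  · right
    push Not at h
    obtain ⟨hT, w, hw, hwD⟩ := hu
    have key : ∀ x, G.Adj u x → x ∈ D → x = a := fun x hx hxD => by
      by_contra hne
      exact h x hx hne hxD
    obtain rfl := key w hw hwD
    exact ⟨⟨hT, w, ⟨hw, hwD⟩, fun x hx => key x hx.1 hx.2⟩, hw.symm⟩

/-- Among the sets obtained from a dominating set by removing repeatedly a node with the fewest
private targets, one informs at least the fraction `1 / m` of the targets, where `m` exceeds the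
binary logarithm of the size of the dominating set. -/
theorem exists_spokesmen {D : ℕ → Finset V} {a : ℕ → V} {m : ℕ}
    (hm : Nat.log 2 (D 0).card + 1 ≤ m) (hT : T.Nonempty)
    (hdom : ∀ u ∈ T, ∃ w, G.Adj u w ∧ w ∈ D 0)
    (ha : ∀ k, (D k).Nonempty → a k ∈ D k ∧
      ∀ b ∈ D k, (privateOf G T (D k) (a k)).card ≤ (privateOf G T (D k) b).card)
    (hD : ∀ k, (D k).Nonempty → D (k + 1) = (D k).erase (a k)) :
    ∃ k < (D 0).card, T.card ≤ (uniq G T (D k)).card * m := by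
  classical
  by_contra hno
  push Not at hno
  set K := (D 0).card with hK
  have hcard : ∀ k ≤ K, (D k).card = K - k := by
    intro k
    induction k with
    | zero => simp [hK]
    | succ k ih =>
      intro hk
      have h1 := ih (by omega)
      have hne : (D k).Nonempty := Finset.card_pos.1 (by omega)
      rw [hD k hne, Finset.card_erase_of_mem (ha k hne).1, h1]
      omega
  have hm0 : (0 : ℚ) < m := by
    have : 0 < m := by omega
    exact_mod_cast this
  have ht : (1 : ℚ) ≤ T.card := by exact_mod_cast hT.card_pos
  -- By the negated claim, `c` bounds the number of targets hearing exactly one transmitter of any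
  -- `D k`; the 1 subtracted comes from strictness.
  set c : ℚ := (T.card - 1) / m with hc
  have hc0 : 0 ≤ c := div_nonneg (by linarith) hm0.le
  -- The node removed from a set of `K - k` nodes has at most the average number of private targets,
  -- so at most `c / (K - k)` targets lose coverage. The losses add up to a difference of harmonic
  -- numbers.
  have key : ∀ k ≤ K, (T.card : ℚ) ≤
      (covered G T (D k)).card + c * (harmonic K - harmonic (K - k)) := by
    intro k
    induction k with
    | zero =>
      intro _
      have : covered G T (D 0) = T := Finset.filter_true_of_mem hdom
      simp [this]
    | succ k ih =>
      intro hk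
      have h1 := ih (by omega)
      have h2 := hcard k (by omega)
      have hne : (D k).Nonempty := Finset.card_pos.1 (by omega)
      obtain ⟨ha1, ha2⟩ := ha k hne
      have h3 := covered_le (G := G) (T := T) (D := D k) (a k)
      rw [← hD k hne] at h3
      have h4 : (D k).card * (privateOf G T (D k) (a k)).card ≤ (uniq G T (D k)).card := by
        refine le_trans ?_ sum_privateOf_le
        rw [← smul_eq_mul]
        exact Finset.card_nsmul_le_sum _ _ _ ha2
      have h5 := hno k (by omega)
      obtain ⟨j, hj⟩ : ∃ j, K - k = j + 1 := ⟨K - k - 1, by omega⟩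
      rw [show K - (k + 1) = j by omega]
      rw [hj, harmonic_succ] at h1
      rw [h2, hj] at h4
      have h6 : ((privateOf G T (D k) (a k)).card : ℚ) ≤ c * ((j + 1 : ℕ) : ℚ)⁻¹ := by
        rw [← div_eq_mul_inv, le_div_iff₀ (by positivity), hc, le_div_iff₀ hm0]
        have h7 : (privateOf G T (D k) (a k)).card * (j + 1) * m + 1 ≤ T.card := by
          nlinarith [Nat.mul_le_mul_right m h4]
        have h8 : (((privateOf G T (D k) (a k)).card * (j + 1) * m + 1 : ℕ) : ℚ) ≤ T.card := by
          exact_mod_cast h7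
        push_cast at h8 ⊢
        linarith
      have h9 : ((covered G T (D k)).card : ℚ) ≤ (covered G T (D (k + 1))).card +
          (privateOf G T (D k) (a k)).card := by exact_mod_cast h3
      linarith
  -- At the end nothing is covered, so all targets were lost; but the losses are at most `c * m =
  -- T.card - 1`.
  have h1 := key K le_rfl
  have h2 : covered G T (D K) = ∅ := by
    have : D K = ∅ := Finset.card_eq_zero.1 (by rw [hcard K le_rfl, Nat.sub_self])
    simp [covered, this]
  rw [h2, Nat.sub_self, harmonic_zero, Finset.card_empty, Nat.cast_zero, zero_add, sub_zero] at h1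
  have h3 : harmonic K ≤ m := (harmonic_le_log K).trans (by exact_mod_cast hm)
  have h4 : c * harmonic K ≤ c * m := mul_le_mul_of_nonneg_left h3 hc0
  rw [hc, div_mul_cancel₀ _ hm0.ne'] at h4
  linarith

/-- A quantity below `2 ^ m` which drops by the factor `1 - 1 / m` vanishes after `m ^ 2` steps. -/
theorem eq_zero_of_decay {m : ℕ} (hm : 0 < m) {q : ℕ → ℕ} (h0 : q 0 < 2 ^ m)
    (hq : ∀ j < m * m, q (j + 1) * m ≤ q j * (m - 1)) : q (m * m) = 0 := by
  have h1 : ∀ j ≤ m * m, q j * m ^ j ≤ q 0 * (m - 1) ^ j := by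
    intro j
    induction j with
    | zero => simp
    | succ j ih =>
      intro hj
      have h2 := ih (by omega)
      have h3 := hq j (by omega)
      calc q (j + 1) * m ^ (j + 1) = (q (j + 1) * m) * m ^ j := by ring
        _ ≤ (q j * (m - 1)) * m ^ j := Nat.mul_le_mul_right _ h3
        _ = (q j * m ^ j) * (m - 1) := by ring
        _ ≤ (q 0 * (m - 1) ^ j) * (m - 1) := Nat.mul_le_mul_right _ h2
        _ = q 0 * (m - 1) ^ (j + 1) := by ring
  -- Bernoulli's inequality: `m` steps of the decay halve the quantity, so `m * m` steps divide it
  -- by `2 ^ m`.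
  have h2 : 2 * (m - 1) ^ m ≤ m ^ m := by
    obtain ⟨k, rfl⟩ := Nat.exists_eq_succ_of_ne_zero hm.ne'
    rw [Nat.succ_sub_one, Nat.succ_eq_add_one]
    have h4 : ∀ j, k ^ (j + 1) + (j + 1) * k ^ j ≤ (k + 1) ^ (j + 1) := by
      intro j
      induction j with
      | zero => simp
      | succ j ih =>
        calc k ^ (j + 2) + (j + 2) * k ^ (j + 1)
            ≤ k ^ (j + 2) + (j + 2) * k ^ (j + 1) + (j + 1) * k ^ j := Nat.le_add_right _ _
          _ = (k ^ (j + 1) + (j + 1) * k ^ j) * (k + 1) := by ring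
          _ ≤ (k + 1) ^ (j + 1) * (k + 1) := Nat.mul_le_mul_right _ ih
    calc 2 * k ^ (k + 1) = k ^ (k + 1) + k * k ^ k := by ring
      _ ≤ k ^ (k + 1) + (k + 1) * k ^ k := by gcongr; omega
      _ ≤ (k + 1) ^ (k + 1) := h4 k
  have h3 : 2 ^ m * (m - 1) ^ (m * m) ≤ m ^ (m * m) := by
    have := Nat.pow_le_pow_left h2 m
    rwa [mul_pow, ← pow_mul, ← pow_mul] at this
  have h4 := h1 (m * m) le_rfl
  by_contra hne
  have h5 : 0 < m ^ (m * m) := by positivity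
  have h6 : m ^ (m * m) ≤ q (m * m) * m ^ (m * m) := Nat.le_mul_of_pos_left _ (by omega)
  have h7 : 0 < (m - 1) ^ (m * m) := by
    by_contra h
    have : (m - 1) ^ (m * m) = 0 := by omega
    rw [this] at h4
    omega
  have h8 := Nat.mul_lt_mul_of_pos_right h0 h7
  omega

end spokesmen

/-! ### Minimal dominating sets and slow transmitters as computed by the program -/

section block
variable {n : ℕ} {G : SimpleGraph (Fin n)} {s : Fin n}

/-- The informed nodes. -/
def BlockState.Inf (S : BlockState) (v : Fin n) : Prop := S.1.getD v false = true

/-- The nodes with their dominating flag set. -/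
def BlockState.Flag (S : BlockState) (v : Fin n) : Prop := S.2.1.getD v false = true

/-- The nodes that have been targets. -/
def BlockState.Mark (S : BlockState) (v : Fin n) : Prop := S.2.2.getD v false = true

/-- The uninformed nodes with an informed neighbour on the preceding level, the level active in
block `r`. -/
def Frontier (G : SimpleGraph (Fin n)) (s : Fin n) (S : BlockState) (r : ℕ) (u : Fin n) : Prop :=
  ¬ S.Inf u ∧ G.dist s u % 3 = (r + 1) % 3 ∧ ∃ w, S.Inf w ∧ G.Adj w u ∧ G.dist s u = G.dist s w + 1

theorem receiver_netOf (hG : G.Connected) {r : ℕ} {u : Fin n} :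
    (netOf G s).receiver r u = true ↔ G.dist s u % 3 = (r + 1) % 3 := by
  simp only [Net.receiver, lev_netOf hG, decide_eq_true_eq]

theorem frontier_netOf (hG : G.Connected) {S : BlockState} {r : ℕ} {u : Fin n} :
    (netOf G s).frontier S r u = true ↔ Frontier G s S r u := by
  simp only [Net.frontier, Bool.and_eq_true, Bool.not_eq_true', ← Bool.not_eq_true,
    receiver_netOf hG, nodes_netOf, any_iff, lev_netOf hG, decide_eq_true_eq, adj_netOf, Frontier,
    BlockState.Inf, and_assoc]

theorem hearsOne_netOf {D : List Bool} {u : Fin n} : (netOf G s).hearsOne D u = true ↔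
    ∃! w : Fin n, G.Adj u w ∧ D.getD w false = true := by
  classical
  rw [Net.hearsOne, nodes_netOf, decide_eq_true_eq,
    count_eq (P := fun w : Fin n => G.Adj u w ∧ D.getD w false = true),
    ← Fintype.existsUnique_iff_card_one]
  intro w
  rw [Bool.and_eq_true, adj_netOf, G.adj_comm, and_comm]

/-- One pass of deletions suffices for minimality: a node is kept because some frontier node has no
other neighbour in the current set, and this remains true when the set shrinks. That frontier node
is the future feedback node. -/
theorem domTable_spec (hG : G.Connected) {S : BlockState} {r : ℕ}
    (hS : ∀ u, Frontier G s S r u → ∃ w, S.Flag w ∧ G.dist s w % 3 = r % 3 ∧ G.Adj w u) :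
    (∀ v : Fin n, ((netOf G s).domTable S r).getD v false = true →
      S.Flag v ∧ G.dist s v % 3 = r % 3) ∧
    (∀ u, Frontier G s S r u →
      ∃ w : Fin n, ((netOf G s).domTable S r).getD w false = true ∧ G.Adj w u) ∧
    ∀ v : Fin n, ((netOf G s).domTable S r).getD v false = true →
      ∃ u, Frontier G s S r u ∧ ∀ w : Fin n,
        ((netOf G s).domTable S r).getD w false = true → (G.Adj w u ↔ w = v) := by
  set f : ℕ → List Bool → List Bool := fun v D => tab (netOf G s).nodes fun w =>
    D.getD w false && !(decide (w = v) && all (netOf G s).nodes fun u =>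
      !(netOf G s).frontier S r u || (netOf G s).dominated ((netOf G s).without D v) u) with hf
  set D₀ : List Bool := tab (netOf G s).nodes fun v =>
    S.2.1.getD v false && decide ((netOf G s).lev v % 3 = r % 3) with hD₀
  have hstep : ∀ (k w : Fin n) D, (f k D).getD w false = true ↔ D.getD w false = true ∧
      ¬ (w = k ∧ ∀ u, Frontier G s S r u → ∃ x : Fin n, D.getD x false = true ∧ x ≠ k ∧ G.Adj x u) := by
    intro k w D
    simp only [hf, nodes_netOf, getD_tab_fin, Bool.and_eq_true, Bool.not_eq_true',
      ← Bool.not_eq_true, decide_eq_true_eq, all_iff, Bool.or_eq_true, frontier_netOf hG,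
      Net.dominated, Net.without, any_iff, adj_netOf, Fin.val_inj, and_assoc, ne_eq,
      ← imp_iff_not_or]
  have main : ∀ k ≤ n,
      (∀ v : Fin n, (loopN f D₀ k).getD v false = true → S.Flag v ∧ G.dist s v % 3 = r % 3) ∧
      (∀ u, Frontier G s S r u → ∃ w : Fin n, (loopN f D₀ k).getD w false = true ∧ G.Adj w u) ∧
      ∀ v : Fin n, v < k → (loopN f D₀ k).getD v false = true →
        ∃ u, Frontier G s S r u ∧ ∀ w : Fin n,
          (loopN f D₀ k).getD w false = true → G.Adj w u → w = v := by
    intro k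
    induction k with
    | zero =>
      intro _
      have h0 : ∀ v : Fin n, D₀.getD v false = true ↔ S.Flag v ∧ G.dist s v % 3 = r % 3 := by
        intro v
        simp only [hD₀, nodes_netOf, getD_tab_fin, Bool.and_eq_true, decide_eq_true_eq,
          lev_netOf hG, BlockState.Flag]
      refine ⟨fun v hv => (h0 v).1 hv, fun u hu => ?_, fun v hv => absurd hv (by omega)⟩
      obtain ⟨w, h1, h2, h3⟩ := hS u hu
      exact ⟨w, (h0 w).2 ⟨h1, h2⟩, h3⟩
    | succ k ih =>
      intro hk
      obtain ⟨h1, h2, h3⟩ := ih (by omega)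
      have hstep' := fun w => hstep ⟨k, hk⟩ w (loopN f D₀ k)
      simp only [loopN]
      refine ⟨fun v hv => h1 v ((hstep' v).1 hv).1, fun u hu => ?_, fun v hv hvD => ?_⟩
      · by_cases hall : ∀ u, Frontier G s S r u →
          ∃ x : Fin n, (loopN f D₀ k).getD x false = true ∧ x ≠ ⟨k, hk⟩ ∧ G.Adj x u
        · obtain ⟨x, hx1, hx2, hx3⟩ := hall u hu
          exact ⟨x, (hstep' x).2 ⟨hx1, fun h => hx2 h.1⟩, hx3⟩
        · obtain ⟨x, hx1, hx2⟩ := h2 u hu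
          exact ⟨x, (hstep' x).2 ⟨hx1, fun h => hall h.2⟩, hx2⟩
      · obtain ⟨hvD1, hvD2⟩ := (hstep' v).1 hvD
        by_cases hvk : v = ⟨k, hk⟩
        · rw [not_and] at hvD2
          have h4 := hvD2 hvk
          push Not at h4
          obtain ⟨u, hu, h5⟩ := h4
          refine ⟨u, hu, fun w hw hadj => ?_⟩
          by_contra hne
          exact h5 w ((hstep' w).1 hw).1 (hvk ▸ hne) hadj
        · have hlt : (v : ℕ) < k := by
            have : (v : ℕ) ≠ k := fun h => hvk (Fin.ext h)
            omega
          obtain ⟨u, hu, h5⟩ := h3 v hlt hvD1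
          exact ⟨u, hu, fun w hw => h5 w ((hstep' w).1 hw).1⟩
  have hdom : (netOf G s).domTable S r = loopN f D₀ n := by
    rw [Net.domTable, nodes_netOf, hf, hD₀, nodes_netOf]
  rw [hdom]
  obtain ⟨h1, h2, h3⟩ := main n le_rfl
  refine ⟨h1, h2, fun v hv => ?_⟩
  obtain ⟨u, hu, h4⟩ := h3 v v.2 hv
  refine ⟨u, hu, fun w hw => ⟨h4 w hw, ?_⟩⟩
  rintro rfl
  obtain ⟨x, hx, hadj⟩ := h2 u hu
  rwa [h4 x hx hadj] at hadj

/-- The set given by a table. -/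
def tableSet (D : List Bool) : Finset (Fin n) := Finset.univ.filter fun w => D.getD w false = true

theorem mem_tableSet {D : List Bool} {w : Fin n} :
    w ∈ (tableSet D : Finset (Fin n)) ↔ D.getD w false = true := by
  simp [tableSet]

open Classical in
/-- The targets of block `r`. -/
noncomputable def targets (G : SimpleGraph (Fin n)) (s : Fin n) (S : BlockState) (r : ℕ) :
    Finset (Fin n) := Finset.univ.filter fun u => (netOf G s).isTarget S r u = true

theorem logSize_netOf : (netOf G s).logSize = Nat.log 2 n + 1 := by
  have hn : n ≠ 0 := by rintro rfl; exact s.elim0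
  have h1 : ∀ k, loopN (fun _ a => min (a + a) (n + 1)) 1 k = min (2 ^ k) (n + 1) := by
    intro k
    induction k with
    | zero => simp [loopN]
    | succ k ih =>
      rw [loopN, ih, pow_succ]
      omega
  rw [Net.logSize, nodes_netOf, count_eq_of_downward]
  · exact Nat.succ_le_succ (Nat.log_le_self 2 n)
  · intro i
    rw [h1, decide_eq_true_eq, Nat.lt_succ_iff, Nat.le_log_iff_pow_le (by norm_num) hn]
    omega

theorem slowTable_subset {S : BlockState} {r : ℕ} {v : Fin n}
    (hv : ((netOf G s).slowTable S r).getD v false = true) :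
    ((netOf G s).domTable S r).getD v false = true := by
  have h1 : ∀ k, ((netOf G s).chain S r k).getD v false = true →
      ((netOf G s).domTable S r).getD v false = true := by
    intro k
    induction k with
    | zero => exact id
    | succ k ih =>
      intro h
      refine ih ?_
      have h2 : (netOf G s).chain S r (k + 1) = (netOf G s).without ((netOf G s).chain S r k)
        ((netOf G s).worst S r ((netOf G s).chain S r k)) := rfl
      rw [h2, Net.without, nodes_netOf, getD_tab_fin, Bool.and_eq_true] at h
      exact h.1
  exact h1 _ hv

open Classical in
theorem slowTable_spec {S : BlockState} {r : ℕ}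
    (hdom : ∀ u ∈ targets G s S r, ∃ w : Fin n,
      ((netOf G s).domTable S r).getD w false = true ∧ G.Adj w u) :
    (targets G s S r).card ≤ (uniq G (targets G s S r)
      (tableSet ((netOf G s).slowTable S r))).card * (Nat.log 2 n + 1) := by
  rcases Finset.eq_empty_or_nonempty (targets G s S r) with hT | hT
  · simp [hT]
  have hpriv : ∀ (D : List Bool) (a : Fin n), (netOf G s).privateTargets S r D a =
      (privateOf G (targets G s S r) (tableSet D) a).card := by
    intro D a
    rw [Net.privateTargets, nodes_netOf, privateOf, uniq, targets, Finset.filter_filter,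
      Finset.filter_filter]
    refine count_eq fun u => ?_
    simp only [Bool.and_eq_true, hearsOne_netOf, adj_netOf, mem_tableSet, and_assoc]
  have hworst : ∀ D : List Bool, (tableSet D : Finset (Fin n)).Nonempty →
      ∃ a : Fin n, (netOf G s).worst S r D = a ∧ a ∈ (tableSet D : Finset (Fin n)) ∧
      ∀ b ∈ (tableSet D : Finset (Fin n)), (privateOf G (targets G s S r) (tableSet D) a).card ≤
        (privateOf G (targets G s S r) (tableSet D) b).card := by
    intro D hD
    obtain ⟨a, ha, hmin⟩ := Finset.exists_min_image _
      (fun a => (privateOf G (targets G s S r) (tableSet D) a).card) hD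
    rw [Net.worst, nodes_netOf]
    refine find_spec_iff (fun a => ?_) ⟨a, ha, hmin⟩
    simp only [Bool.and_eq_true, all_iff, Bool.or_eq_true, Bool.not_eq_true',
      ← Bool.not_eq_true, decide_eq_true_eq, hpriv, mem_tableSet, ← imp_iff_not_or]
  have hne : Nonempty (Fin n) := ⟨s⟩
  choose! a ha1 ha2 using hworst
  obtain ⟨k, hk, hle⟩ := exists_spokesmen (G := G) (T := targets G s S r)
    (D := fun k => tableSet ((netOf G s).chain S r k))
    (a := fun k => a ((netOf G s).chain S r k)) (m := Nat.log 2 n + 1) (by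
      refine Nat.succ_le_succ (Nat.log_mono_right ?_)
      exact (Finset.card_le_univ _).trans (by simp)) hT
    (fun u hu => by
      obtain ⟨w, h1, h2⟩ := hdom u hu
      exact ⟨w, h2.symm, mem_tableSet.2 h1⟩)
    (fun k hk => ha2 _ hk) (fun k hk => by
      have h2 : (netOf G s).chain S r (k + 1) = (netOf G s).without ((netOf G s).chain S r k)
        ((netOf G s).worst S r ((netOf G s).chain S r k)) := rfl
      ext w
      rw [h2, Net.without, mem_tableSet, nodes_netOf, getD_tab_fin, ha1 _ hk, Finset.mem_erase,
        mem_tableSet, Bool.and_eq_true, Bool.not_eq_true', decide_eq_false_iff_not, Fin.val_inj,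
        and_comm])
  have hkn : k < n := hk.trans_le ((Finset.card_le_univ _).trans (by simp))
  obtain ⟨j, hj, hp⟩ : ∃ j : Fin n, find n (fun k =>
      decide (count n (fun u => (netOf G s).isTarget S r u) ≤
        count n (fun u => (netOf G s).isTarget S r u &&
          (netOf G s).hearsOne ((netOf G s).chain S r k) u) * (netOf G s).logSize)) = j ∧
      (targets G s S r).card ≤ (uniq G (targets G s S r)
        (tableSet ((netOf G s).chain S r j))).card * (Nat.log 2 n + 1) := by
    refine find_spec_iff (fun k => ?_) ⟨⟨k, hkn⟩, hle⟩
    rw [decide_eq_true_eq, logSize_netOf,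
      count_eq (P := fun u => (netOf G s).isTarget S r u = true) fun _ => Iff.rfl,
      count_eq (P := fun u => (netOf G s).isTarget S r u = true ∧
        ∃! w : Fin n, G.Adj u w ∧ w ∈ (tableSet ((netOf G s).chain S r k) : Finset (Fin n)))
        fun u => by simp only [Bool.and_eq_true, hearsOne_netOf, mem_tableSet],
      uniq, targets, Finset.filter_filter]
  rw [Net.slowTable, nodes_netOf, hj]
  exact hp

end block

/-! ### The course of the computed execution -/

section trajectory
variable {n : ℕ} {G : SimpleGraph (Fin n)} {s : Fin n}

/-- The computed dominating set of block `r`. -/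
def Dom (G : SimpleGraph (Fin n)) (s : Fin n) (r : ℕ) (v : Fin n) : Prop :=
  (netOf G s).dom r v = true

/-- The computed transmitters of the Go step of block `r`. -/
def Go (G : SimpleGraph (Fin n)) (s : Fin n) (r : ℕ) (v : Fin n) : Prop :=
  (netOf G s).go r v = true

/-- The computed state at the beginning of block `r`. -/
noncomputable def stateAt (G : SimpleGraph (Fin n)) (s : Fin n) (r : ℕ) : BlockState :=
  (netOf G s).blockAt r

theorem inf_zero {v : Fin n} : (stateAt G s 0).Inf v ↔ v = s := by
  simp only [stateAt, Net.blockAt, loopN, Net.blockInit, BlockState.Inf, nodes_netOf, getD_tab_fin,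
    isSource_netOf]

theorem flag_zero {v : Fin n} : (stateAt G s 0).Flag v ↔ v = s := by
  simp only [stateAt, Net.blockAt, loopN, Net.blockInit, BlockState.Flag, nodes_netOf, getD_tab_fin,
    isSource_netOf]

theorem stateAt_succ (r : ℕ) :
    stateAt G s (r + 1) = (netOf G s).blockStep (stateAt G s r) r := rfl

theorem inf_succ (hG : G.Connected) {r : ℕ} {u : Fin n} : (stateAt G s (r + 1)).Inf u ↔
    (stateAt G s r).Inf u ∨ G.dist s u % 3 = (r + 1) % 3 ∧
      ((∃! w, G.Adj u w ∧ Dom G s r w) ∨ ∃! w, G.Adj u w ∧ Go G s r w) := by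
  rw [stateAt_succ]
  simp only [BlockState.Inf, Net.blockStep, Net.nextInformed, nodes_netOf, getD_tab_fin,
    Bool.or_eq_true, Bool.and_eq_true, receiver_netOf hG, hearsOne_netOf]
  rfl

theorem inf_mono (hG : G.Connected) {r r' : ℕ} (h : r ≤ r') {v : Fin n}
    (hv : (stateAt G s r).Inf v) : (stateAt G s r').Inf v := by
  induction h with
  | refl => exact hv
  | step _ ih => exact (inf_succ hG).2 (.inl ih)

theorem flag_succ_of_active (hG : G.Connected) {r : ℕ} {v : Fin n}
    (h : G.dist s v % 3 = r % 3) : (stateAt G s (r + 1)).Flag v ↔ Dom G s r v := by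
  rw [stateAt_succ]
  simp only [BlockState.Flag, Net.blockStep, nodes_netOf, getD_tab_fin, decide_eq_true_eq,
    lev_netOf hG, h, if_true]
  rfl

theorem flag_succ_of_not_active (hG : G.Connected) {r : ℕ} {v : Fin n}
    (h : G.dist s v % 3 ≠ r % 3) : (stateAt G s (r + 1)).Flag v ↔
      (stateAt G s r).Flag v ∨ ¬ (stateAt G s r).Inf v ∧ (stateAt G s (r + 1)).Inf v := by
  rw [stateAt_succ]
  simp only [BlockState.Flag, BlockState.Inf, Net.blockStep, nodes_netOf, getD_tab_fin,
    decide_eq_true_eq, lev_netOf hG, h, if_false, Bool.or_eq_true, Bool.and_eq_true,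
    Bool.not_eq_true', ← Bool.not_eq_true]

/-- Every uninformed node with an informed neighbour on the preceding level has a flagged one. -/
def Flagged (G : SimpleGraph (Fin n)) (s : Fin n) (S : BlockState) : Prop :=
  (∀ v : Fin n, S.Flag v → S.Inf v) ∧
  ∀ u w : Fin n, ¬ S.Inf u → S.Inf w → G.Adj w u → G.dist s u = G.dist s w + 1 →
    ∃ w' : Fin n, S.Flag w' ∧ G.dist s w' % 3 = G.dist s w % 3 ∧ G.Adj w' u

theorem Flagged.frontier {S : BlockState} (hS : Flagged G s S) {r : ℕ} {u : Fin n}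
    (hu : Frontier G s S r u) : ∃ w, S.Flag w ∧ G.dist s w % 3 = r % 3 ∧ G.Adj w u := by
  obtain ⟨h1, h2, w, h3, h4, h5⟩ := hu
  obtain ⟨w', h6, h7, h8⟩ := hS.2 u w h1 h3 h4 h5
  exact ⟨w', h6, by omega, h8⟩

/-- Pruning is harmless because the dominating set still covers the frontier of the active levels,
while other levels lose no flags. Newly informed nodes are flagged themselves, so new frontier nodes
are covered too. -/
theorem flagged (hG : G.Connected) (r : ℕ) : Flagged G s (stateAt G s r) := by
  induction r with
  | zero =>
    refine ⟨fun v hv => inf_zero.2 (flag_zero.1 hv), fun u w _ hw hadj _ => ?_⟩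
    exact ⟨w, flag_zero.2 (inf_zero.1 hw), rfl, hadj⟩
  | succ r ih =>
    obtain ⟨h1, h2, h3⟩ := domTable_spec hG (r := r) fun u hu => ih.frontier hu
    refine ⟨fun v hv => ?_, fun u w hu hw hadj hd => ?_⟩
    · by_cases h : G.dist s v % 3 = r % 3
      · exact inf_mono hG (Nat.le_succ r) (ih.1 v (h1 v ((flag_succ_of_active hG h).1 hv)).1)
      · rcases (flag_succ_of_not_active hG h).1 hv with h4 | h4
        · exact inf_mono hG (Nat.le_succ r) (ih.1 v h4)
        · exact h4.2
    · have hu' : ¬ (stateAt G s r).Inf u := fun h => hu (inf_mono hG (Nat.le_succ r) h)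
      by_cases hw' : (stateAt G s r).Inf w
      · by_cases h : G.dist s w % 3 = r % 3
        · obtain ⟨x, hx, hxu⟩ := h2 u ⟨hu', by omega, w, hw', hadj, hd⟩
          have hxl := (h1 x hx).2
          exact ⟨x, (flag_succ_of_active hG hxl).2 hx, by omega, hxu⟩
        · obtain ⟨x, hx, hxl, hxu⟩ := ih.2 u w hu' hw' hadj hd
          exact ⟨x, (flag_succ_of_not_active hG (by omega)).2 (.inl hx), hxl, hxu⟩
      · have hl : G.dist s w % 3 = (r + 1) % 3 := (((inf_succ hG).1 hw).resolve_left hw').1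
        exact ⟨w, (flag_succ_of_not_active hG (by omega)).2 (.inr ⟨hw', hw⟩), rfl, hadj⟩

theorem dom_spec (hG : G.Connected) (r : ℕ) :
    (∀ v, Dom G s r v → (stateAt G s r).Flag v ∧ G.dist s v % 3 = r % 3) ∧
    (∀ u, Frontier G s (stateAt G s r) r u → ∃ w, Dom G s r w ∧ G.Adj w u) ∧
    ∀ v, Dom G s r v → ∃ u, Frontier G s (stateAt G s r) r u ∧
      ∀ w, Dom G s r w → (G.Adj w u ↔ w = v) :=
  domTable_spec hG fun _ hu => (flagged hG r).frontier hu

theorem isSlow_iff {r : ℕ} : isSlow r = true ↔ 3 ≤ r % 6 := by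
  simp [isSlow]

theorem go_of_slow {r : ℕ} (hr : 3 ≤ r % 6) {v : Fin n} :
    Go G s r v ↔ ((netOf G s).slowTable (stateAt G s r) r).getD v false = true := by
  rw [Go, Net.go, Net.goTable, if_pos (isSlow_iff.2 hr)]
  rfl

theorem go_of_fast (hG : G.Connected) {r : ℕ} (hr : r % 6 < 3) {v : Fin n} :
    Go G s r v ↔ Dom G s r v ∧ ∃ u : Fin n, Frontier G s (stateAt G s r) r u ∧
      (netOf G s).fastEdge u = true ∧ (netOf G s).due u = r + 1 ∧
      (netOf G s).helper (stateAt G s r) r u = v := by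
  rw [Go, Net.go, Net.goTable, if_neg (by rw [isSlow_iff]; omega), Net.fastTable, nodes_netOf,
    getD_tab_fin]
  simp only [Bool.and_eq_true, any_iff, decide_eq_true_eq, frontier_netOf hG, and_assoc]
  rfl

theorem go_dom (hG : G.Connected) {r : ℕ} {v : Fin n} (hv : Go G s r v) : Dom G s r v := by
  by_cases hr : 3 ≤ r % 6
  · exact slowTable_subset ((go_of_slow hr).1 hv)
  · exact ((go_of_fast hG (by omega)).1 hv).1

theorem helper_spec {r : ℕ} {u : Fin n} (h : ∃ w, Dom G s r w ∧ G.Adj w u) :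
    ∃ w : Fin n, (netOf G s).helper (stateAt G s r) r u = w ∧ Dom G s r w ∧ G.Adj w u := by
  rw [Net.helper, nodes_netOf]
  refine find_spec_iff (fun w => ?_) h
  rw [Bool.and_eq_true, adj_netOf]
  rfl

theorem adj_level {r : ℕ} {w u : Fin n} (hw : G.dist s w % 3 = r % 3)
    (hu : G.dist s u % 3 = (r + 1) % 3) (h : G.Adj w u) : G.dist s u = G.dist s w + 1 := by
  have := h.diff_dist_adj (u := s)
  omega

theorem exists_feedback (hG : G.Connected) (s : Fin n) : ∃ fb : ℕ → Fin n → Fin n,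
    (∀ r v, Dom G s r v → (netOf G s).feedback r v = fb r v) ∧
    ∀ r v, Dom G s r v → ¬ (stateAt G s r).Inf (fb r v) ∧
      G.dist s (fb r v) = G.dist s v + 1 ∧ ∀ w, Dom G s r w → (G.Adj w (fb r v) ↔ w = v) := by
  have h : ∀ r v, Dom G s r v → ∃ u : Fin n, (netOf G s).feedback r v = u ∧
      (Frontier G s (stateAt G s r) r u ∧ G.Adj v u ∧ ∀ w, Dom G s r w → G.Adj w u → w = v) := by
    intro r v hv
    rw [Net.feedback, nodes_netOf]
    refine find_spec_iff (fun u => ?_) ?_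
    · simp only [Bool.and_eq_true, all_iff, Bool.or_eq_true, Bool.not_eq_true', ← Bool.not_eq_true,
        decide_eq_true_eq, adj_netOf, Fin.val_inj, ← imp_iff_not_or, and_assoc, and_imp]
      rw [frontier_netOf hG]
      rfl
    · obtain ⟨u, h1, h2⟩ := (dom_spec hG r).2.2 v hv
      exact ⟨u, h1, (h2 v hv).2 rfl, fun w hw => (h2 w hw).1⟩
  have : Nonempty (Fin n) := ⟨s⟩
  choose! fb h1 h2 using h
  refine ⟨fb, h1, fun r v hv => ?_⟩
  obtain ⟨h3, h4, h5⟩ := h2 r v hv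
  refine ⟨h3.1, adj_level ((dom_spec hG r).1 v hv).2 h3.2.1 h4, fun w hw => ⟨h5 w hw, ?_⟩⟩
  rintro rfl
  exact h4

theorem schedule (hG : G.Connected) {fb : ℕ → Fin n → Fin n}
    (hfb : ∀ r v, Dom G s r v → ¬ (stateAt G s r).Inf (fb r v) ∧
      G.dist s (fb r v) = G.dist s v + 1 ∧ ∀ w, Dom G s r w → (G.Adj w (fb r v) ↔ w = v)) :
    Schedule G s (fun r => (stateAt G s r).Inf) (Dom G s) (Go G s) fb where
  init _ := inf_zero
  step _ _ := inf_succ hG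
  dom_inf r v hv := ⟨(flagged hG r).1 v ((dom_spec hG r).1 v hv).1, ((dom_spec hG r).1 v hv).2⟩
  cover r u w hu hw hadj hd hl := (dom_spec hG r).2.1 u ⟨hu, by omega, w, hw, hadj, hd⟩
  feedback := hfb
  go_dom _ _ hv := go_dom hG hv
  persist r v hv hi := by
    obtain ⟨h1, h2⟩ := (dom_spec hG (r + 3)).1 v hv
    -- The blocks `r + 1` and `r + 2` are not active for `v`, and `v` is not newly informed there,
    -- so its flag stems from block `r`.
    have h3 := ((flag_succ_of_not_active hG (r := r + 2) (by omega)).1 h1).resolve_right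
      fun h => h.1 (inf_mono hG (by omega) hi)
    have h4 := ((flag_succ_of_not_active hG (r := r + 1) (by omega)).1 h3).resolve_right
      fun h => h.1 (inf_mono hG (by omega) hi)
    exact (flag_succ_of_active hG (by omega)).1 h4

/-! ### The slow part of the Go steps -/

theorem mark_succ (hG : G.Connected) {r : ℕ} {u : Fin n} : (stateAt G s (r + 1)).Mark u ↔
    (stateAt G s r).Mark u ∨ 3 ≤ r % 6 ∧ Frontier G s (stateAt G s r) r u ∧
      ¬ ∃ v, (stateAt G s r).Mark v ∧ ¬ (stateAt G s r).Inf v ∧ G.dist s v % 3 = (r + 1) % 3 := by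
  rw [stateAt_succ]
  simp only [BlockState.Mark, Net.blockStep, Net.targetTable, nodes_netOf, getD_tab_fin,
    Bool.or_eq_true, Bool.and_eq_true, isSlow_iff, Bool.not_eq_true', ← Bool.not_eq_true, any_iff,
    Net.pending, receiver_netOf hG, frontier_netOf hG, and_assoc, BlockState.Inf]
  refine or_congr_right (and_congr_right fun _ => ?_)
  rw [and_comm]

open Classical in
/-- The uninformed marked nodes of the levels receiving in block `r`. -/
noncomputable def pendingSet (G : SimpleGraph (Fin n)) (s : Fin n) (r : ℕ) : Finset (Fin n) :=
  Finset.univ.filter fun u => (stateAt G s r).Mark u ∧ ¬ (stateAt G s r).Inf u ∧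
    G.dist s u % 3 = (r + 1) % 3

theorem mem_targets (hG : G.Connected) {r : ℕ} {u : Fin n} :
    u ∈ targets G s (stateAt G s r) r ↔ (stateAt G s (r + 1)).Mark u ∧
      ¬ (stateAt G s r).Inf u ∧ G.dist s u % 3 = (r + 1) % 3 := by
  simp only [targets, Finset.mem_filter, Finset.mem_univ, true_and, Net.isTarget, Bool.and_eq_true,
    receiver_netOf hG, Bool.not_eq_true', ← Bool.not_eq_true, and_assoc]
  rfl

theorem mem_pendingSet {r : ℕ} {u : Fin n} : u ∈ pendingSet G s r ↔ (stateAt G s r).Mark u ∧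
    ¬ (stateAt G s r).Inf u ∧ G.dist s u % 3 = (r + 1) % 3 := by
  simp [pendingSet]

theorem targets_of_pending (hG : G.Connected) {r : ℕ} (h : (pendingSet G s r).Nonempty) :
    targets G s (stateAt G s r) r = pendingSet G s r := by
  obtain ⟨x, hx⟩ := h
  rw [mem_pendingSet] at hx
  ext u
  rw [mem_targets hG, mem_pendingSet, mark_succ hG]
  refine and_congr_left fun _ => or_iff_left fun h => h.2.2 ⟨x, hx⟩

theorem targets_of_no_pending (hG : G.Connected) {r : ℕ} (hr : 3 ≤ r % 6)
    (h : pendingSet G s r = ∅) {u : Fin n} (hu : Frontier G s (stateAt G s r) r u) :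
    u ∈ targets G s (stateAt G s r) r := by
  rw [mem_targets hG, mark_succ hG]
  refine ⟨.inr ⟨hr, hu, ?_⟩, hu.1, hu.2.1⟩
  rintro ⟨v, hv⟩
  rw [← mem_pendingSet, h] at hv
  exact absurd hv (Finset.notMem_empty v)

theorem mark_frontier (hG : G.Connected) (r : ℕ) (u : Fin n) (hu : (stateAt G s r).Mark u) :
    ∃ w, (stateAt G s r).Inf w ∧ G.Adj w u ∧ G.dist s u = G.dist s w + 1 := by
  induction r with
  | zero =>
    simp only [stateAt, Net.blockAt, loopN, Net.blockInit, BlockState.Mark, nodes_netOf,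
      getD_tab_fin, Bool.false_eq_true] at hu
  | succ r ih =>
    rcases (mark_succ hG).1 hu with h | ⟨-, h, -⟩
    · obtain ⟨w, h1, h2⟩ := ih h
      exact ⟨w, inf_mono hG (Nat.le_succ r) h1, h2⟩
    · obtain ⟨w, h1, h2⟩ := h.2.2
      exact ⟨w, inf_mono hG (Nat.le_succ r) h1, h2⟩

theorem mark_mono (hG : G.Connected) {r r' : ℕ} (h : r ≤ r') {v : Fin n}
    (hv : (stateAt G s r).Mark v) : (stateAt G s r').Mark v := by
  induction h with
  | refl => exact hv
  | step _ ih => exact (mark_succ hG).2 (.inl ih)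

/-- Until the next slow block for the same levels, targets are only lost, and at least the
fraction `1 / (⌊log₂ n⌋ + 1)` of them is. -/
theorem card_pendingSet_le (hG : G.Connected) {r : ℕ} (hr : 3 ≤ r % 6) :
    (pendingSet G s (r + 6)).card * (Nat.log 2 n + 1) ≤
      (targets G s (stateAt G s r) r).card * (Nat.log 2 n + 1 - 1) := by
  classical
  set m := Nat.log 2 n + 1 with hm
  have hdom : ∀ u ∈ targets G s (stateAt G s r) r, ∃ w : Fin n,
      ((netOf G s).domTable (stateAt G s r) r).getD w false = true ∧ G.Adj w u := by
    intro u hu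
    rw [mem_targets hG] at hu
    have hfr : Frontier G s (stateAt G s r) r u := by
      refine ⟨hu.2.1, hu.2.2, ?_⟩
      rcases (mark_succ hG).1 hu.1 with h | h
      · exact mark_frontier hG r u h
      · exact h.2.1.2.2
    exact (dom_spec hG r).2.1 u hfr
  have h1 := slowTable_spec hdom
  rw [← hm] at h1
  have hsub : pendingSet G s (r + 6) ⊆ targets G s (stateAt G s r) r \
      uniq G (targets G s (stateAt G s r) r) (tableSet ((netOf G s).slowTable (stateAt G s r) r)) := by
    intro u hu
    rw [mem_pendingSet] at hu
    obtain ⟨h2, h3, h4⟩ := hu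
    have h5 : ∀ j < 6, ¬ (stateAt G s (r + j)).Inf u := fun j hj h => h3 (inf_mono hG (by omega) h)
    -- No further node of these levels is marked before block `r + 6`: the only other block with the
    -- same receivers is `r + 3`, a fast one.
    have hback : ∀ j < 5, (stateAt G s (r + j + 2)).Mark u → (stateAt G s (r + j + 1)).Mark u := by
      intro j hj h
      rcases (mark_succ hG).1 h with h | ⟨h6, h7, -⟩
      · exact h
      · have := h7.2.1
        omega
    have h6 := hback 0 (by omega) <| hback 1 (by omega) <| hback 2 (by omega) <|
      hback 3 (by omega) <| hback 4 (by omega) h2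
    rw [Finset.mem_sdiff, mem_targets hG]
    refine ⟨⟨h6, h5 0 (by omega), by omega⟩, fun h7 => h5 1 (by omega) ?_⟩
    rw [uniq, Finset.mem_filter] at h7
    refine (inf_succ hG).2 (.inr ⟨by omega, .inr ?_⟩)
    simpa only [mem_tableSet, go_of_slow hr] using h7.2
  have h2 := Finset.card_le_card hsub
  have h3 : uniq G (targets G s (stateAt G s r) r)
      (tableSet ((netOf G s).slowTable (stateAt G s r) r)) ⊆ targets G s (stateAt G s r) r :=
    Finset.filter_subset _ _
  rw [Finset.card_sdiff_of_subset h3] at h2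
  have h4 := Finset.card_le_card h3
  rw [Nat.add_sub_cancel]
  set t := (targets G s (stateAt G s r) r).card
  set x := (uniq G (targets G s (stateAt G s r) r)
      (tableSet ((netOf G s).slowTable (stateAt G s r) r))).card
  have h5 := Nat.mul_le_mul_right m h2
  rw [Nat.sub_mul] at h5
  have h6 : t * m = t * Nat.log 2 n + t := by rw [hm]; ring
  omega

/-- A node with an informed neighbour on the preceding level is informed after two rounds of
slow blocks. -/
theorem slow_wait (hG : G.Connected) {r₀ : ℕ} {p v : Fin n} (hp : (stateAt G s r₀).Inf p)
    (hadj : G.Adj p v) (hd : G.dist s v = G.dist s p + 1) :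
    (stateAt G s (r₀ + 18 * ((Nat.log 2 n + 1) * (Nat.log 2 n + 1)))).Inf v := by
  by_contra hno
  set m := Nat.log 2 n + 1 with hm
  have hn : n ≠ 0 := by rintro rfl; exact s.elim0
  have hmm : 1 ≤ m * m := Nat.mul_pos (by omega) (by omega)
  -- The first slow block from `r₀` on in which the level of `p` is active, that is, with residue `3
  -- + G.dist s p % 3` mod 6.
  obtain ⟨r, hr1, hr2, hr3, hr4⟩ : ∃ r, r₀ ≤ r ∧ r ≤ r₀ + 5 ∧ 3 ≤ r % 6 ∧
      G.dist s p % 3 = r % 3 :=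
    ⟨r₀ + (9 + G.dist s p % 3 - r₀ % 6) % 6, by omega, by omega, by omega, by omega⟩
  have hslow : ∀ i, 3 ≤ (r + 6 * i) % 6 := fun i => by omega
  have hfr : ∀ i ≤ 2 * (m * m), Frontier G s (stateAt G s (r + 6 * i)) (r + 6 * i) v := by
    intro i hi
    exact ⟨fun h => hno (inf_mono hG (by omega) h), by omega, p,
      inf_mono hG (by omega) hp, hadj, hd⟩
  have hcard : ∀ A : Finset (Fin n), A.card < 2 ^ m := fun A =>
    ((Finset.card_le_univ A).trans (by simp)).trans_lt (Nat.lt_pow_succ_log_self (by norm_num) n)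
  have hstep : ∀ i, (pendingSet G s (r + 6 * (i + 1))).card * m ≤
      (targets G s (stateAt G s (r + 6 * i)) (r + 6 * i)).card * (m - 1) := fun i =>
    card_pendingSet_le hG (hslow i)
  -- The batch in progress is exhausted after at most `m * m` slow blocks; as long as it is not,
  -- targets and pending nodes coincide and decay.
  obtain ⟨i, hi, hempty⟩ : ∃ i ≤ m * m, pendingSet G s (r + 6 * i) = ∅ := by
    by_contra hall
    push Not at hall
    have h0 := eq_zero_of_decay (m := m) (by omega) (q := fun i => (pendingSet G s (r + 6 * i)).card)
      (hcard _) fun j hj => by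
        have := hstep j
        rwa [targets_of_pending hG (hall j hj.le)] at this
    exact (hall (m * m) le_rfl).ne_empty (Finset.card_eq_zero.1 h0)
  have hv : v ∈ targets G s (stateAt G s (r + 6 * i)) (r + 6 * i) :=
    targets_of_no_pending hG (hslow i) hempty (hfr i (by omega))
  -- From now on `v` belongs to the batch. While it is uninformed no other batch is opened, so
  -- another `m * m` slow blocks exhaust this one. In all, `5 + 12 m²` blocks, at most `18 m²`.
  have hv' : ∀ j, 1 ≤ j → i + j ≤ 2 * (m * m) → v ∈ pendingSet G s (r + 6 * (i + j)) := by
    intro j hj hle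
    have h1 := ((mem_targets hG).1 hv).1
    have h2 := hfr (i + j) hle
    exact mem_pendingSet.2 ⟨mark_mono hG (by omega) h1, h2.1, h2.2.1⟩
  have h0 := eq_zero_of_decay (m := m) (by omega)
    (q := fun j => (targets G s (stateAt G s (r + 6 * (i + j))) (r + 6 * (i + j))).card)
    (hcard _) fun j hj => by
      have := hstep (i + j)
      rwa [add_assoc i j 1, ← targets_of_pending hG ⟨v, hv' (j + 1) (by omega) (by omega)⟩] at this
  have h1 := hv' (m * m) hmm (by omega)
  rw [← targets_of_pending hG ⟨v, h1⟩, Finset.card_eq_zero.1 h0] at h1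
  exact absurd h1 (Finset.notMem_empty v)

end trajectory

/-! ### The computed labels -/

section labels
variable {n : ℕ} {G : SimpleGraph (Fin n)} {s : Fin n}

theorem maxHeight_netOf : (netOf G s).maxHeight = (netOf G s).height s := by
  rw [Net.maxHeight, nodes_netOf]
  obtain ⟨i, hi, rfl⟩ := find_spec_iff (fun i => isSource_netOf (G := G) (s := s) (i := i)) ⟨s, rfl⟩
  rw [hi]

theorem due_netOf (hG : G.Connected) (v : Fin n) : (netOf G s).due v =
    G.dist s v + ((G.dist s v - 1) - (G.dist s v - 1) % 3) +
      18 * ((Nat.log 2 n + 1) * (Nat.log 2 n + 1)) *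
        ((netOf G s).height s - (netOf G s).height v) := by
  rw [Net.due, lev_netOf hG, logSize_netOf, maxHeight_netOf]

/-- Every node `v` is informed before block `(netOf G s).due v`. -/
theorem inf_due (hG : G.Connected) {P : Fin n → Fin n}
    (hP : ∀ u : Fin n, (netOf G s).parent u = P u)
    (hT : IsTwoHRT G s P (fun v => (netOf G s).height v))
    (hH : HeightSpec s P (fun v : Fin n => (netOf G s).height v)) (v : Fin n) :
    (stateAt G s ((netOf G s).due v)).Inf v := by
  induction hd : G.dist s v generalizing v with
  | zero =>
    obtain rfl := (hG.dist_eq_zero_iff).1 hd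
    exact inf_mono hG (Nat.zero_le _) (inf_zero.2 rfl)
  | succ l ih =>
    have hv : v ≠ s := by
      rintro rfl
      rw [SimpleGraph.dist_self] at hd
      omega
    have hadj := hT.bfs.adj v hv
    have hlev := hT.bfs.level v hv
    have hp := ih (P v) (by omega)
    have hle := hH.le_parent hv
    have hroot := hH.le_root hT.bfs
    have hrp := hroot (P v)
    have hdp := due_netOf (s := s) hG (P v)
    have hdv := due_netOf (s := s) hG v
    rcases Nat.eq_or_lt_of_le hle with hfast | hslow
    · rw [← hfast] at hdp
      set X := 18 * ((Nat.log 2 n + 1) * (Nat.log 2 n + 1)) *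
        ((netOf G s).height s - (netOf G s).height v) with hX
      -- The waiting times are multiples of 6, so the residue of the due block depends only on the
      -- level.
      have hX6 : X % 6 = 0 := by
        rw [hX, show 18 = 6 * 3 from rfl, mul_assoc, mul_assoc]
        exact Nat.mul_mod_right 6 _
      obtain ⟨r, hr⟩ : ∃ r, (netOf G s).due v = r + 1 := ⟨(netOf G s).due v - 1, by omega⟩
      have hpr : (stateAt G s r).Inf (P v) := inf_mono hG (by omega) hp
      rw [hr]
      by_cases hi : (stateAt G s r).Inf v
      · exact inf_mono hG (Nat.le_succ r) hi
      -- With `l = G.dist s v - 1`, up to multiples of 6 the block `r` is `l + (l - l % 3)`, hence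
      -- `l % 3`: a fast block in which the level of the parent is active.
      have hr6 : r % 6 < 3 := by omega
      have hvr : G.dist s v % 3 = (r + 1) % 3 := by omega
      have hfr : Frontier G s (stateAt G s r) r v := ⟨hi, hvr, P v, hpr, hadj, hlev⟩
      have hfe : ∀ u : Fin n, (netOf G s).fastEdge u = true ↔
          IsFastEdge s P (fun v => (netOf G s).height v) u := by
        intro u
        rw [Net.fastEdge, Bool.and_eq_true, Bool.not_eq_true', ← Bool.not_eq_true, isSource_netOf,
          decide_eq_true_eq, hP, IsFastEdge]
      have hvf : IsFastEdge s P (fun v => (netOf G s).height v) v := ⟨hv, hfast⟩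
      obtain ⟨w, hw1, hw2, hw3⟩ := helper_spec ((dom_spec hG r).2.1 v hfr)
      refine (inf_succ hG).2 (.inr ⟨hvr, .inr ⟨w, ⟨hw3.symm, (go_of_fast hG hr6).2
        ⟨hw2, v, hfr, (hfe v).2 hvf, hr, hw1⟩⟩, ?_⟩⟩)
      -- Any transmitter `x` near `v` serves some `u`. Both `u` and `v` lie one level below `x` and
      -- are due at the same time, so their heights agree, and the respecting property forces `u =
      -- v`.
      rintro x ⟨hx1, hx2⟩
      obtain ⟨hx3, u, hu, huf, hud, hux⟩ := (go_of_fast hG hr6).1 hx2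
      have hxl := ((dom_spec hG r).1 x hx3).2
      obtain ⟨y, hy1, hy2, hy3⟩ := helper_spec ((dom_spec hG r).2.1 u hu)
      obtain rfl : x = y := Fin.ext (by rw [← hux, hy1])
      have hlv := adj_level hxl hvr hx1.symm
      have hlu := adj_level hxl hu.2.1 hy3
      have hhu : (netOf G s).height u = (netOf G s).height v := by
        have hdu := due_netOf (s := s) hG u
        have h2 : (18 * ((Nat.log 2 n + 1) * (Nat.log 2 n + 1))) *
            ((netOf G s).height s - (netOf G s).height u) = X := by
          rw [hlu, ← hlv] at hdu
          omega
        have h3 := Nat.eq_of_mul_eq_mul_left (by positivity) h2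
        have h4 := hroot u
        have h5 := hroot v
        omega
      have huv : u = v := by
        by_contra hne
        exact hT.respecting u v hne ((hfe u).1 huf) hvf (by omega) hhu ⟨x, hy3, hx1.symm, hlu⟩
      subst huv
      exact Fin.ext (by rw [← hux, hw1])
    · refine inf_mono hG ?_ (slow_wait hG hp hadj hlev)
      obtain ⟨j, hj⟩ : ∃ j, (netOf G s).height s - (netOf G s).height v =
          ((netOf G s).height s - (netOf G s).height (P v)) + (j + 1) :=
        ⟨(netOf G s).height (P v) - (netOf G s).height v - 1, by omega⟩
      generalize 18 * ((Nat.log 2 n + 1) * (Nat.log 2 n + 1)) = K at *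
      rw [hj, mul_add, mul_add, mul_one] at hdv
      omega

theorem height_le (v : Fin n) : (netOf G s).height v ≤ n := by
  have h : ∀ k, ((netOf G s).treeAt k).2.getD v 0 ≤ n := by
    intro k
    cases k with
    | zero => simp [Net.treeAt, loopN, Net.treeInit, -List.getD_eq_getElem?_getD]
    | succ k =>
      have h1 : (netOf G s).treeAt (k + 1) = (netOf G s).treeStep ((netOf G s).treeAt k) := rfl
      rw [h1]
      simp only [Net.treeStep, nodes_netOf, getD_tab_fin]
      exact min_le_left _ _
  exact h _

/-- A dominating node has an uninformed feedback node, and by `inf_due` there are none left after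
`blocks` blocks. Hence the bounded searches in the label bits miss nothing. -/
theorem dom_lt_blocks (hG : G.Connected) {fb : ℕ → Fin n → Fin n}
    (hfb : ∀ r v, Dom G s r v → ¬ (stateAt G s r).Inf (fb r v) ∧
      G.dist s (fb r v) = G.dist s v + 1 ∧ ∀ w, Dom G s r w → (G.Adj w (fb r v) ↔ w = v))
    {r : ℕ} {v : Fin n} (hv : Dom G s r v) : r < (netOf G s).blocks := by
  obtain ⟨P, hP, hT, hH⟩ := exists_tree (s := s) hG
  have h1 := inf_due hG hP hT hH (fb r v)
  by_contra hlt
  refine (hfb r v hv).1 (inf_mono hG (le_trans ?_ (not_lt.1 hlt)) h1)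
  rw [due_netOf hG, Net.blocks, nodes_netOf, logSize_netOf]
  have h2 := dist_lt_card (s := s) hG (fb r v)
  have h3 := Nat.mul_le_mul_left (18 * ((Nat.log 2 n + 1) * (Nat.log 2 n + 1)))
    ((Nat.sub_le _ ((netOf G s).height (fb r v))).trans (height_le (G := G) (s := s) s))
  omega

/-- The labels found by the program. -/
noncomputable def labelOf (G : SimpleGraph (Fin n)) (s v : Fin n) : List Bool :=
  (netOf G s).labels.getD v []

theorem labelOf_eq (v : Fin n) : labelOf G s v =
    [(netOf G s).joinBit v, decide ((netOf G s).lev v % 3 = 1), decide ((netOf G s).lev v % 3 = 2),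
    (netOf G s).stayBit v, (netOf G s).goBit v, false, false] := by
  rw [labelOf, Net.labels, nodes_netOf, getD_tab_fin]

/-- The bits are disjunctions over all blocks; each is pinned down by uniqueness, of the block in
which a node is informed for Join, and of the pair served by a feedback node for Stay and Go. -/
theorem prescribes (hG : G.Connected) {fb : ℕ → Fin n → Fin n}
    (hfb : ∀ r v, Dom G s r v → (netOf G s).feedback r v = fb r v)
    (hfb' : ∀ r v, Dom G s r v → ¬ (stateAt G s r).Inf (fb r v) ∧
      G.dist s (fb r v) = G.dist s v + 1 ∧ ∀ w, Dom G s r w → (G.Adj w (fb r v) ↔ w = v)) :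
    Prescribes G s (labelOf G s) (fun r => (stateAt G s r).Inf) (Dom G s) (Go G s) fb := by
  have hS := schedule hG hfb'
  have hR := fun r v => dom_lt_blocks hG hfb' (r := r) (v := v)
  have hjoin : ∀ v, labelJoin (labelOf G s v) = true ↔
      ∃ r, Dom G s r v ∧ (r = 0 ∨ ¬ (stateAt G s (r - 1)).Inf v) := by
    intro v
    rw [labelOf_eq, labelJoin, List.getD_cons_zero, Net.joinBit, any_eq_true]
    simp only [Bool.and_eq_true, Bool.or_eq_true, decide_eq_true_eq, Bool.not_eq_true',
      ← Bool.not_eq_true]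
    exact ⟨fun ⟨r, _, h⟩ => ⟨r, h⟩, fun ⟨r, h⟩ => ⟨r, hR r v h.1, h⟩⟩
  have hstay : ∀ u : Fin n, (netOf G s).stayBit u = true ↔
      ∃ r v, Dom G s r v ∧ fb r v = u ∧ Dom G s (r + 3) v := by
    intro u
    rw [Net.stayBit, any_eq_true]
    simp only [nodes_netOf, any_iff, Bool.and_eq_true, decide_eq_true_eq, and_assoc]
    constructor
    · rintro ⟨r, _, v, h1, h2, h3⟩
      exact ⟨r, v, h1, Fin.ext (by rw [← hfb r v h1, h2]), h3⟩
    · rintro ⟨r, v, h1, h2, h3⟩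
      exact ⟨r, hR r v h1, v, h1, by rw [hfb r v h1, h2], h3⟩
  have hgo : ∀ u : Fin n, (netOf G s).goBit u = true ↔
      ∃ r v, Dom G s r v ∧ fb r v = u ∧ Go G s r v := by
    intro u
    rw [Net.goBit, any_eq_true]
    simp only [nodes_netOf, any_iff, Bool.and_eq_true, decide_eq_true_eq, and_assoc]
    constructor
    · rintro ⟨r, _, v, h1, h2, h3⟩
      exact ⟨r, v, h1, Fin.ext (by rw [← hfb r v h1, h2]), h3⟩
    · rintro ⟨r, v, h1, h2, h3⟩
      exact ⟨r, hR r v h1, v, h1, by rw [hfb r v h1, h2], h3⟩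
  have horders : ∀ v, labelOrders (labelOf G s v) =
      ⟨(netOf G s).stayBit v, (netOf G s).goBit v, false, false⟩ := by
    intro v
    rw [labelOf_eq]
    rfl
  refine ⟨fun v => ?_, ?_, fun r v h1 h2 => ?_, fun r v hv => ?_, fun r v hv => ?_,
    fun v => by rw [horders], fun v => by rw [horders], fun u hu => ?_⟩
  · rw [labelOf_eq, lev_netOf hG]
    have h3 : G.dist s v % 3 < 3 := Nat.mod_lt _ (by norm_num)
    unfold labelLev
    generalize G.dist s v % 3 = l at h3
    interval_cases l <;> rfl
  · rw [hjoin]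
    constructor
    · rintro ⟨r, hr, rfl | h⟩
      · exact hr
      · exact absurd (inf_mono hG (Nat.zero_le _) (inf_zero.2 rfl)) h
    · exact fun h => ⟨0, h, .inl rfl⟩
  · rw [hjoin]
    constructor
    · rintro ⟨q, hq, h⟩
      have h3 := (hS.dom_inf q v hq).1
      rcases q with _ | q
      · exact absurd (inf_mono hG (Nat.zero_le _) h3) h1
      · have h4 := h.resolve_left (Nat.succ_ne_zero q)
        rwa [hS.block_eq h1 h2 h4 h3]
    · exact fun h => ⟨r + 1, h, .inr h1⟩
  · rw [horders, hstay]
    constructor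
    · rintro ⟨q, w, h1, h2, h3⟩
      obtain ⟨rfl, rfl⟩ := hS.feedback_inj h1 hv h2
      exact h3
    · exact fun h => ⟨r, v, hv, rfl, h⟩
  · rw [horders, hgo]
    constructor
    · rintro ⟨q, w, h1, h2, h3⟩
      obtain ⟨rfl, rfl⟩ := hS.feedback_inj h1 hv h2
      exact h3
    · exact fun h => ⟨r, v, hv, rfl, h⟩
  · rw [horders, Orders.zero, Orders.mk.injEq]
    refine ⟨?_, ?_, rfl, rfl⟩
    · rw [← Bool.not_eq_true, hstay]
      rintro ⟨r, v, h1, h2, -⟩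
      exact hu r v h1 h2
    · rw [← Bool.not_eq_true, hgo]
      rintro ⟨r, v, h1, h2, -⟩
      exact hu r v h1 h2

/-! ### Polynomial time -/

theorem esize_netOf_le : esize (netOf G s) ≤ n * (4 * n + 2) + 4 * n + 3 := by
  have h1 : esize (netOf G s).1 ≤ n * (4 * n + 2) + 1 := by
    refine (esize_list_le (B := 4 * n + 1) fun a ha => ?_).trans (by simp [netOf])
    simp only [netOf, List.mem_ofFn] at ha
    obtain ⟨i, rfl⟩ := ha
    exact esize_boolTable.trans (by simp)
  have h2 : esize (netOf G s).2 ≤ 4 * n + 1 := esize_boolTable.trans (by simp [netOf])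
  have h3 : esize (netOf G s) = 1 + esize (netOf G s).1 + esize (netOf G s).2 := rfl
  omega

theorem enc_labels : Enc.enc (netOf G s).labels = encodeLabels (labelOf G s) := by
  have h1 : (netOf G s).labels = List.ofFn (labelOf G s) := by
    apply List.ext_getElem
    · simp [Net.labels]
    · intro i h2 h3
      rw [List.getElem_ofFn, labelOf, List.getD_eq_getElem]
  rw [h1]
  simp only [encodeLabels, Enc.enc, List.map_ofFn, Function.comp_def]

theorem isPolyTimeScheme : IsPolyTimeScheme fun _ G s => labelOf G s := by
  have h : PolyTime fun N : Net => N.labels := by fun_prop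
  obtain ⟨p, P, hp⟩ := h
  refine ⟨p, P.comp (Polynomial.X * (4 * Polynomial.X + 2) + 4 * Polynomial.X + 3),
    fun n G s _ => ?_⟩
  obtain ⟨t, h1, h2, -⟩ := hp (netOf G s)
  rw [enc_netOf, enc_labels] at h1
  refine ⟨t, h2.trans ?_, h1⟩
  rw [Polynomial.eval_comp]
  refine eval_nat_mono P (esize_netOf_le.trans (le_of_eq ?_))
  simp

/-! ### The number of rounds -/

theorem due_le_ultimateBlock (hG : G.Connected)
    (hroot : 2 ^ (netOf G s).height s ≤ n) (v : Fin n) :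
    (netOf G s).due v ≤ ultimateBlock G s (fun v : Fin n => (netOf G s).height v) v := by
  rw [due_netOf hG, ultimateBlock, Fintype.card_fin]
  rcases Nat.eq_zero_or_pos ((netOf G s).height s - (netOf G s).height v) with h0 | h0
  · rw [h0, mul_zero, mul_zero]
    omega
  -- A positive height difference forces `n ≥ 2`, so the logarithm is at least 1 and can absorb the
  -- `+ 1` in `m`.
  have hn : 2 ≤ n := by
    refine le_trans ?_ hroot
    exact Nat.le_self_pow (n := (netOf G s).height s) (by omega) 2
  have hL : 1 ≤ Nat.log 2 n := Nat.log_pos (by norm_num) hn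
  have h1 : Nat.log 2 n ^ 2 ≤ ⌈Real.logb 2 n ^ 2⌉₊ := by
    have h2 : ((Nat.log 2 n ^ 2 : ℕ) : ℝ) ≤ ⌈Real.logb 2 n ^ 2⌉₊ := by
      refine le_trans ?_ (Nat.le_ceil _)
      push_cast
      gcongr
      exact_mod_cast Real.natLog_le_logb n 2
    exact_mod_cast h2
  -- `(L + 1)² ≤ 4 L²` for `L ≥ 1`, and `18 * 4 = 72 ≤ 90 = 3 * 30`.
  have h2 : 18 * ((Nat.log 2 n + 1) * (Nat.log 2 n + 1)) ≤ 90 * ⌈Real.logb 2 n ^ 2⌉₊ := by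
    nlinarith
  have h3 := Nat.mul_le_mul_right ((netOf G s).height s - (netOf G s).height v) h2
  have h4 : 3 * (30 * ⌈Real.logb 2 n ^ 2⌉₊ * ((netOf G s).height s - (netOf G s).height v)) =
    90 * ⌈Real.logb 2 n ^ 2⌉₊ * ((netOf G s).height s - (netOf G s).height v) := by ring
  omega

theorem rounds_le (hroot : 2 ^ (netOf G s).height s ≤ n) {D : ℕ}
    (hD : (netOf G s).height s ≤ D) :
    ((5 * (2 * D + 18 * ((Nat.log 2 n + 1) * (Nat.log 2 n + 1)) * (netOf G s).height s) : ℕ) : ℝ) ≤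
      360 * ((D : ℝ) + min (D : ℝ) (Real.logb 2 n) * Real.logb 2 n ^ 2) := by
  have hn1 : 1 ≤ n := Nat.one_le_two_pow.trans hroot
  have hlog0 : 0 ≤ Real.logb 2 n := Real.logb_nonneg (by norm_num) (by exact_mod_cast hn1)
  have hmin0 : 0 ≤ min (D : ℝ) (Real.logb 2 n) := le_min (Nat.cast_nonneg D) hlog0
  push_cast
  rcases Nat.eq_zero_or_pos ((netOf G s).height s) with h0 | h0
  -- With height 0 the slow term vanishes; this covers `n = 1`, where the logarithm is 0 and cannot
  -- bound `m`.
  · rw [h0]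
    have : 0 ≤ min (D : ℝ) (Real.logb 2 n) * Real.logb 2 n ^ 2 := by positivity
    have : (0 : ℝ) ≤ D := Nat.cast_nonneg D
    push_cast
    linarith
  have hh : ((netOf G s).height s : ℝ) ≤ Real.logb 2 n := by
    rw [Real.le_logb_iff_rpow_le (by norm_num) (by exact_mod_cast hn1), Real.rpow_natCast]
    exact_mod_cast hroot
  have hh1 : (1 : ℝ) ≤ (netOf G s).height s := by exact_mod_cast h0
  have hmin : ((netOf G s).height s : ℝ) ≤ min (D : ℝ) (Real.logb 2 n) :=
    le_min (by exact_mod_cast hD) hh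
  have hL : (Nat.log 2 n : ℝ) ≤ Real.logb 2 n := by exact_mod_cast Real.natLog_le_logb n 2
  have hL0 : (0 : ℝ) ≤ Nat.log 2 n := Nat.cast_nonneg _
  -- Here `n ≥ 2` again; the constant is `360 = 5 * 18 * 4`, with five rounds per block.
  have h1 : ((Nat.log 2 n : ℝ) + 1) * (Nat.log 2 n + 1) ≤ 4 * Real.logb 2 n ^ 2 := by nlinarith
  have h2 : ((Nat.log 2 n : ℝ) + 1) * (Nat.log 2 n + 1) * (netOf G s).height s ≤
      4 * Real.logb 2 n ^ 2 * min (D : ℝ) (Real.logb 2 n) :=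
    mul_le_mul h1 hmin (by linarith) (by positivity)
  have : (0 : ℝ) ≤ D := Nat.cast_nonneg D
  nlinarith

end labels

/-! ### The theorem -/

theorem theorem4p7 :
    ∃ L : (n : ℕ) → SimpleGraph (Fin n) → Fin n → Fin n → List Bool,
      IsPolyTimeScheme L ∧
      (∀ (n : ℕ) (G : SimpleGraph (Fin n)) (s v : Fin n), (L n G s v).length ≤ 7) ∧
      ∃ C : ℝ, ∀ (n : ℕ) (G : SimpleGraph (Fin n)) (s : Fin n), G.Connected →
        ∀ (M : Type) (μ : M),
          (∃ (parent : Fin n → Fin n) (h : Fin n → ℕ) (fb : ℕ → Fin n → Fin n)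
              (rescuer : Fin n → Fin n),
            FollowsFastScheme G (L n G s) s μ parent h fb rescuer ∧
            ∀ v, InformedBefore G (L n G s) s μ (ultimateBlock G s h v + 1) v) ∧
          ∃ T : ℕ,
            (T : ℝ) ≤ C * ((G.diam : ℝ) +
              min (G.diam : ℝ) (Real.logb 2 n) * (Real.logb 2 n) ^ 2) ∧
            ∀ v, (fastBroadcast M).known ((fastBroadcast M).run G (L n G s) s μ T v) = some μ := by
  refine ⟨fun _ G s => labelOf G s, isPolyTimeScheme, fun n G s v => (congrArg List.length (labelOf_eq v)).le, 360,
    fun n G s hG M μ => ?_⟩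
  obtain ⟨P, hP, hT, hH⟩ := exists_tree (s := s) hG
  obtain ⟨fb, hfb, hfb'⟩ := exists_feedback hG s
  have hS := schedule hG hfb'
  have hL := prescribes hG hfb hfb'
  have hroot := hH.two_pow_root_le
  rw [Fintype.card_fin] at hroot
  have hdue := inf_due hG hP hT hH
  have hult : ∀ v, (stateAt G s (ultimateBlock G s (fun v : Fin n => (netOf G s).height v) v)).Inf v :=
    fun v => inf_mono hG (due_le_ultimateBlock hG hroot v) (hdue v)
  have : Nonempty (Fin n) := ⟨s⟩
  have hdiam : ∀ v, G.dist s v ≤ G.diam := fun v =>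
    SimpleGraph.dist_le_diam (SimpleGraph.connected_iff_ediam_ne_top.1 hG)
  refine ⟨⟨P, _, fb, id, hS.follows hL hT hult, fun v => ?_⟩,
    -- Five rounds for each of the blocks up to the largest possible due block: the level part of
    -- `due` is at most twice the level, and the height difference is at most `h s`.
    5 * (2 * G.diam + 18 * ((Nat.log 2 n + 1) * (Nat.log 2 n + 1)) * (netOf G s).height s),
    rounds_le hroot ?_, fun v => ?_⟩
  · exact (hS.informedBefore_iff hL).2 (inf_mono hG (Nat.le_succ _) (hult v))
  · have := hH.add_dist_le hT.bfs hdiam s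
    omega
  · have h1 := (hS.blockInv (μ := μ) hL (2 * G.diam +
      18 * ((Nat.log 2 n + 1) * (Nat.log 2 n + 1)) * (netOf G s).height s) v).2.1
    rw [if_pos] at h1
    · exact h1
    · refine inf_mono hG ?_ (hdue v)
      rw [due_netOf hG]
      have h2 := hdiam v
      have h3 := Nat.mul_le_mul_left (18 * ((Nat.log 2 n + 1) * (Nat.log 2 n + 1)))
        (Nat.sub_le ((netOf G s).height s) ((netOf G s).height v))
      omega
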